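/- **Conventions.** All Hilbert spaces are complex and $\otimes$ is the Hilbert space tensor product. A *probabilistic channel* from $\mathcal H$ to $\mathcal K$ is a linear, completely positive, trace non-increasing map $\mathcal E$ from the trace class operators on $\mathcal H$ to those on $\mathcal K$; it is *deterministic* if it preserves the trace. For a state (density operator) $\rho$ on $\mathcal H\otimes\mathcal S$ put $t(\mathcal E|\rho)=\mathrm{Tr}\,(\mathcal E\otimes\mathbb 1)[\rho]$; the output state is $(\mathcal E\otimes\mathbb 1)[\rho]/t(\mathcal E|\rho)$ (the maximally mixed state, by convention, if $t(\mathcal E|\rho)=0$). $F(\rho,\sigma)=\bigl(\mathrm{Tr}\sqrt{\sqrt\rho\,\sigma\sqrt\rho}\bigr)^2$ is the Uhlmann fidelity. For channels $\mathcal E_1,\mathcal E_2$ from $\mathcal H_i$ to $\mathcal H_o$ (finite-dimensional) and a maximally entangled state $\Phi_+$ of $\mathcal H_i\otimes\mathcal H_i$, $\mathcal F_J(\mathcal E_1,\mathcal E_2)$ is the fidelity of the two output states for the input $\Phi_+$, and $\mathcal F_\diamond(\mathcal E_1,\mathcal E_2)$ is the infimum, taken in $[0,1]$, of the fidelities of the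 two output states over all pure input states $\phi$ of $\mathcal H_i\otimes\mathcal H_i$ with $t(\mathcal E_1|\phi)\ne0$ and $t(\mathcal E_2|\phi)\neq 0$. **Statement.** Let $\mathcal H_{\mathcal A_1},\mathcal H_{\mathcal A_2},\mathcal H_{\mathcal B}$ be Hilbert spaces of arbitrary dimension, let $\mathcal H_i,\mathcal H_o$ be finite-dimensional Hilbert spaces, $d=\dim\mathcal H_i$, and let $\Gamma^{\mathcal A_1}:\mathcal H_{\mathcal A_1}\to\mathcal H_{\mathcal A_1}\otimes\mathcal H_i$, $\Gamma^{\mathcal A_2}:\mathcal H_{\mathcal A_2}\to\mathcal H_{\mathcal A_2}\otimes\mathcal H_i$, $\Gamma^{\mathcal B}:\mathcal H_{\mathcal B}\to\mathcal H_{\mathcal B}\otimes\mathcal H_o$ be isometries. For $\mathcal P=\mathcal A_1,\mathcal A_2,\mathcal B$ put $\Lambda^{\mathcal P}[X]=\mathrm{Tr}_{\mathcal P}(\Gamma^{\mathcal P}X\Gamma^{\mathcal P\dagger})$. Then there are a finite-dimensional Hilbert space $\mathcal H_i^{ext}$, an encoding isometry $\Gamma_i:\mathcal H_{\mathcal A_1}\otimes\mathcal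 H_i\to\mathcal H_{\mathcal A_1}\otimes\mathcal H_i^{ext}$ which inverts $\Gamma^{\mathcal A_1}$, in the sense that for some unit vector $e\in\mathcal H_i^{ext}$ one has $\Gamma_i\Gamma^{\mathcal A_1}x=x\otimes e$ for all $x\in\mathcal H_{\mathcal A_1}$, and a decoding isometry, $\Gamma_o=\Gamma^{\mathcal B}$, with the following property. For every state $\Phi_i$ on $\mathcal H_{\mathcal A_1}\otimes\mathcal H_{\mathcal A_2}$ and every maximally entangled state $\Phi_+$ of $\mathcal H_i\otimes\mathcal H_i$ there is a state $\rho_{\mathcal A_1}$ on $\mathcal H_{\mathcal A_1}$ such that, for every probabilistic channel $\mathcal E$ from $\mathcal H_{\mathcal A_1}$ to $\mathcal H_{\mathcal B}$ with $t:=t(\mathcal E|\Phi_i)\neq0$ and every deterministic channel $\mathcal E_0$ from $\mathcal H_i$ to $\mathcal H_o$, the following holds. Put $$F^i=F\bigl((\Lambda^{\mathcal A_1}\otimes\Lambda^{\mathcal A_2})[\Phi_i],\Phi_+\bigr),\qquad F^o=F\bigl((\Lambda^{\mathcal B}\otimes\Lambda^{\mathcal A_2})[(\mathcal E\otimes\mathbb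 1)[\Phi_i]/t],(\mathcal E_0\otimes\mathbb 1)[\Phi_+]\bigr),$$ $C^i=\sqrt{1-F^i}$, $C^o=\sqrt{1-F^o}$, and let $\mathcal E_{i,o}[\rho]=\mathrm{Tr}_{ext}\bigl((\Gamma_o\circ\mathcal E\circ\Gamma_i)[\rho_{\mathcal A_1}\otimes\rho]\bigr)$ be the extracted channel from $\mathcal H_i$ to $\mathcal H_o$, where $\Gamma_o\circ\mathcal E$ acts on $\mathcal H_{\mathcal A_1}$ and the trace is over $\mathcal H_i^{ext}$ and $\mathcal H_{\mathcal B}$. Then $$\sqrt{1-\mathcal F_\diamond(\mathcal E_{i,o},\mathcal E_0)}\le d\,\sqrt{1-\mathcal F_J(\mathcal E_{i,o},\mathcal E_0)},$$ and if $C^i\le t$ and $\arcsin(C^i/t)+\arcsin C^o\le\pi/2$, then $$d\,\sqrt{1-\mathcal F_J(\mathcal E_{i,o},\mathcal E_0)}\le d\,\sin\bigl(\arcsin(C^i/t)+\arcsin C^o\bigr),$$ and, if moreover $d=2$, $\ \mathcal F_\diamond(\mathcal E_{i,o},\mathcal E_0)\ge1-4\sin^2\bigl(\arcsin(C^i/t)+\arcsin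 C^o\bigr)$. -/

import Mathlib

open scoped TensorProduct

set_option linter.unusedSectionVars false

noncomputable section

namespace ChannelCert

universe u v w

/-! ### Hilbert spaces: trace, states, Uhlmann fidelity -/

section Trace

variable (H : Type u) [NormedAddCommGroup H] [InnerProductSpace ℂ H] [CompleteSpace H]

/-- The index set of a fixed Hilbert basis of `H`. -/
def basisIndex : Set H := (exists_hilbertBasis ℂ H).choose

/-- A fixed Hilbert basis of `H`. The trace below does not depend on this choice. -/
def basis : HilbertBasis (basisIndex H) ℂ H := (exists_hilbertBasis ℂ H).choose_spec.choose

variable {H}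

/-- The trace of an operator, `∑ ⟨b, T b⟩` over a Hilbert basis. It is used for trace class
operators only, for which the series converges absolutely. -/
def trace (T : H →L[ℂ] H) : ℂ := ∑' i, inner ℂ (basis H i) (T (basis H i))

variable (H) in
/-- The trace class operators on `H`: the linear span of the positive operators of finite trace. -/
def traceClass : Submodule ℂ (H →L[ℂ] H) :=
  Submodule.span ℂ
    {P | P.IsPositive ∧ Summable fun i => inner ℂ (basis H i) (P (basis H i))}

/-- Density operators: positive operators of trace one. -/
def IsState (ρ : H →L[ℂ] H) : Prop :=
  ρ.IsPositive ∧ HasSum (fun i => inner ℂ (basis H i) (ρ (basis H i))) 1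

/-- Uhlmann fidelity `F(ρ, σ) = (Tr √(√ρ σ √ρ))²`. -/
def fidelity (ρ σ : H →L[ℂ] H) : ℝ :=
  (trace (CFC.sqrt (CFC.sqrt ρ * σ * CFC.sqrt ρ))).re ^ 2

/-- The projector `|φ⟩⟨φ|`. -/
def pureState (φ : H) : H →L[ℂ] H := InnerProductSpace.rankOne ℂ φ φ

end Trace

/-! ### Hilbert space tensor products -/

/-- The Hilbert space tensor product: the completion of the algebraic tensor product for the
inner product `⟨a ⊗ b, a' ⊗ b'⟩ = ⟨a, a'⟩ ⟨b, b'⟩`. -/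
abbrev HTensor (H : Type u) (K : Type v) [NormedAddCommGroup H] [InnerProductSpace ℂ H]
    [NormedAddCommGroup K] [InnerProductSpace ℂ K] : Type (max u v) :=
  UniformSpace.Completion (H ⊗[ℂ] K)

section Tensor

variable {H : Type u} {K : Type v} {L : Type w}
  [NormedAddCommGroup H] [InnerProductSpace ℂ H]
  [NormedAddCommGroup K] [InnerProductSpace ℂ K]
  [NormedAddCommGroup L] [InnerProductSpace ℂ L]

/-- The elementary tensor `a ⊗ b`. -/
def tmul (a : H) (b : K) : HTensor H K := ((a ⊗ₜ[ℂ] b : H ⊗[ℂ] K) : HTensor H K)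

/-- The operator `a ↦ a ⊗ b`. -/
def tmulRight (b : K) : H →L[ℂ] HTensor H K :=
  UniformSpace.Completion.toComplL.comp ((TensorProduct.mkL ℂ H K).flip b)

/-- The operator `b ↦ a ⊗ b`. -/
def tmulLeft (a : H) : K →L[ℂ] HTensor H K :=
  UniformSpace.Completion.toComplL.comp (TensorProduct.mkL ℂ H K a)

@[simp] theorem tmulRight_apply (a : H) (b : K) : tmulRight b a = tmul a b := rfl

@[simp] theorem tmulLeft_apply (a : H) (b : K) : tmulLeft a b = tmul a b := rfl

theorem inner_tmul_tmul (a a' : H) (b b' : K) :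
    inner ℂ (tmul a b) (tmul a' b') = inner ℂ a a' * inner ℂ b b' := by
  simp [tmul]

variable [CompleteSpace H] [CompleteSpace K] [CompleteSpace L]

/-- The block `(1 ⊗ ⟨s|) X (1 ⊗ |s'⟩)` of an operator on `H ⊗ K`, an operator on `H`. -/
def blockRight (s s' : K) (X : HTensor H K →L[ℂ] HTensor H K) : H →L[ℂ] H :=
  (ContinuousLinearMap.adjoint (tmulRight s)).comp (X.comp (tmulRight s'))

/-- The block `(⟨s| ⊗ 1) X (|s'⟩ ⊗ 1)` of an operator on `H ⊗ K`, an operator on `K`. -/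
def blockLeft (s s' : H) (X : HTensor H K →L[ℂ] HTensor H K) : K →L[ℂ] K :=
  (ContinuousLinearMap.adjoint (tmulLeft s)).comp (X.comp (tmulLeft s'))

theorem inner_blockRight (s s' : K) (X : HTensor H K →L[ℂ] HTensor H K) (a a' : H) :
    inner ℂ a (blockRight s s' X a') = inner ℂ (tmul a s) (X (tmul a' s')) := by
  simp [blockRight, ContinuousLinearMap.adjoint_inner_right]

theorem inner_blockLeft (s s' : H) (X : HTensor H K →L[ℂ] HTensor H K) (b b' : K) :
    inner ℂ b (blockLeft s s' X b') = inner ℂ (tmul s b) (X (tmul s' b')) := by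
  simp [blockLeft, ContinuousLinearMap.adjoint_inner_right]

/-- An operator on `H ⊗ K` is determined by its matrix elements between elementary tensors. -/
theorem ext_tmul {X Y : HTensor H K →L[ℂ] HTensor H K}
    (h : ∀ a a' b b', inner ℂ (tmul a b) (X (tmul a' b')) = inner ℂ (tmul a b) (Y (tmul a' b'))) :
    X = Y := by
  have key : ∀ (ξ : HTensor H K), (∀ (a : H) (b : K), inner ℂ (tmul a b) ξ = 0) → ξ = 0 := by
    intro ξ hξ
    have h1 : ∀ η : HTensor H K, inner ℂ η ξ = 0 := by
      intro η
      induction η using UniformSpace.Completion.induction_on with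
      | hp => exact isClosed_eq (by fun_prop) continuous_const
      | ih x =>
        induction x using TensorProduct.induction_on with
        | zero => exact inner_zero_left ξ
        | tmul a b => exact hξ a b
        | add x y hx hy =>
          rw [UniformSpace.Completion.coe_add, inner_add_left, hx, hy, add_zero]
    exact inner_self_eq_zero.mp (h1 ξ)
  have h2 : ∀ a' b', X (tmul a' b') = Y (tmul a' b') := by
    intro a' b'
    rw [← sub_eq_zero]
    refine key _ fun a b => ?_
    rw [inner_sub_right, h, sub_self]
  ext ξ
  induction ξ using UniformSpace.Completion.induction_on with
  | hp => exact isClosed_eq (by fun_prop) (by fun_prop)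
  | ih x =>
    induction x using TensorProduct.induction_on with
    | zero => exact (map_zero X).trans (map_zero Y).symm
    | tmul a b => exact h2 a b
    | add x y hx hy => rw [UniformSpace.Completion.coe_add, map_add, map_add, hx, hy]

theorem ext_blockRight {X Y : HTensor H K →L[ℂ] HTensor H K}
    (h : ∀ s s', blockRight s s' X = blockRight s s' Y) : X = Y :=
  ext_tmul fun a a' b b' => by rw [← inner_blockRight, ← inner_blockRight, h]

theorem ext_blockLeft {X Y : HTensor H K →L[ℂ] HTensor H K}
    (h : ∀ s s', blockLeft s s' X = blockLeft s s' Y) : X = Y :=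
  ext_tmul fun a a' b b' => by rw [← inner_blockLeft, ← inner_blockLeft, h]

/-- Partial trace over the second factor (norm convergent for trace class `X`). -/
def ptraceRight (X : HTensor H K →L[ℂ] HTensor H K) : H →L[ℂ] H :=
  ∑' i, blockRight (basis K i) (basis K i) X

/-- Partial trace over the first factor (norm convergent for trace class `X`). -/
def ptraceLeft (X : HTensor H K →L[ℂ] HTensor H K) : K →L[ℂ] K :=
  ∑' i, blockLeft (basis H i) (basis H i) X

/-- The map `X ↦ Γ X Γ†` on operators. -/
def conj (Γ : H →ₗᵢ[ℂ] K) (X : H →L[ℂ] H) : K →L[ℂ] K :=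
  Γ.toContinuousLinearMap.comp (X.comp (ContinuousLinearMap.adjoint Γ.toContinuousLinearMap))

/-- The operator `S ⊗ T` on `H ⊗ K`, for finite-dimensional `K`. -/
def tensorOp [FiniteDimensional ℂ K] (S : H →L[ℂ] H) (T : K →L[ℂ] K) :
    HTensor H K →L[ℂ] HTensor H K :=
  ∑ i, (tmulRight (T (stdOrthonormalBasis ℂ K i))).comp
    (S.comp (ContinuousLinearMap.adjoint (tmulRight (stdOrthonormalBasis ℂ K i))))

theorem tensorOp_tmul [FiniteDimensional ℂ K] (S : H →L[ℂ] H) (T : K →L[ℂ] K) (a : H) (b : K) :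
    tensorOp S T (tmul a b) = tmul (S a) (T b) := by
  have h1 : ∀ s : K, ContinuousLinearMap.adjoint (tmulRight s) (tmul a b) = inner ℂ s b • a := by
    intro s
    refine ext_inner_left ℂ fun x => ?_
    rw [ContinuousLinearMap.adjoint_inner_right, tmulRight_apply, inner_tmul_tmul,
      inner_smul_right, mul_comm]
  have h2 : T b = ∑ i, inner ℂ (stdOrthonormalBasis ℂ K i) b • T (stdOrthonormalBasis ℂ K i) := by
    conv_lhs => rw [← (stdOrthonormalBasis ℂ K).sum_repr' b]
    simp
  rw [h2, ← tmulLeft_apply (S a)]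
  simp only [tensorOp, sum_apply, ContinuousLinearMap.comp_apply, h1, map_smul,
    map_sum, tmulRight_apply, tmulLeft_apply]

/-! ### Maps on operators and their action on one part of a bipartite system -/

open Classical in
/-- The operator `(E ⊗ 1)[X]` on `L ⊗ K`: the unique operator whose blocks along `K` are the images
under `E` of the blocks of `X`. -/
def ampLeft (E : (H →L[ℂ] H) → (L →L[ℂ] L)) (X : HTensor H K →L[ℂ] HTensor H K) :
    HTensor L K →L[ℂ] HTensor L K :=
  if h : ∃ Y : HTensor L K →L[ℂ] HTensor L K,
      ∀ s s' : K, blockRight s s' Y = E (blockRight s s' X) then h.choose else 0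

open Classical in
/-- The operator `(1 ⊗ E)[X]` on `K ⊗ L`: the unique operator whose blocks along `K` are the images
under `E` of the blocks of `X`. -/
def ampRight (E : (H →L[ℂ] H) → (L →L[ℂ] L)) (X : HTensor K H →L[ℂ] HTensor K H) :
    HTensor K L →L[ℂ] HTensor K L :=
  if h : ∃ Y : HTensor K L →L[ℂ] HTensor K L,
      ∀ s s' : K, blockLeft s s' Y = E (blockLeft s s' X) then h.choose else 0

theorem ampLeft_eq {E : (H →L[ℂ] H) → (L →L[ℂ] L)} {X : HTensor H K →L[ℂ] HTensor H K}
    {Y : HTensor L K →L[ℂ] HTensor L K}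
    (hY : ∀ s s' : K, blockRight s s' Y = E (blockRight s s' X)) : ampLeft E X = Y := by
  have h : ∃ Y : HTensor L K →L[ℂ] HTensor L K,
      ∀ s s' : K, blockRight s s' Y = E (blockRight s s' X) := ⟨Y, hY⟩
  rw [ampLeft, dif_pos h]
  exact ext_blockRight fun s s' => by rw [h.choose_spec, hY]

theorem ampRight_eq {E : (H →L[ℂ] H) → (L →L[ℂ] L)} {X : HTensor K H →L[ℂ] HTensor K H}
    {Y : HTensor K L →L[ℂ] HTensor K L}
    (hY : ∀ s s' : K, blockLeft s s' Y = E (blockLeft s s' X)) : ampRight E X = Y := by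
  have h : ∃ Y : HTensor K L →L[ℂ] HTensor K L,
      ∀ s s' : K, blockLeft s s' Y = E (blockLeft s s' X) := ⟨Y, hY⟩
  rw [ampRight, dif_pos h]
  exact ext_blockLeft fun s s' => by rw [h.choose_spec, hY]

open scoped ComplexOrder in
/-- Positivity of the operator matrix `(T i j)` as an operator on `H ⊗ ℂⁿ`. -/
def IsPositiveMatrix {n : ℕ} (T : Fin n → Fin n → (H →L[ℂ] H)) : Prop :=
  ∀ x : Fin n → H, 0 ≤ ∑ i, ∑ j, inner ℂ (x i) (T i j (x j))

/-- Quantum channels in the general sense (probabilistic channels): linear, completely positive,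
trace non-increasing maps from the trace class operators on `H` to those on `L`. The values of `E`
outside the trace class play no role. -/
structure IsChannel (E : (H →L[ℂ] H) → (L →L[ℂ] L)) : Prop where
  map_add : ∀ S ∈ traceClass H, ∀ T ∈ traceClass H, E (S + T) = E S + E T
  map_smul : ∀ c : ℂ, ∀ T ∈ traceClass H, E (c • T) = c • E T
  map_traceClass : ∀ T ∈ traceClass H, E T ∈ traceClass L
  completely_positive : ∀ (n : ℕ) (T : Fin n → Fin n → (H →L[ℂ] H)),
    (∀ i j, T i j ∈ traceClass H) → IsPositiveMatrix T → IsPositiveMatrix fun i j => E (T i j)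
  trace_le : ∀ T ∈ traceClass H, T.IsPositive → (trace (E T)).re ≤ (trace T).re

/-- Deterministic channels: completely positive trace preserving maps. -/
structure IsDeterministicChannel (E : (H →L[ℂ] H) → (L →L[ℂ] L)) : Prop extends IsChannel E where
  trace_eq : ∀ T ∈ traceClass H, trace (E T) = trace T

/-- The transmissivity `t(E|ρ) = Tr (E ⊗ 1)[ρ]`. -/
def transmissivity (E : (H →L[ℂ] H) → (L →L[ℂ] L)) (ρ : HTensor H K →L[ℂ] HTensor H K) : ℝ :=
  (trace (ampLeft E ρ)).re

open Classical in
/-- The output state `(E ⊗ 1)[ρ] / t(E|ρ)`, with the convention that it is the maximally mixed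
state if `t(E|ρ) = 0`. -/
def outputState (E : (H →L[ℂ] H) → (L →L[ℂ] L)) (ρ : HTensor H K →L[ℂ] HTensor H K) :
    HTensor L K →L[ℂ] HTensor L K :=
  if transmissivity E ρ = 0 then ((Module.finrank ℂ (HTensor L K) : ℂ)⁻¹) • 1
  else ((transmissivity E ρ : ℂ)⁻¹) • ampLeft E ρ

/-- Maximally entangled vectors `(1/√d) ∑ₖ eₖ ⊗ fₖ`, with `e` and `f` orthonormal bases. -/
def IsMaximallyEntangled (φ : HTensor H H) : Prop :=
  ∃ e f : OrthonormalBasis (Fin (Module.finrank ℂ H)) ℂ H,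
    φ = ((Real.sqrt (Module.finrank ℂ H) : ℂ)⁻¹) • ∑ k, tmul (e k) (f k)

/-- The Choi-Jamiolkowski fidelity of two channels, with respect to the maximally entangled
vector `φ`. -/
def choiFidelity (φ : HTensor H H) (E₁ E₂ : (H →L[ℂ] H) → (L →L[ℂ] L)) : ℝ :=
  fidelity (outputState E₁ (pureState φ)) (outputState E₂ (pureState φ))

/-- The diamond fidelity of two channels: the infimum of the fidelities of the output states over
the pure states of `H ⊗ H` that are transmitted with nonzero probability by both channels. The
infimum is taken in `[0, 1]`, so it is `1` if there is no such pure state. -/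
def diamondFidelity (E₁ E₂ : (H →L[ℂ] H) → (L →L[ℂ] L)) : ℝ :=
  sInf (insert 1 {x : ℝ | ∃ φ : HTensor H H, ‖φ‖ = 1 ∧ transmissivity E₁ (pureState φ) ≠ 0 ∧
    transmissivity E₂ (pureState φ) ≠ 0 ∧
    x = fidelity (outputState E₁ (pureState φ)) (outputState E₂ (pureState φ))})

/-- The map `Λ[X] = Tr_P (Γ X Γ†)` attached to an isometry `Γ : P → P ⊗ H`. -/
def localExtraction (Γ : K →ₗᵢ[ℂ] HTensor K H) (X : K →L[ℂ] K) : H →L[ℂ] H :=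
  ptraceLeft (conj Γ X)

/-- The fidelity `Fⁱ` of `(Λ₁ ⊗ Λ₂)[Φ]` to the pure state `φ`, with `Λ₁`, `Λ₂` attached to the
isometries `Γ₁`, `Γ₂`. -/
def inputFidelity (Γ₁ : H →ₗᵢ[ℂ] HTensor H L) (Γ₂ : K →ₗᵢ[ℂ] HTensor K L)
    (Φ : HTensor H K →L[ℂ] HTensor H K) (φ : HTensor L L) : ℝ :=
  fidelity (ampLeft (localExtraction Γ₁) (ampRight (localExtraction Γ₂) Φ)) (pureState φ)

end Tensor

section Extraction

variable {A B Hi Ho Ei : Type*}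
  [NormedAddCommGroup A] [InnerProductSpace ℂ A] [CompleteSpace A]
  [NormedAddCommGroup B] [InnerProductSpace ℂ B] [CompleteSpace B]
  [NormedAddCommGroup Hi] [InnerProductSpace ℂ Hi] [CompleteSpace Hi] [FiniteDimensional ℂ Hi]
  [NormedAddCommGroup Ho] [InnerProductSpace ℂ Ho] [CompleteSpace Ho]
  [NormedAddCommGroup Ei] [InnerProductSpace ℂ Ei] [CompleteSpace Ei]

/-- The channel extracted from `E`, namely `ρ ↦ Tr_ext ((Γo ∘ E ∘ Γi)[ρA ⊗ ρ])`. Here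
`Γi : A ⊗ Hi → A ⊗ Ei` is the encoding isometry, `Γo : B → B ⊗ Ho` the decoding isometry, the map
`Γo ∘ E` acts on the factor `A`, and the trace is taken over `Ei` and `B`. -/
def extractedChannel (Γi : HTensor A Hi →ₗᵢ[ℂ] HTensor A Ei) (Γo : B →ₗᵢ[ℂ] HTensor B Ho)
    (ρA : A →L[ℂ] A) (E : (A →L[ℂ] A) → (B →L[ℂ] B)) (ρ : Hi →L[ℂ] Hi) : Ho →L[ℂ] Ho :=
  ptraceLeft (ptraceRight (ampLeft (fun X => conj Γo (E X)) (conj Γi (tensorOp ρA ρ))))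

/-- The fidelity `Fᵒ` of `(ΛB ⊗ Λ₂)[(E ⊗ 1)[Φ] / t(E|Φ)]` to `(E₀ ⊗ 1)[φ]`, with `ΛB`, `Λ₂` attached
to the isometries `ΓB`, `Γ₂`. -/
def outputFidelity {A₂ : Type*} [NormedAddCommGroup A₂] [InnerProductSpace ℂ A₂] [CompleteSpace A₂]
    (ΓB : B →ₗᵢ[ℂ] HTensor B Ho) (Γ₂ : A₂ →ₗᵢ[ℂ] HTensor A₂ Hi)
    (E : (A →L[ℂ] A) → (B →L[ℂ] B)) (E₀ : (Hi →L[ℂ] Hi) → (Ho →L[ℂ] Ho))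
    (Φ : HTensor A A₂ →L[ℂ] HTensor A A₂) (φ : HTensor Hi Hi) : ℝ :=
  fidelity (ampLeft (localExtraction ΓB) (ampRight (localExtraction Γ₂) (outputState E Φ)))
    (ampLeft E₀ (pureState φ))

end Extraction

end ChannelCert

end

/-! Purify and compare overlaps. Write the input state as `∑ᵢ |xᵢ⟩⟨xᵢ|`. The extraction on the
ancilla turns the `xᵢ` into vectors of `A₁ ⊗ Hi`, with slices `w m` along an orthonormal basis `f`
of `Hi`. Let `φₘ` be the slices of the maximally entangled vector `φ`, and let `z = ∑ₘ (1 ⊗ ⟨φₘ|) Γ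
wₘ`, with `Γ` the isometry of `A₁`. The squared norm `c²` of the family `z` is the expectation of
the extracted input state in `φ`, hence at least `Fⁱ`. The reference state is `∑ᵢ |rᵢ⟩⟨rᵢ|` with `r
= z / c`; it is chosen before the channel `E` is known. Since `Γi` is isometric and `Γi Γ w = w ⊗
e`, the encoded family `Γi (r ⊗ φₘ)` has overlap `⟨r, z⟩ = c` with the padded true input `wₘ ⊗ e`
(`exists_reference`).

Both families now pass through `E` and the decoding. Let `t` and `t'` be the output traces, and `p`
the root fidelity of the normalized outputs. Complete positivity makes the `2 × 2` operator matrix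
of outputs positive, so its off-diagonal trace `x` has `|x| ≤ √(t t') p`. Trace non-increase makes
the matrix of lost traces positive semidefinite, so `|c - x|² ≤ (1 - t)(1 - t')`. Cauchy-Schwarz
then gives `t (1 - p²) ≤ 1 - c²` (`mul_one_sub_sq_le`), which bounds the sine of the angle between
the outputs by `Cⁱ / t`. The triangle inequality for the angles `arccos √F`
(`rootFidelity_triangle`) adds the angle `arcsin Cᵒ` to the ideal output.

For the diamond fidelity, each unit vector of `Hi ⊗ Hi` is `√d (1 ⊗ K) φ` with `K` a contraction,
and `1 ⊗ K` commutes with the channels. The same loss-of-trace estimate, applied to the contraction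
`1 ⊗ K`, gives `1 - F ≤ d (1 - F_J)` (`one_sub_fidelity_le`), which is stronger than the required
bound with `d²`.

In infinite dimension everything is expressed by operators `∑ᵢ |xᵢ⟩⟨yᵢ|` with square summable `x`
and `y`. These are exactly the trace class operators, and channels commute with such series
(`IsChannel.hasSum_op`), so that `E` commutes with the extraction on an ancilla of any dimension. -/

open scoped TensorProduct

set_option linter.unusedSectionVars false

noncomputable section

namespace ChannelCert

open scoped ComplexOrder

universe u v w

/-! ### Square summable families and the operators `∑ᵢ |vᵢ⟩⟨wᵢ|` -/

section SquareSummable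

variable {H : Type u} {K : Type v} {L : Type w}
  [NormedAddCommGroup H] [InnerProductSpace ℂ H]
  [NormedAddCommGroup K] [InnerProductSpace ℂ K]
  [NormedAddCommGroup L] [InnerProductSpace ℂ L]
  {ι κ : Type*}

/-- Square summable families of vectors. -/
def SqSum (x : ι → H) : Prop := Summable fun i => ‖x i‖ ^ 2

theorem SqSum.add {x y : ι → H} (hx : SqSum x) (hy : SqSum y) : SqSum fun i => x i + y i := by
  refine Summable.of_nonneg_of_le (fun _ => sq_nonneg _) (fun i => ?_)
    ((hx.mul_left 2).add (hy.mul_left 2))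
  have h := norm_add_le (x i) (y i)
  nlinarith [sq_nonneg (‖x i‖ - ‖y i‖), norm_nonneg (x i + y i)]

theorem SqSum.smul {x : ι → H} (hx : SqSum x) (c : ℂ) : SqSum fun i => c • x i := by
  have h := hx.mul_left (‖c‖ ^ 2)
  simpa only [SqSum, norm_smul, mul_pow] using h

theorem SqSum.map {x : ι → H} (hx : SqSum x) (A : H →L[ℂ] K) : SqSum fun i => A (x i) := by
  refine Summable.of_nonneg_of_le (fun _ => sq_nonneg _) (fun i => ?_) (hx.mul_left (‖A‖ ^ 2))
  rw [← mul_pow]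
  exact pow_le_pow_left₀ (norm_nonneg _) (A.le_opNorm _) 2

theorem SqSum.sum {s : Finset κ} {x : κ → ι → H} (hx : ∀ k ∈ s, SqSum (x k)) :
    SqSum fun i => ∑ k ∈ s, x k i := by
  classical
  induction s using Finset.induction_on with
  | empty => simp [SqSum, summable_zero]
  | insert a s ha ih =>
    simp only [Finset.sum_insert ha]
    exact (hx a (by simp)).add (ih fun k hk => hx k (by simp [hk]))

theorem SqSum.comp_injective {x : ι → H} (hx : SqSum x) {f : κ → ι} (hf : Function.Injective f) :
    SqSum fun k => x (f k) :=
  Summable.comp_injective hx hf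

theorem SqSum.of_fintype [Finite ι] (x : ι → H) : SqSum x := by
  cases nonempty_fintype ι
  exact (hasSum_fintype _).summable

theorem SqSum.summable_norm_mul {x : ι → H} {y : ι → K} (hx : SqSum x) (hy : SqSum y) :
    Summable fun i => ‖x i‖ * ‖y i‖ := by
  refine Summable.of_nonneg_of_le (fun _ => by positivity) (fun i => ?_) (Summable.add hx hy)
  nlinarith [sq_nonneg (‖x i‖ - ‖y i‖), sq_nonneg ‖x i‖, sq_nonneg ‖y i‖]

theorem SqSum.summable_inner {x y : ι → H} (hx : SqSum x) (hy : SqSum y) :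
    Summable fun i => (inner ℂ (x i) (y i) : ℂ) :=
  (hx.summable_norm_mul hy).of_norm_bounded fun i => norm_inner_le_norm (x i) (y i)

theorem inner_self_eq_ofReal (x : H) : (inner ℂ x x : ℂ) = ((‖x‖ ^ 2 : ℝ) : ℂ) := by
  rw [inner_self_eq_norm_sq_to_K]
  norm_cast

theorem inner_mul_inner_symm (x y : H) :
    (inner ℂ x y : ℂ) * inner ℂ y x = ((‖(inner ℂ y x : ℂ)‖ ^ 2 : ℝ) : ℂ) := by
  rw [← inner_conj_symm x y, mul_comm, RCLike.mul_conj]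
  norm_cast

theorem HilbertBasis.hasSum_norm_sq (b : HilbertBasis κ ℂ H) (x : H) :
    HasSum (fun k => ‖(inner ℂ (b k) x : ℂ)‖ ^ 2) (‖x‖ ^ 2) := by
  have h := b.hasSum_inner_mul_inner x x
  rw [inner_self_eq_ofReal] at h
  simp only [inner_mul_inner_symm] at h
  exact_mod_cast h

theorem SqSum.basis_inner {x : ι → H} (hx : SqSum x) (b : HilbertBasis κ ℂ H) :
    Summable fun p : ι × κ => ‖(inner ℂ (b p.2) (x p.1) : ℂ)‖ ^ 2 := by
  rw [summable_prod_of_nonneg fun _ => sq_nonneg _]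
  exact ⟨fun i => (HilbertBasis.hasSum_norm_sq b (x i)).summable,
    hx.congr fun i => (HilbertBasis.hasSum_norm_sq b (x i)).tsum_eq.symm⟩

variable [CompleteSpace H] [CompleteSpace K] [CompleteSpace L]

/-- The operator `∑ᵢ |xᵢ⟩⟨yᵢ|`. -/
def op (x : ι → K) (y : ι → H) : H →L[ℂ] K := ∑' i, InnerProductSpace.rankOne ℂ (x i) (y i)

theorem hasSum_op {x : ι → K} {y : ι → H} (hx : SqSum x) (hy : SqSum y) :
    HasSum (fun i => InnerProductSpace.rankOne ℂ (x i) (y i)) (op x y) := by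
  refine Summable.hasSum (Summable.of_norm ?_)
  simpa only [InnerProductSpace.norm_rankOne] using hx.summable_norm_mul hy

theorem hasSum_op_apply {x : ι → K} {y : ι → H} (hx : SqSum x) (hy : SqSum y) (h : H) :
    HasSum (fun i => (inner ℂ (y i) h : ℂ) • x i) (op x y h) := by
  have h1 := ContinuousLinearMap.hasSum (ContinuousLinearMap.apply ℂ K h) (hasSum_op hx hy)
  simpa only [ContinuousLinearMap.apply_apply, InnerProductSpace.rankOne_apply] using h1

theorem hasSum_inner_op {x : ι → K} {y : ι → H} (hx : SqSum x) (hy : SqSum y) (k : K) (h : H) :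
    HasSum (fun i => (inner ℂ k (x i) : ℂ) * inner ℂ (y i) h) (inner ℂ k (op x y h)) := by
  have := (innerSL ℂ k).hasSum (hasSum_op_apply hx hy h)
  simpa only [innerSL_apply_apply, inner_smul_right, mul_comm] using this

theorem comp_op_comp_adjoint {H' K' : Type*} [NormedAddCommGroup H'] [InnerProductSpace ℂ H']
    [CompleteSpace H'] [NormedAddCommGroup K'] [InnerProductSpace ℂ K'] [CompleteSpace K']
    {x : ι → K} {y : ι → H} (hx : SqSum x) (hy : SqSum y) (A : K →L[ℂ] K') (B : H →L[ℂ] H') :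
    A.comp ((op x y).comp (ContinuousLinearMap.adjoint B)) =
      op (fun i => A (x i)) fun i => B (y i) := by
  refine ContinuousLinearMap.ext fun h => ?_
  have h1 := A.hasSum (hasSum_op_apply hx hy (ContinuousLinearMap.adjoint B h))
  have h2 := hasSum_op_apply (hx.map A) (hy.map B) h
  refine h1.unique (h2.congr_fun ?_)
  intro i
  simp [ContinuousLinearMap.adjoint_inner_right]

theorem op_add_left {x x' : ι → K} {y : ι → H} (hx : SqSum x) (hx' : SqSum x') (hy : SqSum y) :
    op (fun i => x i + x' i) y = op x y + op x' y :=
  (hasSum_op (hx.add hx') hy).unique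
    (((hasSum_op hx hy).add (hasSum_op hx' hy)).congr_fun fun i => by simp)

theorem op_add_right {x : ι → K} {y y' : ι → H} (hx : SqSum x) (hy : SqSum y) (hy' : SqSum y') :
    op x (fun i => y i + y' i) = op x y + op x y' :=
  (hasSum_op hx (hy.add hy')).unique
    (((hasSum_op hx hy).add (hasSum_op hx hy')).congr_fun fun i => by simp)

theorem op_smul_left (c : ℂ) {x : ι → K} {y : ι → H} (hx : SqSum x) (hy : SqSum y) :
    op (fun i => c • x i) y = c • op x y :=
  (hasSum_op (hx.smul c) hy).unique
    (((hasSum_op hx hy).const_smul c).congr_fun fun i => by simp)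

theorem op_smul_right (c : ℂ) {x : ι → K} {y : ι → H} (hx : SqSum x) (hy : SqSum y) :
    op x (fun i => c • y i) = (starRingEnd ℂ c) • op x y :=
  (hasSum_op hx (hy.smul c)).unique
    (((hasSum_op hx hy).const_smul (starRingEnd ℂ c)).congr_fun fun i => by simp)

theorem op_unique (x : K) (y : H) : op (fun _ : Unit => x) (fun _ => y) =
    InnerProductSpace.rankOne ℂ x y := by
  simp [op]

theorem isPositive_iff_inner_nonneg (T : H →L[ℂ] H) :
    T.IsPositive ↔ ∀ h, 0 ≤ (inner ℂ h (T h) : ℂ) := by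
  refine ⟨fun hT h => hT.inner_nonneg_right h, fun h => ?_⟩
  rw [ContinuousLinearMap.isPositive_iff_complex]
  intro x
  have hx := h x
  rw [RCLike.nonneg_iff] at hx
  rw [← inner_conj_symm]
  rw [RCLike.conj_eq_iff_im.mpr hx.2]
  exact ⟨RCLike.conj_eq_iff_re.mp (RCLike.conj_eq_iff_im.mpr hx.2), hx.1⟩

theorem op_self_isPositive {x : ι → H} (hx : SqSum x) : (op x x).IsPositive := by
  rw [isPositive_iff_inner_nonneg]
  intro h
  have h2 : HasSum (fun i => ((‖(inner ℂ (x i) h : ℂ)‖ ^ 2 : ℝ) : ℂ)) (inner ℂ h (op x x h)) :=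
    (hasSum_inner_op hx hx h h).congr_fun fun i => (inner_mul_inner_symm _ _).symm
  rw [← h2.tsum_eq, ← Complex.ofReal_tsum]
  exact Complex.zero_le_real.mpr (tsum_nonneg fun i => sq_nonneg _)

theorem op_sum_index {x : ι ⊕ κ → K} {y : ι ⊕ κ → H} (hx : SqSum x) (hy : SqSum y) :
    op x y = op (fun i => x (.inl i)) (fun i => y (.inl i)) +
      op (fun k => x (.inr k)) (fun k => y (.inr k)) := by
  have h1 := hasSum_op (hx.comp_injective Sum.inl_injective) (hy.comp_injective Sum.inl_injective)
  have h2 := hasSum_op (hx.comp_injective Sum.inr_injective) (hy.comp_injective Sum.inr_injective)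
  exact (hasSum_op hx hy).unique (HasSum.sum h1 h2)

/-! ### The trace -/

/-- Parseval makes the double family `⟨bₖ, xᵢ⟩⟨yᵢ, bₖ⟩` absolutely summable, so it may be summed
over `k` or over `i` first. The value does not involve `b`: this is the basis independence of the
trace. -/
theorem hasSum_basis_op {x y : ι → H} (hx : SqSum x) (hy : SqSum y) (b : HilbertBasis κ ℂ H) :
    HasSum (fun k => (inner ℂ (b k) (op x y (b k)) : ℂ)) (∑' i, inner ℂ (y i) (x i)) := by
  have hs : Summable fun p : ι × κ =>
      (inner ℂ (b p.2) (x p.1) : ℂ) * inner ℂ (y p.1) (b p.2) := by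
    refine Summable.of_norm_bounded ((hx.basis_inner b).add (hy.basis_inner b)) fun p => ?_
    rw [norm_mul, ← norm_inner_symm (b p.2) (y p.1)]
    nlinarith [sq_nonneg (‖(inner ℂ (b p.2) (x p.1) : ℂ)‖ - ‖(inner ℂ (b p.2) (y p.1) : ℂ)‖),
      sq_nonneg ‖(inner ℂ (b p.2) (x p.1) : ℂ)‖, sq_nonneg ‖(inner ℂ (b p.2) (y p.1) : ℂ)‖]
  have h1 : ∀ i, HasSum (fun k => (inner ℂ (b k) (x i) : ℂ) * inner ℂ (y i) (b k))
      (inner ℂ (y i) (x i)) := fun i =>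
    (b.hasSum_inner_mul_inner (y i) (x i)).congr_fun fun k => mul_comm _ _
  have h2 : HasSum (fun p : ι × κ => (inner ℂ (b p.2) (x p.1) : ℂ) * inner ℂ (y p.1) (b p.2))
      (∑' i, inner ℂ (y i) (x i)) := by
    have := hs.hasSum
    rwa [(this.prod_fiberwise h1).tsum_eq]
  have h3 := (Equiv.prodComm κ ι).hasSum_iff.mpr h2
  exact h3.prod_fiberwise fun k => hasSum_inner_op hx hy (b k) (b k)

theorem trace_op {x y : ι → H} (hx : SqSum x) (hy : SqSum y) :
    trace (op x y) = ∑' i, inner ℂ (y i) (x i) :=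
  (hasSum_basis_op hx hy (basis H)).tsum_eq

theorem hasSum_trace_op {x y : ι → H} (hx : SqSum x) (hy : SqSum y) :
    HasSum (fun i => (inner ℂ (y i) (x i) : ℂ)) (trace (op x y)) := by
  rw [trace_op hx hy]
  exact (hy.summable_inner hx).hasSum

theorem trace_op_self {x : ι → H} (hx : SqSum x) :
    trace (op x x) = ((∑' i, ‖x i‖ ^ 2 : ℝ) : ℂ) := by
  rw [trace_op hx hx, Complex.ofReal_tsum]
  refine tsum_congr fun i => ?_
  rw [inner_self_eq_ofReal]

/-- A positive operator of finite trace is `∑ᵢ |xᵢ⟩⟨xᵢ|` for a square summable family `x`. -/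
theorem exists_op_self {P : H →L[ℂ] H} (hP : P.IsPositive)
    (hs : Summable fun i => (inner ℂ (basis H i) (P (basis H i)) : ℂ)) :
    ∃ x : basisIndex H → H, SqSum x ∧ P = op x x := by
  have hP0 : 0 ≤ P := (ContinuousLinearMap.nonneg_iff_isPositive P).mpr hP
  set S := CFC.sqrt P with hS
  have hSS : ∀ h, P h = S (S h) := fun h => by
    conv_lhs => rw [← CFC.sqrt_mul_sqrt_self P hP0]
    rfl
  have hSp : S.IsPositive :=
    (ContinuousLinearMap.nonneg_iff_isPositive S).mp (CFC.sqrt_nonneg P)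
  have hsymm : ∀ h k, (inner ℂ (S h) k : ℂ) = inner ℂ h (S k) := hSp.inner_left_eq_inner_right
  have hx : SqSum fun i => S (basis H i) := by
    have : ∀ i, (inner ℂ (basis H i) (P (basis H i)) : ℂ) = ((‖S (basis H i)‖ ^ 2 : ℝ) : ℂ) := by
      intro i
      rw [hSS, ← hsymm, inner_self_eq_ofReal]
    simp_rw [this] at hs
    exact_mod_cast hs
  refine ⟨_, hx, ?_⟩
  refine ContinuousLinearMap.ext fun h => ext_inner_left ℂ fun k => ?_
  refine HasSum.unique ?_ (hasSum_inner_op hx hx k h)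
  rw [hSS, ← hsymm]
  exact ((basis H).hasSum_inner_mul_inner (S k) (S h)).congr_fun fun i => by rw [hsymm, hsymm]

theorem op_self_mem_traceClass {x : ι → H} (hx : SqSum x) : op x x ∈ traceClass H :=
  Submodule.subset_span ⟨op_self_isPositive hx, (hasSum_basis_op hx hx (basis H)).summable⟩

/-- Reduces general series to the positive ones `op z z`, to which the definition of the trace class
and the trace inequality of a channel apply directly. -/
theorem op_polarization {x y : ι → H} (hx : SqSum x) (hy : SqSum y) :
    op x y = (4 : ℂ)⁻¹ • (op (fun i => x i + y i) (fun i => x i + y i) -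
      op (fun i => x i + (-1 : ℂ) • y i) (fun i => x i + (-1 : ℂ) • y i) +
      Complex.I • op (fun i => x i + Complex.I • y i) (fun i => x i + Complex.I • y i) -
      Complex.I • op (fun i => x i + (-Complex.I) • y i) (fun i => x i + (-Complex.I) • y i)) := by
  have e : ∀ c : ℂ, op (fun i => x i + c • y i) (fun i => x i + c • y i) =
      op x x + (starRingEnd ℂ c) • op x y + c • op y x + (c * starRingEnd ℂ c) • op y y := by
    intro c
    rw [op_add_left hx (hy.smul c) (hx.add (hy.smul c)), op_add_right hx hx (hy.smul c),
      op_add_right (hy.smul c) hx (hy.smul c), op_smul_left c hy hx, op_smul_left c hy (hy.smul c),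
      op_smul_right c hx hy, op_smul_right c hy hy, smul_smul]
    abel
  have e1 := e 1
  simp only [one_smul] at e1
  rw [e1, e, e, e]
  simp only [map_neg, Complex.conj_I, map_one, smul_add, smul_sub, smul_smul]
  match_scalars <;> ring_nf <;> simp <;> ring

theorem op_mem_traceClass {x y : ι → H} (hx : SqSum x) (hy : SqSum y) : op x y ∈ traceClass H := by
  rw [op_polarization hx hy]
  have h : ∀ c : ℂ, op (fun i => x i + c • y i) (fun i => x i + c • y i) ∈ traceClass H :=
    fun c => op_self_mem_traceClass (hx.add (hy.smul c))
  have h1 := h 1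
  simp only [one_smul] at h1
  exact Submodule.smul_mem _ _ (Submodule.sub_mem _ (Submodule.add_mem _ (Submodule.sub_mem _ h1
    (h _)) (Submodule.smul_mem _ _ (h _))) (Submodule.smul_mem _ _ (h _)))

/-- Every trace class operator is `∑ᵢ |xᵢ⟩⟨yᵢ|` for square summable families `x` and `y`. -/
theorem exists_op {T : H →L[ℂ] H} (hT : T ∈ traceClass H) :
    ∃ (ι : Type u) (x y : ι → H), SqSum x ∧ SqSum y ∧ T = op x y := by
  induction hT using Submodule.span_induction with
  | mem P hP =>
    obtain ⟨x, hx, h⟩ := exists_op_self hP.1 hP.2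
    exact ⟨_, x, x, hx, hx, h⟩
  | zero =>
    exact ⟨PEmpty, fun _ => 0, fun _ => 0, SqSum.of_fintype _, SqSum.of_fintype _, by simp [op]⟩
  | add S T _ _ hS hT =>
    obtain ⟨ι, x, y, hx, hy, rfl⟩ := hS
    obtain ⟨κ, x', y', hx', hy', rfl⟩ := hT
    have hxx : SqSum (Sum.elim x x') := by
      refine (Summable.sum (f := fun i => ‖Sum.elim x x' i‖ ^ 2) ?_ ?_) <;> assumption
    have hyy : SqSum (Sum.elim y y') := by
      refine (Summable.sum (f := fun i => ‖Sum.elim y y' i‖ ^ 2) ?_ ?_) <;> assumption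
    exact ⟨ι ⊕ κ, _, _, hxx, hyy, (op_sum_index hxx hyy).symm⟩
  | smul c T _ hT =>
    obtain ⟨ι, x, y, hx, hy, rfl⟩ := hT
    exact ⟨ι, _, y, hx.smul c, hy, (op_smul_left c hx hy).symm⟩

theorem hasSum_trace {T : H →L[ℂ] H} (hT : T ∈ traceClass H) (b : HilbertBasis κ ℂ H) :
    HasSum (fun k => (inner ℂ (b k) (T (b k)) : ℂ)) (trace T) := by
  obtain ⟨ι, x, y, hx, hy, rfl⟩ := exists_op hT
  rw [trace_op hx hy]
  exact hasSum_basis_op hx hy b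

theorem trace_add {S T : H →L[ℂ] H} (hS : S ∈ traceClass H) (hT : T ∈ traceClass H) :
    trace (S + T) = trace S + trace T :=
  (hasSum_trace (Submodule.add_mem _ hS hT) (basis H)).unique
    (((hasSum_trace hS (basis H)).add (hasSum_trace hT (basis H))).congr_fun fun i => by
      simp)

theorem trace_smul (c : ℂ) (T : H →L[ℂ] H) : trace (c • T) = c * trace T := by
  simp only [trace, smul_apply, inner_smul_right, tsum_mul_left]

theorem trace_sum {s : Finset κ} {T : κ → H →L[ℂ] H} (hT : ∀ k ∈ s, T k ∈ traceClass H) :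
    trace (∑ k ∈ s, T k) = ∑ k ∈ s, trace (T k) := by
  classical
  induction s using Finset.induction_on with
  | empty => simp [trace]
  | insert a s ha ih =>
    have h : ∀ k ∈ s, T k ∈ traceClass H := fun k hk => hT k (by simp [hk])
    rw [Finset.sum_insert ha, Finset.sum_insert ha,
      trace_add (hT a (by simp)) (Submodule.sum_mem _ h), ih h]

theorem comp_comp_adjoint_mem_traceClass {T : H →L[ℂ] H} (hT : T ∈ traceClass H)
    (A B : H →L[ℂ] K) : A.comp (T.comp (ContinuousLinearMap.adjoint B)) ∈ traceClass K := by
  obtain ⟨ι, x, y, hx, hy, rfl⟩ := exists_op hT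
  rw [comp_op_comp_adjoint hx hy]
  exact op_mem_traceClass (hx.map A) (hy.map B)

theorem rankOne_mem_traceClass (x y : H) : InnerProductSpace.rankOne ℂ x y ∈ traceClass H := by
  rw [← op_unique]
  exact op_mem_traceClass (SqSum.of_fintype _) (SqSum.of_fintype _)

theorem trace_rankOne (x y : H) : trace (InnerProductSpace.rankOne ℂ x y) = inner ℂ y x := by
  rw [← op_unique, trace_op (SqSum.of_fintype _) (SqSum.of_fintype _)]
  simp

theorem mem_traceClass_of_finiteDimensional [FiniteDimensional ℂ H] (T : H →L[ℂ] H) :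
    T ∈ traceClass H := by
  have : T = op (fun i => T (stdOrthonormalBasis ℂ H i)) fun i => stdOrthonormalBasis ℂ H i := by
    refine ContinuousLinearMap.ext fun h => ?_
    refine HasSum.unique ?_ (hasSum_op_apply (SqSum.of_fintype _) (SqSum.of_fintype _) h)
    have h1 : T h = ∑ i, (inner ℂ (stdOrthonormalBasis ℂ H i) h : ℂ) •
        T (stdOrthonormalBasis ℂ H i) := by
      conv_lhs => rw [← (stdOrthonormalBasis ℂ H).sum_repr' h]
      simp only [map_sum, map_smul]
    rw [h1]
    exact hasSum_fintype _
  rw [this]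
  exact op_mem_traceClass (SqSum.of_fintype _) (SqSum.of_fintype _)

theorem trace_eq_sum {κ : Type*} [Fintype κ] (b : OrthonormalBasis κ ℂ H) (T : H →L[ℂ] H) :
    trace T = ∑ k, inner ℂ (b k) (T (b k)) := by
  have := Module.Basis.finiteDimensional_of_finite b.toBasis
  have h := hasSum_trace (mem_traceClass_of_finiteDimensional T) b.toHilbertBasis
  rw [OrthonormalBasis.coe_toHilbertBasis] at h
  exact h.unique (hasSum_fintype _)

theorem trace_eq_linearMap_trace [FiniteDimensional ℂ H] (T : H →L[ℂ] H) :
    trace T = LinearMap.trace ℂ H T := by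
  rw [trace_eq_sum (stdOrthonormalBasis ℂ H),
    LinearMap.trace_eq_sum_inner _ (stdOrthonormalBasis ℂ H)]
  rfl

/-- The trace of a positive trace class operator is a nonnegative real, and it bounds the norm. -/
theorem norm_le_trace {P : H →L[ℂ] H} (hP : P.IsPositive) (hT : P ∈ traceClass H) :
    ‖P‖ ≤ (trace P).re ∧ (trace P).im = 0 := by
  obtain ⟨x, hx, rfl⟩ := exists_op_self hP (hasSum_trace hT (basis H)).summable
  rw [trace_op_self hx, Complex.ofReal_re, Complex.ofReal_im]
  refine ⟨?_, rfl⟩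
  have h : Summable fun i => ‖InnerProductSpace.rankOne ℂ (x i) (x i)‖ := by
    simpa only [InnerProductSpace.norm_rankOne] using hx.summable_norm_mul hx
  refine (norm_tsum_le_tsum_norm h).trans (le_of_eq (tsum_congr fun i => ?_))
  rw [InnerProductSpace.norm_rankOne, sq]

end SquareSummable

/-! ### Slices of tensors, block operators -/

section Slices

variable {H : Type u} {K : Type v} {L : Type w}
  [NormedAddCommGroup H] [InnerProductSpace ℂ H] [CompleteSpace H]
  [NormedAddCommGroup K] [InnerProductSpace ℂ K] [CompleteSpace K]
  [NormedAddCommGroup L] [InnerProductSpace ℂ L] [CompleteSpace L]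
  {ι κ : Type*}

theorem op_prod_fiberwise_swap {x : ι × κ → K} {y : ι × κ → H} (hx : SqSum x) (hy : SqSum y) :
    HasSum (fun k => op (fun i => x (i, k)) (fun i => y (i, k))) (op x y) := by
  have h := (Equiv.prodComm κ ι).hasSum_iff.mpr (hasSum_op hx hy)
  exact h.prod_fiberwise fun k =>
    hasSum_op (hx.comp_injective (Prod.mk_left_injective k))
      (hy.comp_injective (Prod.mk_left_injective k))

/-- The slice `1 ⊗ ⟨s|`. -/
def sliceRight (s : K) : HTensor H K →L[ℂ] H := ContinuousLinearMap.adjoint (tmulRight s)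

/-- The slice `⟨s| ⊗ 1`. -/
def sliceLeft (s : H) : HTensor H K →L[ℂ] K := ContinuousLinearMap.adjoint (tmulLeft s)

theorem inner_sliceRight (s : K) (a : H) (ξ : HTensor H K) :
    (inner ℂ a (sliceRight s ξ) : ℂ) = inner ℂ (tmul a s) ξ := by
  rw [sliceRight, ContinuousLinearMap.adjoint_inner_right, tmulRight_apply]

theorem inner_sliceLeft (s : H) (b : K) (ξ : HTensor H K) :
    (inner ℂ b (sliceLeft s ξ) : ℂ) = inner ℂ (tmul s b) ξ := by
  rw [sliceLeft, ContinuousLinearMap.adjoint_inner_right, tmulLeft_apply]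

theorem sliceRight_tmul (s : K) (a : H) (b : K) :
    sliceRight s (tmul a b) = (inner ℂ s b : ℂ) • a :=
  ext_inner_left ℂ fun x => by
    rw [inner_sliceRight, inner_tmul_tmul, inner_smul_right, mul_comm]

theorem sliceLeft_tmul (s : H) (a : H) (b : K) :
    sliceLeft s (tmul a b) = (inner ℂ s a : ℂ) • b :=
  ext_inner_left ℂ fun x => by
    rw [inner_sliceLeft, inner_tmul_tmul, inner_smul_right]

theorem adjoint_sliceRight (s : K) :
    ContinuousLinearMap.adjoint (sliceRight (H := H) s) = tmulRight s :=
  ContinuousLinearMap.adjoint_adjoint _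

theorem adjoint_sliceLeft (s : H) :
    ContinuousLinearMap.adjoint (sliceLeft (K := K) s) = tmulLeft s :=
  ContinuousLinearMap.adjoint_adjoint _

theorem tmul_add (a : H) (b b' : K) : tmul a (b + b') = tmul a b + tmul a b' :=
  map_add (tmulLeft a) b b'

theorem tmul_smul (c : ℂ) (a : H) (b : K) : tmul a (c • b) = c • tmul a b :=
  map_smul (tmulLeft a) c b

theorem tmul_sum (s : Finset κ) (a : H) (b : κ → K) :
    tmul a (∑ k ∈ s, b k) = ∑ k ∈ s, tmul a (b k) :=
  map_sum (tmulLeft a) b s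

theorem norm_tmul (a : H) (b : K) : ‖tmul a b‖ = ‖a‖ * ‖b‖ := by
  rw [tmul, UniformSpace.Completion.norm_coe, TensorProduct.norm_tmul]

theorem eq_zero_of_sliceRight {ξ : HTensor H K} (h : ∀ s : K, sliceRight s ξ = 0) : ξ = 0 := by
  -- Passing to `|ξ⟩⟨ξ|` turns a statement on vectors into one on operators, where elementary
  -- tensors suffice.
  have h1 : InnerProductSpace.rankOne ℂ ξ ξ = (0 : HTensor H K →L[ℂ] HTensor H K) :=
    ext_tmul fun a a' b b' => by
      rw [InnerProductSpace.rankOne_apply, inner_smul_right, ← inner_sliceRight b, h]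
      simp
  simpa using h1

/-- The product of two Hilbert bases. -/
def tensorBasis (b : HilbertBasis ι ℂ H) (c : HilbertBasis κ ℂ K) :
    HilbertBasis (ι × κ) ℂ (HTensor H K) :=
  HilbertBasis.mkOfOrthogonalEqBot (v := fun p : ι × κ => tmul (b p.1) (c p.2))
    (by
      classical
      rw [orthonormal_iff_ite]
      rintro ⟨i, k⟩ ⟨i', k'⟩
      rw [inner_tmul_tmul, orthonormal_iff_ite.mp b.orthonormal, orthonormal_iff_ite.mp c.orthonormal]
      by_cases h : i = i' <;> by_cases h' : k = k' <;> simp [h, h'])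
    (by
      rw [Submodule.eq_bot_iff]
      intro ξ hξ
      rw [Submodule.mem_orthogonal] at hξ
      have h0 : ∀ i k, (inner ℂ (tmul (b i) (c k)) ξ : ℂ) = 0 := fun i k =>
        hξ _ (Submodule.subset_span ⟨(i, k), rfl⟩)
      have h1 : ∀ i, sliceLeft (b i) ξ = 0 := fun i => by
        refine c.repr.injective (lp.ext (funext fun k => ?_))
        rw [c.repr_apply_apply, inner_sliceLeft, h0, map_zero]
        rfl
      refine eq_zero_of_sliceRight fun s => b.repr.injective (lp.ext (funext fun i => ?_))
      rw [b.repr_apply_apply, inner_sliceRight, ← inner_sliceLeft, h1, inner_zero_right, map_zero]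
      rfl)

theorem tensorBasis_apply (b : HilbertBasis ι ℂ H) (c : HilbertBasis κ ℂ K) (p : ι × κ) :
    tensorBasis b c p = tmul (b p.1) (c p.2) := by
  rw [tensorBasis, HilbertBasis.coe_mkOfOrthogonalEqBot]

theorem hasSum_inner_tmul (b : HilbertBasis ι ℂ H) (c : HilbertBasis κ ℂ K) (ξ η : HTensor H K) :
    HasSum (fun p : ι × κ => (inner ℂ ξ (tmul (b p.1) (c p.2)) : ℂ) *
      inner ℂ (tmul (b p.1) (c p.2)) η) (inner ℂ ξ η) := by
  simpa only [tensorBasis_apply] using (tensorBasis b c).hasSum_inner_mul_inner ξ η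

/-- Parseval's identity for slices along the second factor. -/
theorem hasSum_inner_sliceRight (c : HilbertBasis κ ℂ K) (ξ η : HTensor H K) :
    HasSum (fun k => (inner ℂ (sliceRight (c k) ξ) (sliceRight (c k) η) : ℂ)) (inner ℂ ξ η) := by
  have h := (Equiv.prodComm κ (basisIndex H)).hasSum_iff.mpr (hasSum_inner_tmul (basis H) c ξ η)
  refine h.prod_fiberwise fun k => ?_
  refine ((basis H).hasSum_inner_mul_inner _ _).congr_fun fun i => ?_
  rw [inner_sliceRight, ← inner_conj_symm _ (basis H i), inner_sliceRight, inner_conj_symm]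
  rfl

/-- Parseval's identity for slices along the first factor. -/
theorem hasSum_inner_sliceLeft (b : HilbertBasis ι ℂ H) (ξ η : HTensor H K) :
    HasSum (fun i => (inner ℂ (sliceLeft (b i) ξ) (sliceLeft (b i) η) : ℂ)) (inner ℂ ξ η) := by
  refine (hasSum_inner_tmul b (basis K) ξ η).prod_fiberwise fun i => ?_
  refine ((basis K).hasSum_inner_mul_inner _ _).congr_fun fun k => ?_
  rw [inner_sliceLeft, ← inner_conj_symm _ (basis K k), inner_sliceLeft, inner_conj_symm]

theorem hasSum_norm_sq_sliceRight (c : HilbertBasis κ ℂ K) (ξ : HTensor H K) :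
    HasSum (fun k => ‖sliceRight (c k) ξ‖ ^ 2) (‖ξ‖ ^ 2) := by
  have h := hasSum_inner_sliceRight c ξ ξ
  simp only [inner_self_eq_ofReal] at h
  exact_mod_cast h

theorem hasSum_norm_sq_sliceLeft (b : HilbertBasis ι ℂ H) (ξ : HTensor H K) :
    HasSum (fun i => ‖sliceLeft (b i) ξ‖ ^ 2) (‖ξ‖ ^ 2) := by
  have h := hasSum_inner_sliceLeft b ξ ξ
  simp only [inner_self_eq_ofReal] at h
  exact_mod_cast h

theorem sum_inner_sliceRight [Fintype κ] (f : OrthonormalBasis κ ℂ K) (ξ η : HTensor H K) :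
    ∑ k, (inner ℂ (sliceRight (f k) ξ) (sliceRight (f k) η) : ℂ) = inner ℂ ξ η := by
  have h := hasSum_inner_sliceRight f.toHilbertBasis ξ η
  rw [OrthonormalBasis.coe_toHilbertBasis] at h
  exact (hasSum_fintype _).unique h

theorem sum_norm_sq_sliceRight [Fintype κ] (f : OrthonormalBasis κ ℂ K) (ξ : HTensor H K) :
    ∑ k, ‖sliceRight (f k) ξ‖ ^ 2 = ‖ξ‖ ^ 2 := by
  have h := hasSum_norm_sq_sliceRight f.toHilbertBasis ξ
  rw [OrthonormalBasis.coe_toHilbertBasis] at h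
  exact (hasSum_fintype _).unique h

theorem sum_norm_sq_sliceLeft [Fintype κ] (f : OrthonormalBasis κ ℂ H) (ξ : HTensor H K) :
    ∑ k, ‖sliceLeft (f k) ξ‖ ^ 2 = ‖ξ‖ ^ 2 := by
  have h := hasSum_norm_sq_sliceLeft f.toHilbertBasis ξ
  rw [OrthonormalBasis.coe_toHilbertBasis] at h
  exact (hasSum_fintype _).unique h

instance finiteDimensional_hTensor [FiniteDimensional ℂ H] [FiniteDimensional ℂ K] :
    FiniteDimensional ℂ (HTensor H K) :=
  Module.Basis.finiteDimensional_of_finite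
    (tensorBasis (stdOrthonormalBasis ℂ H).toHilbertBasis
      (stdOrthonormalBasis ℂ K).toHilbertBasis).toOrthonormalBasis.toBasis

/-! ### Blocks -/

theorem blockRight_eq (s s' : K) (X : HTensor H K →L[ℂ] HTensor H K) :
    blockRight s s' X =
      (sliceRight s).comp (X.comp (ContinuousLinearMap.adjoint (sliceRight s'))) := by
  rw [adjoint_sliceRight]
  rfl

theorem blockLeft_eq (s s' : H) (X : HTensor H K →L[ℂ] HTensor H K) :
    blockLeft s s' X =
      (sliceLeft s).comp (X.comp (ContinuousLinearMap.adjoint (sliceLeft s'))) := by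
  rw [adjoint_sliceLeft]
  rfl

theorem blockRight_op {x y : ι → HTensor H K} (hx : SqSum x) (hy : SqSum y) (s s' : K) :
    blockRight s s' (op x y) = op (fun i => sliceRight s (x i)) fun i => sliceRight s' (y i) := by
  rw [blockRight_eq, comp_op_comp_adjoint hx hy]

theorem blockLeft_op {x y : ι → HTensor H K} (hx : SqSum x) (hy : SqSum y) (s s' : H) :
    blockLeft s s' (op x y) = op (fun i => sliceLeft s (x i)) fun i => sliceLeft s' (y i) := by
  rw [blockLeft_eq, comp_op_comp_adjoint hx hy]

theorem blockRight_mem_traceClass {X : HTensor H K →L[ℂ] HTensor H K} (hX : X ∈ traceClass _)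
    (s s' : K) : blockRight s s' X ∈ traceClass H := by
  rw [blockRight_eq]
  exact comp_comp_adjoint_mem_traceClass hX _ _

theorem blockLeft_mem_traceClass {X : HTensor H K →L[ℂ] HTensor H K} (hX : X ∈ traceClass _)
    (s s' : H) : blockLeft s s' X ∈ traceClass K := by
  rw [blockLeft_eq]
  exact comp_comp_adjoint_mem_traceClass hX _ _

theorem blockRight_smul (s s' : K) (c : ℂ) (X : HTensor H K →L[ℂ] HTensor H K) :
    blockRight s s' (c • X) = c • blockRight s s' X := by
  ext a
  simp [blockRight]

theorem blockLeft_smul (s s' : H) (c : ℂ) (X : HTensor H K →L[ℂ] HTensor H K) :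
    blockLeft s s' (c • X) = c • blockLeft s s' X := by
  ext a
  simp [blockLeft]

/-- The operator on `H ⊗ K` with given blocks with respect to a basis of `K`. -/
def ofBlocks [Fintype κ] (f : OrthonormalBasis κ ℂ K) (N : κ → κ → H →L[ℂ] H) :
    HTensor H K →L[ℂ] HTensor H K :=
  ∑ m, ∑ n, (tmulRight (f m)).comp ((N m n).comp (sliceRight (f n)))

theorem inner_ofBlocks [Fintype κ] (f : OrthonormalBasis κ ℂ K) (N : κ → κ → H →L[ℂ] H)
    (ξ η : HTensor H K) : (inner ℂ ξ (ofBlocks f N η) : ℂ) =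
      ∑ m, ∑ n, inner ℂ (sliceRight (f m) ξ) (N m n (sliceRight (f n) η)) := by
  simp only [ofBlocks, sum_apply, inner_sum]
  refine Finset.sum_congr rfl fun m _ => Finset.sum_congr rfl fun n _ => ?_
  rw [ContinuousLinearMap.comp_apply, ContinuousLinearMap.comp_apply, tmulRight_apply,
    ← inner_conj_symm, ← inner_sliceRight, inner_conj_symm]

theorem blockRight_ofBlocks' [Fintype κ] (f : OrthonormalBasis κ ℂ K) (N : κ → κ → H →L[ℂ] H)
    (s s' : K) : blockRight s s' (ofBlocks f N) =
      ∑ m, ∑ n, ((inner ℂ s (f m) : ℂ) * inner ℂ (f n) s') • N m n := by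
  refine ContinuousLinearMap.ext fun a => ext_inner_left ℂ fun x => ?_
  rw [inner_blockRight, inner_ofBlocks]
  simp only [sum_apply, inner_sum, sliceRight_tmul, map_smul, smul_apply,
    inner_smul_right, inner_smul_left, inner_conj_symm]
  refine Finset.sum_congr rfl fun m _ => Finset.sum_congr rfl fun n _ => ?_
  ring

theorem blockRight_ofBlocks [Fintype κ] (f : OrthonormalBasis κ ℂ K) (N : κ → κ → H →L[ℂ] H)
    (m n : κ) : blockRight (f m) (f n) (ofBlocks f N) = N m n := by
  classical
  rw [blockRight_ofBlocks', Finset.sum_eq_single m, Finset.sum_eq_single n]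
  · simp
  · intro n' _ h
    simp [orthonormal_iff_ite.mp f.orthonormal, h]
  · simp
  · intro m' _ h
    simp [orthonormal_iff_ite.mp f.orthonormal, h.symm]
  · simp

theorem blockRight_eq_sum [Fintype κ] (f : OrthonormalBasis κ ℂ K)
    (X : HTensor H K →L[ℂ] HTensor H K) (s s' : K) : blockRight s s' X =
      ∑ m, ∑ n, ((inner ℂ s (f m) : ℂ) * inner ℂ (f n) s') • blockRight (f m) (f n) X := by
  refine ContinuousLinearMap.ext fun a => ext_inner_left ℂ fun x => ?_
  simp only [sum_apply, inner_sum, smul_apply, inner_smul_right, inner_blockRight]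
  conv_lhs => rw [← f.sum_repr' s, ← f.sum_repr' s']
  simp only [tmul_sum, tmul_smul, map_sum, map_smul, sum_inner, inner_sum, inner_smul_left,
    inner_smul_right, inner_conj_symm]
  simp only [Finset.mul_sum]
  rw [Finset.sum_comm]
  refine Finset.sum_congr rfl fun m _ => Finset.sum_congr rfl fun n _ => ?_
  ring

theorem ext_blockRight_basis [Fintype κ] (f : OrthonormalBasis κ ℂ K)
    {X Y : HTensor H K →L[ℂ] HTensor H K}
    (h : ∀ m n, blockRight (f m) (f n) X = blockRight (f m) (f n) Y) : X = Y :=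
  ext_blockRight fun s s' => by
    rw [blockRight_eq_sum f X, blockRight_eq_sum f Y]
    simp only [h]

theorem trace_eq_sum_blockRight [Fintype κ] (f : OrthonormalBasis κ ℂ K)
    {X : HTensor H K →L[ℂ] HTensor H K} (hX : X ∈ traceClass _) :
    trace X = ∑ m, trace (blockRight (f m) (f m) X) := by
  obtain ⟨ι, x, y, hx, hy, rfl⟩ := exists_op hX
  refine (hasSum_trace_op hx hy).unique ?_
  simp only [blockRight_op hx hy]
  refine (hasSum_sum fun m _ => hasSum_trace_op (hx.map _) (hy.map _)).congr_fun fun i => ?_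
  rw [sum_inner_sliceRight]

/-- Positivity of an operator matrix with entries indexed by a finite type. -/
def PosMatrix [Fintype κ] (T : κ → κ → H →L[ℂ] H) : Prop :=
  ∀ x : κ → H, 0 ≤ ∑ i, ∑ j, (inner ℂ (x i) (T i j (x j)) : ℂ)

theorem PosMatrix.submatrix [Fintype ι] [Fintype κ] {T : κ → κ → H →L[ℂ] H} (hT : PosMatrix T)
    {e : ι → κ} (he : Function.Injective e) : PosMatrix fun i j => T (e i) (e j) := by
  intro x
  have h := hT (Function.extend e x 0)
  convert h using 1
  refine Finset.sum_of_injOn e he.injOn (fun _ _ => Finset.mem_coe.mpr (Finset.mem_univ _)) ?_ ?_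
  · intro k _ hk
    rw [Function.extend_apply' _ _ _ (by simpa using hk)]
    simp
  · intro i _
    rw [he.extend_apply]
    refine Finset.sum_of_injOn e he.injOn (fun _ _ => Finset.mem_coe.mpr (Finset.mem_univ _)) ?_ ?_
    · intro k _ hk
      rw [Function.extend_apply' _ _ _ (by simpa using hk)]
      simp
    · intro j _
      rw [he.extend_apply]

theorem ofBlocks_isPositive [Fintype κ] (f : OrthonormalBasis κ ℂ K) {N : κ → κ → H →L[ℂ] H}
    (hN : PosMatrix N) : (ofBlocks f N).IsPositive := by
  rw [isPositive_iff_inner_nonneg]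
  intro ξ
  rw [inner_ofBlocks]
  exact hN _

/-- For each index `i` the quadratic form contributes `|∑ₗ ⟨rₗ i, xₗ⟩|²`. -/
theorem posMatrix_op [Fintype κ] {r : κ → ι → H} (hr : ∀ k, SqSum (r k)) :
    PosMatrix fun k l => op (r k) (r l) := by
  intro x
  have h : HasSum (fun i => ∑ k, ∑ l, (inner ℂ (x k) (r k i) : ℂ) * inner ℂ (r l i) (x l))
      (∑ k, ∑ l, inner ℂ (x k) (op (r k) (r l) (x l))) :=
    hasSum_sum fun k _ => hasSum_sum fun l _ => hasSum_inner_op (hr k) (hr l) (x k) (x l)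
  rw [← h.tsum_eq]
  refine tsum_nonneg fun i => ?_
  have h1 : ∑ k, ∑ l, (inner ℂ (x k) (r k i) : ℂ) * inner ℂ (r l i) (x l) =
      starRingEnd ℂ (∑ l, inner ℂ (r l i) (x l)) * ∑ l, inner ℂ (r l i) (x l) := by
    rw [map_sum, Finset.sum_mul_sum]
    simp only [inner_conj_symm]
  rw [h1]
  exact star_mul_self_nonneg _

/-! ### Maps that are linear on the trace class, and their action on blocks -/

/-- Linearity on the trace class. -/
structure LinearOnTraceClass (E : (H →L[ℂ] H) → (L →L[ℂ] L)) : Prop where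
  map_add : ∀ S ∈ traceClass H, ∀ T ∈ traceClass H, E (S + T) = E S + E T
  map_smul : ∀ c : ℂ, ∀ T ∈ traceClass H, E (c • T) = c • E T

theorem LinearOnTraceClass.map_zero {E : (H →L[ℂ] H) → (L →L[ℂ] L)} (hE : LinearOnTraceClass E) :
    E 0 = 0 := by
  simpa using hE.map_smul 0 0 (Submodule.zero_mem _)

theorem LinearOnTraceClass.map_sum {E : (H →L[ℂ] H) → (L →L[ℂ] L)} (hE : LinearOnTraceClass E)
    {s : Finset κ} {T : κ → H →L[ℂ] H} (hT : ∀ k ∈ s, T k ∈ traceClass H) :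
    E (∑ k ∈ s, T k) = ∑ k ∈ s, E (T k) := by
  classical
  induction s using Finset.induction_on with
  | empty => simpa using hE.map_zero
  | insert a s ha ih =>
    have h : ∀ k ∈ s, T k ∈ traceClass H := fun k hk => hT k (by simp [hk])
    rw [Finset.sum_insert ha, Finset.sum_insert ha,
      hE.map_add _ (hT a (by simp)) _ (Submodule.sum_mem _ h), ih h]

theorem IsChannel.linear {E : (H →L[ℂ] H) → (L →L[ℂ] L)} (hE : IsChannel E) :
    LinearOnTraceClass E := ⟨hE.map_add, hE.map_smul⟩

/-- A map that is linear on the trace class acts on an operator on `H ⊗ K`, for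
finite-dimensional `K`, block by block. -/
theorem ampLeft_eq_ofBlocks [Fintype κ] (f : OrthonormalBasis κ ℂ K)
    {E : (H →L[ℂ] H) → (L →L[ℂ] L)} (hE : LinearOnTraceClass E)
    {X : HTensor H K →L[ℂ] HTensor H K} (hX : ∀ s s', blockRight s s' X ∈ traceClass H) :
    ampLeft E X = ofBlocks f fun m n => E (blockRight (f m) (f n) X) := by
  refine ampLeft_eq fun s s' => ?_
  rw [blockRight_ofBlocks', blockRight_eq_sum f X, hE.map_sum]
  · refine Finset.sum_congr rfl fun m _ => ?_
    rw [hE.map_sum fun n _ => Submodule.smul_mem _ _ (hX _ _)]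
    exact Finset.sum_congr rfl fun n _ => (hE.map_smul _ _ (hX _ _)).symm
  · exact fun m _ => Submodule.sum_mem _ fun n _ => Submodule.smul_mem _ _ (hX _ _)

/-- With `K` finite-dimensional, linearity on the trace class is enough for the operator with the
prescribed blocks to exist, so the default value in `ampLeft` plays no role. -/
theorem blockRight_ampLeft [FiniteDimensional ℂ K]
    {E : (H →L[ℂ] H) → (L →L[ℂ] L)} (hE : LinearOnTraceClass E)
    {X : HTensor H K →L[ℂ] HTensor H K} (hX : ∀ s s', blockRight s s' X ∈ traceClass H) (s s' : K) :
    blockRight s s' (ampLeft E X) = E (blockRight s s' X) := by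
  let f := stdOrthonormalBasis ℂ K
  rw [ampLeft_eq_ofBlocks f hE hX, blockRight_ofBlocks', blockRight_eq_sum f X, hE.map_sum]
  · refine Finset.sum_congr rfl fun m _ => ?_
    rw [hE.map_sum fun n _ => Submodule.smul_mem _ _ (hX _ _)]
    exact Finset.sum_congr rfl fun n _ => (hE.map_smul _ _ (hX _ _)).symm
  · exact fun m _ => Submodule.sum_mem _ fun n _ => Submodule.smul_mem _ _ (hX _ _)

/-! ### Properties of channels -/

theorem IsChannel.posMatrix [Fintype κ] {E : (H →L[ℂ] H) → (L →L[ℂ] L)} (hE : IsChannel E)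
    {T : κ → κ → H →L[ℂ] H} (hT : ∀ i j, T i j ∈ traceClass H) (hp : PosMatrix T) :
    PosMatrix fun i j => E (T i j) := by
  let e := Fintype.equivFin κ
  have h := hE.completely_positive _ (fun i j => T (e.symm i) (e.symm j)) (fun i j => hT _ _)
    (hp.submatrix e.symm.injective)
  simpa using PosMatrix.submatrix (T := fun i j => E (T (e.symm i) (e.symm j))) h e.injective

theorem IsChannel.map_isPositive {E : (H →L[ℂ] H) → (L →L[ℂ] L)} (hE : IsChannel E)
    {T : H →L[ℂ] H} (hT : T ∈ traceClass H) (hp : T.IsPositive) : (E T).IsPositive := by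
  have h := hE.posMatrix (κ := Unit) (T := fun _ _ => T) (fun _ _ => hT) fun x => by
    simpa using (isPositive_iff_inner_nonneg T).mp hp (x ())
  rw [isPositive_iff_inner_nonneg]
  exact fun x => by simpa using h fun _ => x

theorem IsChannel.map_sub {E : (H →L[ℂ] H) → (L →L[ℂ] L)} (hE : IsChannel E)
    {S T : H →L[ℂ] H} (hS : S ∈ traceClass H) (hT : T ∈ traceClass H) :
    E (S - T) = E S - E T := by
  have := hE.map_add _ (Submodule.sub_mem _ hS hT) _ hT
  rw [sub_add_cancel] at this
  rw [this, add_sub_cancel_right]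

theorem op_sub_sum {x : ι → H} (hx : SqSum x) (s : Finset ι) :
    op x x - ∑ i ∈ s, InnerProductSpace.rankOne ℂ (x i) (x i) =
      op (fun i : {i // i ∉ s} => x i) (fun i : {i // i ∉ s} => x i) := by
  have h1 := hasSum_op hx hx
  have h2 := hasSum_op (hx.comp_injective (f := fun i : {i // i ∉ s} => (i : ι))
    Subtype.val_injective) (hx.comp_injective (f := fun i : {i // i ∉ s} => (i : ι))
    Subtype.val_injective)
  rw [sub_eq_iff_eq_add]
  refine h1.unique ?_
  have := (s.hasSum_compl_iff (f := fun i => InnerProductSpace.rankOne ℂ (x i) (x i))).mp h2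
  exact this

/-- Channels are automatically continuous along such series: the remainder is positive, so the norm
of its image is at most the trace of its image, hence at most its own trace, which is a tail of `∑
‖xᵢ‖²`. -/
theorem IsChannel.hasSum_op_self {E : (H →L[ℂ] H) → (L →L[ℂ] L)} (hE : IsChannel E)
    {x : ι → H} (hx : SqSum x) :
    HasSum (fun i => E (InnerProductSpace.rankOne ℂ (x i) (x i))) (E (op x x)) := by
  have key : ∀ s : Finset ι, ‖E (op x x) - ∑ i ∈ s, E (InnerProductSpace.rankOne ℂ (x i) (x i))‖ ≤
      ∑' i : {i // i ∉ s}, ‖x i‖ ^ 2 := by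
    intro s
    have hx' : SqSum fun i : {i // i ∉ s} => x i := hx.comp_injective Subtype.val_injective
    have hr : ∀ i ∈ s, InnerProductSpace.rankOne ℂ (x i) (x i) ∈ traceClass H :=
      fun i _ => rankOne_mem_traceClass _ _
    rw [← hE.linear.map_sum hr, ← hE.map_sub (op_mem_traceClass hx hx) (Submodule.sum_mem _ hr),
      op_sub_sum hx]
    have hT := op_mem_traceClass hx' hx'
    refine (norm_le_trace (hE.map_isPositive hT (op_self_isPositive hx'))
      (hE.map_traceClass _ hT)).1.trans ((hE.trace_le _ hT (op_self_isPositive hx')).trans ?_)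
    rw [trace_op_self hx', Complex.ofReal_re]
  rw [HasSum, SummationFilter.unconditional_filter, tendsto_iff_norm_sub_tendsto_zero]
  refine squeeze_zero (fun _ => norm_nonneg _) (fun s => ?_) (tendsto_tsum_compl_atTop_zero
    fun i => ‖x i‖ ^ 2)
  rw [norm_sub_rev]
  exact key s

theorem IsChannel.map_op_polarization {E : (H →L[ℂ] H) → (L →L[ℂ] L)} (hE : IsChannel E)
    {x y : ι → H} (hx : SqSum x) (hy : SqSum y) :
    E (op x y) = (4 : ℂ)⁻¹ • (E (op (fun i => x i + (1 : ℂ) • y i) (fun i => x i + (1 : ℂ) • y i)) -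
      E (op (fun i => x i + (-1 : ℂ) • y i) (fun i => x i + (-1 : ℂ) • y i)) +
      Complex.I • E (op (fun i => x i + Complex.I • y i) (fun i => x i + Complex.I • y i)) -
      Complex.I • E (op (fun i => x i + (-Complex.I) • y i)
        (fun i => x i + (-Complex.I) • y i))) := by
  have h : ∀ c : ℂ, op (fun i => x i + c • y i) (fun i => x i + c • y i) ∈ traceClass H :=
    fun c => op_self_mem_traceClass (hx.add (hy.smul c))
  have h1 := h 1
  simp only [one_smul] at h1
  have h12 := Submodule.sub_mem _ h1 (h (-1))
  have h3 := Submodule.smul_mem _ Complex.I (h Complex.I)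
  have h4 := Submodule.smul_mem _ Complex.I (h (-Complex.I))
  simp only [one_smul]
  rw [op_polarization hx hy, hE.map_smul _ _ (Submodule.sub_mem _ (Submodule.add_mem _ h12 h3) h4),
    hE.map_sub (Submodule.add_mem _ h12 h3) h4, hE.map_add _ h12 _ h3, hE.map_sub h1 (h _),
    hE.map_smul _ _ (h _), hE.map_smul _ _ (h _)]

/-- A channel commutes with the series `∑ᵢ |xᵢ⟩⟨yᵢ|`. -/
theorem IsChannel.hasSum_op {E : (H →L[ℂ] H) → (L →L[ℂ] L)} (hE : IsChannel E)
    {x y : ι → H} (hx : SqSum x) (hy : SqSum y) :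
    HasSum (fun i => E (InnerProductSpace.rankOne ℂ (x i) (y i))) (E (op x y)) := by
  have hs := fun c : ℂ => hE.hasSum_op_self (hx.add (hy.smul c))
  rw [hE.map_op_polarization hx hy]
  refine ((((((hs 1).sub (hs (-1))).add ((hs Complex.I).const_smul Complex.I)).sub
    ((hs (-Complex.I)).const_smul Complex.I))).const_smul (4 : ℂ)⁻¹).congr_fun fun i => ?_
  have h := hE.map_op_polarization (x := fun _ : Unit => x i) (y := fun _ => y i)
    (SqSum.of_fintype _) (SqSum.of_fintype _)
  simpa only [op_unique] using h

theorem trace_isDeterministic {E : (H →L[ℂ] H) → (L →L[ℂ] L)} (hE : IsDeterministicChannel E)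
    [Fintype κ] (f : OrthonormalBasis κ ℂ K) {X : HTensor H K →L[ℂ] HTensor H K}
    [FiniteDimensional ℂ L] (hX : X ∈ traceClass _) : trace (ampLeft E X) = trace X := by
  have := Module.Basis.finiteDimensional_of_finite f.toBasis
  rw [trace_eq_sum_blockRight f hX,
    trace_eq_sum_blockRight f (mem_traceClass_of_finiteDimensional (ampLeft E X))]
  refine Finset.sum_congr rfl fun m _ => ?_
  have hb := fun s s' => blockRight_mem_traceClass hX s s'
  rw [blockRight_ampLeft hE.toIsChannel.linear hb, hE.trace_eq _ (hb _ _)]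

/-! ### The extraction map `X ↦ Tr_P (Γ X Γ†)` -/

/-- The Kraus operators `(⟨b| ⊗ 1) Γ` of the extraction map applied to a family of vectors. -/
def extractionFamily (Γ : K →ₗᵢ[ℂ] HTensor K H) (x : ι → K) (p : ι × basisIndex K) : H :=
  sliceLeft (basis K p.2) (Γ (x p.1))

theorem SqSum.extractionFamily {x : ι → K} (hx : SqSum x) (Γ : K →ₗᵢ[ℂ] HTensor K H) :
    SqSum (extractionFamily Γ x) := by
  rw [SqSum, summable_prod_of_nonneg fun _ => sq_nonneg _]
  refine ⟨fun i => (hasSum_norm_sq_sliceLeft (basis K) (Γ (x i))).summable, ?_⟩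
  refine Summable.congr hx fun i => ?_
  rw [← Γ.norm_map]
  exact (hasSum_norm_sq_sliceLeft (basis K) (Γ (x i))).tsum_eq.symm

theorem conj_op (Γ : H →ₗᵢ[ℂ] K) {x y : ι → H} (hx : SqSum x) (hy : SqSum y) :
    conj Γ (op x y) = op (fun i => Γ (x i)) fun i => Γ (y i) :=
  comp_op_comp_adjoint hx hy _ _

theorem hasSum_blockLeft_conj_op (Γ : K →ₗᵢ[ℂ] HTensor K H) {x y : ι → K} (hx : SqSum x)
    (hy : SqSum y) : HasSum (fun i => blockLeft (basis K i) (basis K i) (conj Γ (op x y)))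
      (op (extractionFamily Γ x) (extractionFamily Γ y)) := by
  refine (op_prod_fiberwise_swap (hx.extractionFamily Γ) (hy.extractionFamily Γ)).congr_fun
    fun i => ?_
  rw [conj_op Γ hx hy]
  exact blockLeft_op (hx.map Γ.toContinuousLinearMap) (hy.map Γ.toContinuousLinearMap) _ _

theorem localExtraction_op (Γ : K →ₗᵢ[ℂ] HTensor K H) {x y : ι → K} (hx : SqSum x)
    (hy : SqSum y) :
    localExtraction Γ (op x y) = op (extractionFamily Γ x) (extractionFamily Γ y) :=
  (hasSum_blockLeft_conj_op Γ hx hy).tsum_eq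

theorem hasSum_localExtraction (Γ : K →ₗᵢ[ℂ] HTensor K H) {T : K →L[ℂ] K}
    (hT : T ∈ traceClass K) :
    HasSum (fun i => blockLeft (basis K i) (basis K i) (conj Γ T)) (localExtraction Γ T) := by
  obtain ⟨ι, x, y, hx, hy, rfl⟩ := exists_op hT
  rw [localExtraction_op Γ hx hy]
  exact hasSum_blockLeft_conj_op Γ hx hy

theorem localExtraction_linear (Γ : K →ₗᵢ[ℂ] HTensor K H) :
    LinearOnTraceClass (localExtraction Γ) := by
  refine ⟨fun S hS T hT => ?_, fun c T hT => ?_⟩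
  · refine (hasSum_localExtraction Γ (Submodule.add_mem _ hS hT)).unique
      (((hasSum_localExtraction Γ hS).add (hasSum_localExtraction Γ hT)).congr_fun fun i => ?_)
    ext a
    simp [blockLeft, conj]
  · refine (hasSum_localExtraction Γ (Submodule.smul_mem _ c hT)).unique
      (((hasSum_localExtraction Γ hT).const_smul c).congr_fun fun i => ?_)
    ext a
    simp [blockLeft, conj]

theorem trace_localExtraction (Γ : K →ₗᵢ[ℂ] HTensor K H) {T : K →L[ℂ] K}
    (hT : T ∈ traceClass K) : trace (localExtraction Γ T) = trace T := by
  obtain ⟨ι, x, y, hx, hy, rfl⟩ := exists_op hT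
  rw [localExtraction_op Γ hx hy]
  have h := hasSum_trace_op (hx.extractionFamily Γ) (hy.extractionFamily Γ)
  have h2 := h.prod_fiberwise fun i => hasSum_inner_sliceLeft (basis K) (Γ (y i)) (Γ (x i))
  simp only [Γ.inner_map_map] at h2
  exact h2.unique (hasSum_trace_op hx hy)

/-- The term of the partial trace at the basis vector `b` is the quadratic form of `T` at the
vectors `Γ† (b ⊗ xᵢ)`. -/
theorem localExtraction_posMatrix [Fintype κ] (Γ : K →ₗᵢ[ℂ] HTensor K H)
    {T : κ → κ → K →L[ℂ] K} (hT : ∀ i j, T i j ∈ traceClass K) (hp : PosMatrix T) :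
    PosMatrix fun i j => localExtraction Γ (T i j) := by
  intro x
  have h : HasSum (fun b => ∑ i, ∑ j, (inner ℂ (x i)
      (blockLeft (basis K b) (basis K b) (conj Γ (T i j)) (x j)) : ℂ))
      (∑ i, ∑ j, inner ℂ (x i) (localExtraction Γ (T i j) (x j))) := by
    refine hasSum_sum fun i _ => hasSum_sum fun j _ => ?_
    have h1 := ContinuousLinearMap.hasSum (ContinuousLinearMap.apply ℂ H (x j))
      (hasSum_localExtraction Γ (hT i j))
    exact ContinuousLinearMap.hasSum (innerSL ℂ (x i)) h1
  rw [← h.tsum_eq]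
  refine tsum_nonneg fun b => ?_
  have h2 := hp fun i => ContinuousLinearMap.adjoint Γ.toContinuousLinearMap (tmul (basis K b) (x i))
  convert h2 using 4 with i _ j _
  rw [inner_blockLeft, conj, ContinuousLinearMap.adjoint_inner_left]
  rfl

end Slices

/-! ### Fidelity in finite dimension -/

section Fidelity

open ContinuousLinearMap (adjoint)

variable {K : Type u} {L : Type v} {M : Type w}
  [NormedAddCommGroup K] [InnerProductSpace ℂ K] [CompleteSpace K]
  [NormedAddCommGroup L] [InnerProductSpace ℂ L] [CompleteSpace L]
  [NormedAddCommGroup M] [InnerProductSpace ℂ M] [CompleteSpace M]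

/-- If `‖B x‖ ≤ ‖A x‖` for all `x`, then `B = C A` for a contraction `C`. -/
theorem exists_contraction_comp [FiniteDimensional ℂ K] (A : K →L[ℂ] L) (B : K →L[ℂ] M)
    (h : ∀ x, ‖B x‖ ≤ ‖A x‖) : ∃ C : L →L[ℂ] M, ‖C‖ ≤ 1 ∧ C.comp A = B := by
  let R : Submodule ℂ L := LinearMap.range (A : K →ₗ[ℂ] L)
  -- `C` is `B ∘ s` after the orthogonal projection onto the range of `A`. The choice of the section
  -- `s` is immaterial, since `B` vanishes on the kernel of `A`.
  obtain ⟨s, hs⟩ := (A : K →ₗ[ℂ] L).rangeRestrict.exists_rightInverse_of_surjective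
    (LinearMap.range_rangeRestrict _)
  have hAs : ∀ y : R, A (s y) = y := fun y => congrArg Subtype.val (LinearMap.congr_fun hs y)
  let g : R →L[ℂ] M := LinearMap.toContinuousLinearMap ((B : K →ₗ[ℂ] M).comp s)
  have hg : ∀ y : R, g y = B (s y) := fun y => rfl
  refine ⟨g.comp R.orthogonalProjectionOnto, ?_, ?_⟩
  · refine ContinuousLinearMap.opNorm_le_bound _ zero_le_one fun y => ?_
    rw [ContinuousLinearMap.comp_apply, hg, one_mul]
    refine (h _).trans ?_
    rw [hAs]
    exact R.norm_orthogonalProjectionOnto_apply_le y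
  · ext x
    have hx : A x ∈ R := ⟨x, rfl⟩
    rw [ContinuousLinearMap.comp_apply, ContinuousLinearMap.comp_apply,
      R.orthogonalProjectionOnto_mem_subspace_eq_self ⟨A x, hx⟩, hg, ← sub_eq_zero, ← map_sub]
    have := h (s ⟨A x, hx⟩ - x)
    rw [map_sub A, hAs, sub_self, norm_zero] at this
    exact norm_le_zero_iff.mp this

/-! ### Traces, Hilbert-Schmidt vectors and square roots -/

theorem trace_comp_comm [FiniteDimensional ℂ K] [FiniteDimensional ℂ L] (A : K →L[ℂ] L)
    (B : L →L[ℂ] K) : trace (A.comp B) = trace (B.comp A) := by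
  rw [trace_eq_linearMap_trace, trace_eq_linearMap_trace]
  exact LinearMap.trace_comp_comm' (B : L →ₗ[ℂ] K) (A : K →ₗ[ℂ] L)

theorem trace_mul_comm [FiniteDimensional ℂ K] (A B : K →L[ℂ] K) : trace (A * B) = trace (B * A) :=
  trace_comp_comm A B

/-- The vector of the values of an operator on a fixed orthonormal basis. -/
def hsVec [FiniteDimensional ℂ L] (A : L →L[ℂ] K) :
    PiLp 2 fun _ : Fin (Module.finrank ℂ L) => K :=
  WithLp.toLp 2 fun i => A (stdOrthonormalBasis ℂ L i)

/-- `Tr A B†` is the Hilbert-Schmidt inner product; as an inner product of vectors it gives access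
to Cauchy-Schwarz and to plane geometry. -/
theorem trace_comp_adjoint [FiniteDimensional ℂ L] (A B : L →L[ℂ] K) :
    trace (A.comp (adjoint B)) = inner ℂ (hsVec B) (hsVec A) := by
  have h1 : SqSum (fun i => stdOrthonormalBasis ℂ L i) := SqSum.of_fintype _
  have h2 : op (fun i => stdOrthonormalBasis ℂ L i) (fun i => stdOrthonormalBasis ℂ L i) =
      ContinuousLinearMap.id ℂ L := by
    rw [op, tsum_fintype]
    exact (stdOrthonormalBasis ℂ L).sum_rankOne_eq_id
  have h3 := comp_op_comp_adjoint h1 h1 A B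
  rw [h2, ContinuousLinearMap.id_comp] at h3
  rw [h3, trace_op (h1.map A) (h1.map B), tsum_fintype, PiLp.inner_apply]
  rfl

theorem trace_comp_adjoint_self [FiniteDimensional ℂ L] (A : L →L[ℂ] K) :
    trace (A.comp (adjoint A)) = ((‖hsVec A‖ ^ 2 : ℝ) : ℂ) := by
  rw [trace_comp_adjoint, inner_self_eq_ofReal]

theorem norm_hsVec_comp_le [FiniteDimensional ℂ L] (W : K →L[ℂ] M) (hW : ‖W‖ ≤ 1)
    (A : L →L[ℂ] K) : ‖hsVec (W.comp A)‖ ≤ ‖hsVec A‖ := by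
  rw [PiLp.norm_eq_of_L2, PiLp.norm_eq_of_L2]
  refine Real.sqrt_le_sqrt (Finset.sum_le_sum fun i _ => ?_)
  refine pow_le_pow_left₀ (norm_nonneg _) ((W.le_opNorm _).trans ?_) 2
  exact mul_le_of_le_one_left (norm_nonneg _) hW

theorem re_trace_mono [FiniteDimensional ℂ K] {S T : K →L[ℂ] K}
    (h : ∀ x, (inner ℂ x (S x) : ℂ).re ≤ (inner ℂ x (T x) : ℂ).re) :
    (trace S).re ≤ (trace T).re := by
  rw [trace_eq_sum (stdOrthonormalBasis ℂ K), trace_eq_sum (stdOrthonormalBasis ℂ K),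
    Complex.re_sum, Complex.re_sum]
  exact Finset.sum_le_sum fun i _ => h _

theorem trace_nonneg_of_isPositive {T : K →L[ℂ] K} (hT : T.IsPositive) : 0 ≤ trace T :=
  tsum_nonneg fun _ => hT.inner_nonneg_right _

theorem ofReal_re_trace {T : K →L[ℂ] K} (hT : T.IsPositive) : ((trace T).re : ℂ) = trace T :=
  Complex.ext rfl (Complex.nonneg_iff.mp (trace_nonneg_of_isPositive hT)).2

theorem sqrt_isPositive (T : K →L[ℂ] K) : (CFC.sqrt T).IsPositive :=
  (ContinuousLinearMap.nonneg_iff_isPositive _).mp (CFC.sqrt_nonneg T)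

theorem adjoint_sqrt (T : K →L[ℂ] K) : adjoint (CFC.sqrt T) = CFC.sqrt T :=
  (sqrt_isPositive T).isSelfAdjoint

theorem sqrt_mul_sqrt {T : K →L[ℂ] K} (hT : T.IsPositive) : CFC.sqrt T * CFC.sqrt T = T :=
  CFC.sqrt_mul_sqrt_self T ((ContinuousLinearMap.nonneg_iff_isPositive T).mpr hT)

theorem exists_adjoint_eq_self_comp_self {T : K →L[ℂ] K} (hT : T.IsPositive) :
    ∃ S : K →L[ℂ] K, adjoint S = S ∧ S.comp S = T :=
  ⟨CFC.sqrt T, adjoint_sqrt T, sqrt_mul_sqrt hT⟩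

theorem norm_sq_sqrt_apply {T : K →L[ℂ] K} (hT : T.IsPositive) (x : K) :
    ‖CFC.sqrt T x‖ ^ 2 = (inner ℂ x (T x) : ℂ).re := by
  have h : (inner ℂ x (T x) : ℂ) = inner ℂ (CFC.sqrt T x) (CFC.sqrt T x) := by
    rw [(sqrt_isPositive T).inner_left_eq_inner_right]
    conv_lhs => rw [← sqrt_mul_sqrt hT]
    rfl
  rw [h, inner_self_eq_ofReal, Complex.ofReal_re]

/-- Cauchy-Schwarz for the Hilbert-Schmidt vectors of `W √Q` and `√Q`. -/
theorem norm_trace_mul_le [FiniteDimensional ℂ K] {Q W : K →L[ℂ] K} (hQ : Q.IsPositive)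
    (hW : ‖W‖ ≤ 1) : ‖trace (W * Q)‖ ≤ (trace Q).re := by
  have h1 : W * Q = (W.comp (CFC.sqrt Q)).comp (adjoint (CFC.sqrt Q)) := by
    rw [adjoint_sqrt, ContinuousLinearMap.comp_assoc]
    conv_lhs => rw [← sqrt_mul_sqrt hQ]
    rfl
  have h2 : Q = (CFC.sqrt Q).comp (adjoint (CFC.sqrt Q)) := by
    rw [adjoint_sqrt]
    exact (sqrt_mul_sqrt hQ).symm
  have h3 : (trace Q).re = ‖hsVec (CFC.sqrt Q)‖ ^ 2 := by
    conv_lhs => rw [h2]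
    rw [trace_comp_adjoint_self, Complex.ofReal_re]
  rw [h1, trace_comp_adjoint, h3, sq]
  exact (norm_inner_le_norm _ _).trans
    (mul_le_mul_of_nonneg_left (norm_hsVec_comp_le W hW _) (norm_nonneg _))

/-- The square root of the fidelity. -/
def rootFidelity (ρ σ : K →L[ℂ] K) : ℝ :=
  (trace (CFC.sqrt (CFC.sqrt ρ * σ * CFC.sqrt ρ))).re

theorem fidelity_eq_sq (ρ σ : K →L[ℂ] K) : fidelity ρ σ = rootFidelity ρ σ ^ 2 := rfl

theorem rootFidelity_nonneg (ρ σ : K →L[ℂ] K) : 0 ≤ rootFidelity ρ σ :=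
  (Complex.nonneg_iff.mp (trace_nonneg_of_isPositive (sqrt_isPositive _))).1

/-- Both squared norms are `⟨√ρ x, σ √ρ x⟩`. Hence `√σ √ρ` and `√(√ρ σ √ρ)` factor through each
other by contractions, which stands in for the polar decomposition. -/
theorem norm_sqrt_sqrt_mul {ρ σ : K →L[ℂ] K} (hσ : σ.IsPositive) (x : K) :
    ‖CFC.sqrt (CFC.sqrt ρ * σ * CFC.sqrt ρ) x‖ = ‖(CFC.sqrt σ * CFC.sqrt ρ) x‖ := by
  have hp : (CFC.sqrt ρ * σ * CFC.sqrt ρ).IsPositive := by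
    have := hσ.conj_adjoint (CFC.sqrt ρ)
    rwa [adjoint_sqrt] at this
  have h : ‖CFC.sqrt (CFC.sqrt ρ * σ * CFC.sqrt ρ) x‖ ^ 2 =
      ‖(CFC.sqrt σ * CFC.sqrt ρ) x‖ ^ 2 := by
    rw [norm_sq_sqrt_apply hp]
    change _ = ‖CFC.sqrt σ (CFC.sqrt ρ x)‖ ^ 2
    rw [norm_sq_sqrt_apply hσ, (sqrt_isPositive ρ).inner_left_eq_inner_right]
    rfl
  exact (pow_left_inj₀ (norm_nonneg _) (norm_nonneg _) two_ne_zero).mp h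

/-- Lower bounds on the fidelity: `|Tr A B†| ≤ √F(ρ, σ)` whenever `A A† ≤ ρ` and `B B† ≤ σ`. -/
theorem norm_trace_le_rootFidelity [FiniteDimensional ℂ K] [FiniteDimensional ℂ L]
    {ρ σ : K →L[ℂ] K} (hρ : ρ.IsPositive) (hσ : σ.IsPositive) (A B : L →L[ℂ] K)
    (hA : ∀ x, ‖adjoint A x‖ ^ 2 ≤ (inner ℂ x (ρ x) : ℂ).re)
    (hB : ∀ x, ‖adjoint B x‖ ^ 2 ≤ (inner ℂ x (σ x) : ℂ).re) :
    ‖trace (A.comp (adjoint B))‖ ≤ rootFidelity ρ σ := by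
  obtain ⟨U, hU, hUA⟩ := exists_contraction_comp (CFC.sqrt ρ) (adjoint A) fun x =>
    (pow_le_pow_iff_left₀ (norm_nonneg _) (norm_nonneg _) two_ne_zero).mp
      ((hA x).trans_eq (norm_sq_sqrt_apply hρ x).symm)
  obtain ⟨V, hV, hVB⟩ := exists_contraction_comp (CFC.sqrt σ) (adjoint B) fun x =>
    (pow_le_pow_iff_left₀ (norm_nonneg _) (norm_nonneg _) two_ne_zero).mp
      ((hB x).trans_eq (norm_sq_sqrt_apply hσ x).symm)
  -- With `A = √ρ U†` and `B = √σ V†`, cyclicity turns `Tr A B†` into `Tr U† V C Q`, where `Q = √(√ρ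
  -- σ √ρ)` and `U† V C` is a contraction.
  obtain ⟨C, hC, hCN⟩ := exists_contraction_comp
    (CFC.sqrt (CFC.sqrt ρ * σ * CFC.sqrt ρ)) (CFC.sqrt σ * CFC.sqrt ρ) fun x =>
      (norm_sqrt_sqrt_mul hσ x).ge
  have hAU : A = (CFC.sqrt ρ).comp (adjoint U) := by
    rw [← ContinuousLinearMap.adjoint_adjoint A, ← hUA, ContinuousLinearMap.adjoint_comp,
      adjoint_sqrt]
  have h1 : A.comp (adjoint B) =
      (CFC.sqrt ρ).comp (((adjoint U).comp V).comp (CFC.sqrt σ)) := by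
    rw [← hVB, hAU]
    rfl
  have h2 : (((adjoint U).comp V).comp (CFC.sqrt σ)).comp (CFC.sqrt ρ) =
      (((adjoint U).comp V).comp C) * CFC.sqrt (CFC.sqrt ρ * σ * CFC.sqrt ρ) := by
    change ((adjoint U).comp V).comp ((CFC.sqrt σ) * (CFC.sqrt ρ)) = _
    rw [← hCN]
    rfl
  rw [h1, trace_comp_comm, h2]
  refine norm_trace_mul_le (sqrt_isPositive _) ?_
  refine (ContinuousLinearMap.opNorm_comp_le _ _).trans (mul_le_one₀ ?_ (norm_nonneg _) hC)
  refine (ContinuousLinearMap.opNorm_comp_le _ _).trans (mul_le_one₀ ?_ (norm_nonneg _) hV)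
  rwa [LinearIsometryEquiv.norm_map]

theorem sqrt_comp_adjoint_sqrt {ρ : K →L[ℂ] K} (hρ : ρ.IsPositive) :
    (CFC.sqrt ρ).comp (adjoint (CFC.sqrt ρ)) = ρ := by
  rw [adjoint_sqrt]
  exact sqrt_mul_sqrt hρ

/-- The fidelity is attained: `√F(ρ, σ) = Tr √ρ B†` for some `B` with `B B† ≤ σ`. -/
theorem exists_trace_eq_rootFidelity [FiniteDimensional ℂ K] (ρ : K →L[ℂ] K) {σ : K →L[ℂ] K}
    (hσ : σ.IsPositive) : ∃ B : K →L[ℂ] K,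
      (∀ x, ‖adjoint B x‖ ^ 2 ≤ (inner ℂ x (σ x) : ℂ).re) ∧
      trace ((CFC.sqrt ρ).comp (adjoint B)) = rootFidelity ρ σ := by
  -- Here `C` carries `√σ √ρ` to `√(√ρ σ √ρ)`, so `B = √σ C†` satisfies `B B† ≤ σ` and `Tr √ρ B† =
  -- Tr C √σ √ρ` is the root fidelity.
  obtain ⟨C, hC, hCN⟩ := exists_contraction_comp (CFC.sqrt σ * CFC.sqrt ρ)
    (CFC.sqrt (CFC.sqrt ρ * σ * CFC.sqrt ρ)) fun x => (norm_sqrt_sqrt_mul hσ x).le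
  refine ⟨(CFC.sqrt σ).comp (adjoint C), fun x => ?_, ?_⟩
  · rw [ContinuousLinearMap.adjoint_comp, ContinuousLinearMap.adjoint_adjoint, adjoint_sqrt,
      ← norm_sq_sqrt_apply hσ]
    refine pow_le_pow_left₀ (norm_nonneg _) ((C.le_opNorm _).trans ?_) 2
    exact mul_le_of_le_one_left (norm_nonneg _) hC
  · rw [ContinuousLinearMap.adjoint_comp, ContinuousLinearMap.adjoint_adjoint, adjoint_sqrt,
      trace_comp_comm, rootFidelity, ofReal_re_trace (sqrt_isPositive _)]
    conv_rhs => rw [← hCN]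
    rfl

theorem norm_hsVec_sq_le [FiniteDimensional ℂ K] {ρ A : K →L[ℂ] K}
    (hA : ∀ x, ‖adjoint A x‖ ^ 2 ≤ (inner ℂ x (ρ x) : ℂ).re) :
    ‖hsVec A‖ ^ 2 ≤ (trace ρ).re := by
  have h := trace_comp_adjoint_self A
  rw [← Complex.ofReal_re (‖hsVec A‖ ^ 2), ← h]
  refine re_trace_mono fun x => le_trans (le_of_eq ?_) (hA x)
  rw [ContinuousLinearMap.comp_apply, ← ContinuousLinearMap.adjoint_inner_left,
    inner_self_eq_ofReal, Complex.ofReal_re]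

theorem norm_sq_adjoint_of_eq {ρ : K →L[ℂ] K} {A : L →L[ℂ] K} (h : A.comp (adjoint A) = ρ) (x : K) :
    ‖adjoint A x‖ ^ 2 = (inner ℂ x (ρ x) : ℂ).re := by
  rw [← h, ContinuousLinearMap.comp_apply, ← ContinuousLinearMap.adjoint_inner_left,
    inner_self_eq_ofReal, Complex.ofReal_re]

theorem rootFidelity_le_one [FiniteDimensional ℂ K] {ρ σ : K →L[ℂ] K}
    (hρ : ρ.IsPositive) (hσ : σ.IsPositive) (hρ1 : trace ρ = 1) (hσ1 : trace σ = 1) :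
    rootFidelity ρ σ ≤ 1 := by
  obtain ⟨B, hB, hAB⟩ := exists_trace_eq_rootFidelity ρ hσ
  set A := CFC.sqrt ρ
  have h1 := norm_hsVec_sq_le (fun x => (norm_sq_adjoint_of_eq (sqrt_comp_adjoint_sqrt hρ) x).le)
  have h2 := norm_hsVec_sq_le hB
  rw [hρ1, Complex.one_re] at h1
  rw [hσ1, Complex.one_re] at h2
  rw [trace_comp_adjoint] at hAB
  have h3 : rootFidelity ρ σ ≤ ‖hsVec B‖ * ‖hsVec A‖ := by
    have := norm_inner_le_norm (𝕜 := ℂ) (hsVec B) (hsVec A)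
    rw [hAB] at this
    exact (le_abs_self _).trans (by simpa using this)
  nlinarith [norm_nonneg (hsVec A), norm_nonneg (hsVec B), sq_nonneg (‖hsVec A‖ - ‖hsVec B‖)]

/-- Two vectors of norm at most one, with inner products `p`, `q` with a unit vector. -/
theorem re_inner_ge_of_inner_unit {V : Type*} [NormedAddCommGroup V] [InnerProductSpace ℂ V]
    {a b c : V} (ha : ‖a‖ ^ 2 = 1) (hb : ‖b‖ ^ 2 ≤ 1) (hc : ‖c‖ ^ 2 ≤ 1) {p q : ℝ}
    (hp : inner ℂ b a = (p : ℂ)) (hq : inner ℂ c a = (q : ℂ)) :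
    p * q - √(1 - p ^ 2) * √(1 - q ^ 2) ≤ (inner ℂ b c : ℂ).re := by
  have haa : inner ℂ a a = (1 : ℂ) := by
    rw [inner_self_eq_ofReal, ha, Complex.ofReal_one]
  have hp' : inner ℂ a b = (p : ℂ) := by rw [← inner_conj_symm, hp, Complex.conj_ofReal]
  have hq' : inner ℂ a c = (q : ℂ) := by rw [← inner_conj_symm, hq, Complex.conj_ofReal]
  -- The component of `d` orthogonal to `a` has squared norm `‖d‖² - r²`.
  have h1 : ∀ (d : V) (r : ℝ), inner ℂ d a = (r : ℂ) → ‖d‖ ^ 2 ≤ 1 →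
      ‖d - (r : ℂ) • a‖ ≤ √(1 - r ^ 2) := by
    intro d r hr hd
    refine Real.le_sqrt_of_sq_le ?_
    have hr' : inner ℂ a d = (r : ℂ) := by rw [← inner_conj_symm, hr, Complex.conj_ofReal]
    have h2 : (inner ℂ (d - (r : ℂ) • a) (d - (r : ℂ) • a) : ℂ) = inner ℂ d d - (r : ℂ) ^ 2 := by
      simp only [inner_sub_left, inner_sub_right, inner_smul_left, inner_smul_right, hr, hr', haa,
        Complex.conj_ofReal]
      ring
    rw [inner_self_eq_ofReal, inner_self_eq_ofReal] at h2
    have h3 : ‖d - (r : ℂ) • a‖ ^ 2 = ‖d‖ ^ 2 - r ^ 2 := by exact_mod_cast h2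
    rw [h3]
    linarith
  have h2 : (inner ℂ b c : ℂ) = p * q + inner ℂ (b - (p : ℂ) • a) (c - (q : ℂ) • a) := by
    simp only [inner_sub_left, inner_sub_right, inner_smul_left, inner_smul_right, hp, hq', haa,
      Complex.conj_ofReal]
    ring
  have h3 := norm_inner_le_norm (𝕜 := ℂ) (b - (p : ℂ) • a) (c - (q : ℂ) • a)
  have h4 := mul_le_mul (h1 b p hp hb) (h1 c q hq hc) (norm_nonneg _) (Real.sqrt_nonneg _)
  have h5 := (abs_le.mp (Complex.abs_re_le_norm (inner ℂ (b - (p : ℂ) • a) (c - (q : ℂ) • a)))).1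
  have h6 : (inner ℂ b c : ℂ).re = p * q + (inner ℂ (b - (p : ℂ) • a) (c - (q : ℂ) • a) : ℂ).re := by
    rw [h2, Complex.add_re, ← Complex.ofReal_mul, Complex.ofReal_re]
  linarith

/-- The triangle inequality for the angles `arccos √F`. -/
theorem rootFidelity_triangle [FiniteDimensional ℂ K] {ρ σ τ : K →L[ℂ] K}
    (hρ : ρ.IsPositive) (hσ : σ.IsPositive) (hτ : τ.IsPositive)
    (hρ1 : trace ρ = 1) (hσ1 : trace σ = 1) (hτ1 : trace τ = 1) :
    rootFidelity ρ σ * rootFidelity ρ τ -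
      √(1 - rootFidelity ρ σ ^ 2) * √(1 - rootFidelity ρ τ ^ 2) ≤ rootFidelity σ τ := by
  -- `√ρ` is a unit Hilbert-Schmidt vector whose inner products with `B` and `C` are the two root
  -- fidelities; `⟨B, C⟩` is then bounded below by plane geometry and above by the root fidelity of
  -- `σ` and `τ`.
  obtain ⟨B, hB, hAB⟩ := exists_trace_eq_rootFidelity ρ hσ
  obtain ⟨C, hC, hAC⟩ := exists_trace_eq_rootFidelity ρ hτ
  rw [trace_comp_adjoint] at hAB hAC
  have hA : ‖hsVec (CFC.sqrt ρ)‖ ^ 2 = 1 := by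
    have h := trace_comp_adjoint_self (CFC.sqrt ρ)
    rw [sqrt_comp_adjoint_sqrt hρ, hρ1] at h
    exact_mod_cast h.symm
  have hB1 := norm_hsVec_sq_le hB
  have hC1 := norm_hsVec_sq_le hC
  rw [hσ1, Complex.one_re] at hB1
  rw [hτ1, Complex.one_re] at hC1
  refine (re_inner_ge_of_inner_unit hA hB1 hC1 hAB hAC).trans ?_
  have h := norm_trace_le_rootFidelity hσ hτ B C hB hC
  rw [trace_comp_adjoint, norm_inner_symm] at h
  exact (Complex.re_le_norm _).trans h

/-! ### Fidelity of normalized operators, and loss of trace -/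

theorem inner_smul_inv_trace (T : K →L[ℂ] K) (t : ℝ) (x : K) :
    (inner ℂ x (((t : ℂ)⁻¹ • T) x) : ℂ).re = t⁻¹ * (inner ℂ x (T x) : ℂ).re := by
  rw [smul_apply, inner_smul_right, ← Complex.ofReal_inv, Complex.re_ofReal_mul]

theorem smul_inv_isPositive {T : K →L[ℂ] K} (hT : T.IsPositive) {t : ℝ} (ht : 0 ≤ t) :
    ((t : ℂ)⁻¹ • T).IsPositive := by
  refine hT.smul_of_nonneg ?_
  rw [← Complex.ofReal_inv]
  exact Complex.zero_le_real.mpr (inv_nonneg.mpr ht)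

/-- Lower bounds on the fidelity of normalized positive operators. -/
theorem norm_trace_le_rootFidelity_smul [FiniteDimensional ℂ K] [FiniteDimensional ℂ L]
    {ρ σ : K →L[ℂ] K} (hρ : ρ.IsPositive) (hσ : σ.IsPositive) (A B : L →L[ℂ] K)
    (hA : ∀ x, ‖adjoint A x‖ ^ 2 ≤ (inner ℂ x (ρ x) : ℂ).re)
    (hB : ∀ x, ‖adjoint B x‖ ^ 2 ≤ (inner ℂ x (σ x) : ℂ).re) {s t : ℝ} (hs : 0 < s) (ht : 0 < t) :
    ‖trace (A.comp (adjoint B))‖ ≤ √(s * t) * rootFidelity ((s : ℂ)⁻¹ • ρ) ((t : ℂ)⁻¹ • σ) := by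
  have key : ∀ {r : ℝ} (_ : 0 < r) (T : K →L[ℂ] K) (D : L →L[ℂ] K),
      (∀ x, ‖adjoint D x‖ ^ 2 ≤ (inner ℂ x (T x) : ℂ).re) → ∀ x,
      ‖adjoint (((√r)⁻¹ : ℂ) • D) x‖ ^ 2 ≤ (inner ℂ x (((r : ℂ)⁻¹ • T) x) : ℂ).re := by
    intro r hr T D h x
    rw [inner_smul_inv_trace, map_smulₛₗ, smul_apply, norm_smul, mul_pow]
    refine mul_le_mul (le_of_eq ?_) (h x) (sq_nonneg _) (inv_nonneg.mpr hr.le)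
    rw [RCLike.norm_conj, norm_inv, Complex.norm_real, Real.norm_of_nonneg (Real.sqrt_nonneg _),
      inv_pow, Real.sq_sqrt hr.le]
  have h := norm_trace_le_rootFidelity (smul_inv_isPositive hρ hs.le) (smul_inv_isPositive hσ ht.le)
    _ _ (key hs ρ A hA) (key ht σ B hB)
  have h1 : (((√s)⁻¹ : ℂ) • A).comp (adjoint (((√t)⁻¹ : ℂ) • B)) =
      ((√(s * t) : ℂ)⁻¹) • A.comp (adjoint B) := by
    rw [map_smulₛₗ, ContinuousLinearMap.comp_smul, ContinuousLinearMap.smul_comp, smul_smul,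
      ← Complex.ofReal_inv, Complex.conj_ofReal, ← Complex.ofReal_inv, ← Complex.ofReal_inv,
      ← Complex.ofReal_mul, Real.sqrt_mul hs.le, mul_inv, mul_comm]
  have hst : 0 < √(s * t) := Real.sqrt_pos.mpr (mul_pos hs ht)
  rw [h1, trace_smul, norm_mul, norm_inv, Complex.norm_real, Real.norm_of_nonneg hst.le,
    inv_mul_le_iff₀ hst] at h
  exact h

/-- Lower bounds on the fidelity from a positive `2 × 2` operator matrix. -/
theorem PosMatrix.norm_trace_le_rootFidelity [FiniteDimensional ℂ K]
    {N : Fin 2 → Fin 2 → K →L[ℂ] K} (hN : PosMatrix N) {s t : ℝ} (hs : 0 < s) (ht : 0 < t) :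
    ‖trace (N 0 1)‖ ≤
      √(s * t) * rootFidelity ((s : ℂ)⁻¹ • N 0 0) ((t : ℂ)⁻¹ • N 1 1) := by
  -- The square root `S` of the block operator exhibits `N` as a Gram matrix, `N i j = Zᵢ† Zⱼ`; the
  -- fidelity bound is then applied to `Z₀†` and `Z₁†`.
  let f := EuclideanSpace.basisFun (Fin 2) ℂ
  set X := ofBlocks f N with hX
  have hXp : X.IsPositive := ofBlocks_isPositive f hN
  obtain ⟨S, hS, hSS⟩ := exists_adjoint_eq_self_comp_self hXp
  let Z : Fin 2 → K →L[ℂ] HTensor K (EuclideanSpace ℂ (Fin 2)) := fun i => S.comp (tmulRight (f i))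
  have hZ : ∀ i j, (adjoint (Z i)).comp (Z j) = N i j := by
    intro i j
    rw [← blockRight_ofBlocks f N i j, ← hX, blockRight]
    simp only [Z, ContinuousLinearMap.adjoint_comp, hS]
    rw [← hSS]
    rfl
  have hN' : ∀ i, (N i i).IsPositive := fun i => by
    rw [← hZ i i]
    exact ContinuousLinearMap.isPositive_adjoint_comp_self _
  have hZn : ∀ i x, ‖adjoint (adjoint (Z i)) x‖ ^ 2 ≤ (inner ℂ x (N i i x) : ℂ).re := by
    intro i x
    refine (norm_sq_adjoint_of_eq (A := adjoint (Z i)) ?_ x).le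
    rw [ContinuousLinearMap.adjoint_adjoint, hZ]
  have h := norm_trace_le_rootFidelity_smul (hN' 0) (hN' 1) _ _ (hZn 0) (hZn 1) hs ht
  rwa [ContinuousLinearMap.adjoint_adjoint, hZ] at h

/-- The effect of a loss of trace on the fidelity. -/
theorem mul_one_sub_sq_le {s t c f : ℝ} {x : ℂ} (hs0 : 0 ≤ s) (ht0 : 0 ≤ t) (hs : s ≤ 1)
    (ht : t ≤ 1) (hc : 0 ≤ c) (h : ‖(c : ℂ) - x‖ ^ 2 ≤ (1 - s) * (1 - t))
    (hx : ‖x‖ ≤ √(s * t) * f) : s * (1 - f ^ 2) ≤ 1 - c ^ 2 := by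
  have h1 : c ≤ √(1 - s) * √(1 - t) + √s * f * √t := by
    have h2 : ‖(c : ℂ)‖ ≤ ‖(c : ℂ) - x‖ + ‖x‖ := by
      simpa using norm_add_le ((c : ℂ) - x) x
    rw [Complex.norm_real, Real.norm_of_nonneg hc] at h2
    have h3 := Real.le_sqrt_of_sq_le h
    rw [Real.sqrt_mul (by linarith)] at h3
    rw [Real.sqrt_mul hs0] at hx
    linarith
  have h4 := Real.sq_sqrt hs0
  have h5 := Real.sq_sqrt ht0
  have h6 := Real.sq_sqrt (sub_nonneg.mpr hs)
  have h7 := Real.sq_sqrt (sub_nonneg.mpr ht)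
  have h8 : c ^ 2 ≤ (√(1 - s) * √(1 - t) + √s * f * √t) ^ 2 := pow_le_pow_left₀ hc h1 2
  -- Cauchy-Schwarz for `(√(1 - s), √s f)` and `(√(1 - t), √t)`, the second of which is a unit
  -- vector.
  have h9 : (√(1 - s) * √(1 - t) + √s * f * √t) ^ 2 ≤
      (√(1 - s) ^ 2 + (√s * f) ^ 2) * (√(1 - t) ^ 2 + √t ^ 2) := by
    nlinarith [sq_nonneg (√(1 - s) * √t - √s * f * √(1 - t))]
  rw [h6, h7, h5, mul_pow, h4] at h9
  nlinarith

/-- The fidelity after a contraction. -/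
theorem mul_one_sub_rootFidelity_sq_le [FiniteDimensional ℂ K] {ρ σ G : K →L[ℂ] K}
    (hρ : ρ.IsPositive) (hσ : σ.IsPositive) (hρ1 : trace ρ = 1) (hσ1 : trace σ = 1)
    (hG : ‖G‖ ≤ 1) {s t : ℝ} (hs : trace (G * ρ * adjoint G) = s)
    (ht : trace (G * σ * adjoint G) = t) (hs0 : 0 < s) (ht0 : 0 < t) :
    t * (1 - rootFidelity ((s : ℂ)⁻¹ • (G * ρ * adjoint G)) ((t : ℂ)⁻¹ • (G * σ * adjoint G)) ^ 2) ≤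
      1 - rootFidelity ρ σ ^ 2 := by
  obtain ⟨B, hB, hAB⟩ := exists_trace_eq_rootFidelity ρ hσ
  set A := CFC.sqrt ρ with hA
  have hA' := norm_sq_adjoint_of_eq (sqrt_comp_adjoint_sqrt hρ)
  rw [← hA] at hA'
  have hD0 : (1 - adjoint G * G).IsPositive := by
    rw [isPositive_iff_inner_nonneg]
    intro x
    have h1 : (inner ℂ x ((1 - adjoint G * G) x) : ℂ) = ((‖x‖ ^ 2 - ‖G x‖ ^ 2 : ℝ) : ℂ) := by
      rw [Complex.ofReal_sub, ← inner_self_eq_ofReal, ← inner_self_eq_ofReal,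
        ← ContinuousLinearMap.adjoint_inner_right, ← inner_sub_right]
      rfl
    rw [h1]
    refine Complex.zero_le_real.mpr (sub_nonneg.mpr (pow_le_pow_left₀ (norm_nonneg _) ?_ 2))
    exact (G.le_opNorm x).trans (mul_le_of_le_one_left (norm_nonneg _) hG)
  -- `D` completes `G` to an isometry, `G† G + D² = 1`. It splits `Tr A B†` into a kept part,
  -- bounded by the output fidelity, and a lost part, bounded by the lost traces `1 - s` and `1 -
  -- t`.
  set D := CFC.sqrt (1 - adjoint G * G) with hD
  have hDD : D * D = 1 - adjoint G * G := sqrt_mul_sqrt hD0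
  have hDa : adjoint D = D := adjoint_sqrt _
  have htr : ∀ T : K →L[ℂ] K, trace (D * T * D) = trace T - trace (G * T * adjoint G) := by
    intro T
    rw [trace_mul_comm, ← mul_assoc, hDD, sub_mul, one_mul, sub_eq_add_neg, ← neg_one_smul ℂ,
      trace_add (mem_traceClass_of_finiteDimensional _) (mem_traceClass_of_finiteDimensional _),
      trace_smul, mul_assoc (adjoint G), trace_mul_comm (adjoint G)]
    ring
  have hconj : ∀ (F T C : K →L[ℂ] K), (∀ x, ‖adjoint C x‖ ^ 2 ≤ (inner ℂ x (T x) : ℂ).re) →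
      ∀ x, ‖adjoint (F * C) x‖ ^ 2 ≤ (inner ℂ x ((F * T * adjoint F) x) : ℂ).re := by
    intro F T C h x
    have h2 : adjoint (F * C) x = adjoint C (adjoint F x) := by
      rw [show F * C = F.comp C from rfl, ContinuousLinearMap.adjoint_comp]
      rfl
    rw [h2]
    refine (h _).trans (le_of_eq ?_)
    rw [ContinuousLinearMap.adjoint_inner_left]
    rfl
  have hcross : ∀ F : K →L[ℂ] K, (F * A).comp (adjoint (F * B)) = F * (A.comp (adjoint B)) *
      adjoint F := by
    intro F
    rw [show F * B = F.comp B from rfl, ContinuousLinearMap.adjoint_comp]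
    rfl
  have hGp : ∀ {T : K →L[ℂ] K}, T.IsPositive → (G * T * adjoint G).IsPositive :=
    fun hT => hT.conj_adjoint G
  have h1 := norm_trace_le_rootFidelity_smul (hGp hρ) (hGp hσ) (G * A) (G * B)
    (hconj G ρ A fun x => (hA' x).le) (hconj G σ B hB) hs0 ht0
  have h2 : (rootFidelity ρ σ : ℂ) - trace ((G * A).comp (adjoint (G * B))) =
      inner ℂ (hsVec (D * B)) (hsVec (D * A)) := by
    rw [← trace_comp_adjoint, hcross, hcross, hDa, htr, hAB]
  have h3 : ‖hsVec (D * A)‖ ^ 2 ≤ 1 - s := by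
    refine (norm_hsVec_sq_le (hconj D ρ A fun x => (hA' x).le)).trans (le_of_eq ?_)
    rw [hDa, htr, hρ1, hs, ← Complex.ofReal_one, ← Complex.ofReal_sub, Complex.ofReal_re]
  have h4 : ‖hsVec (D * B)‖ ^ 2 ≤ 1 - t := by
    refine (norm_hsVec_sq_le (hconj D σ B hB)).trans (le_of_eq ?_)
    rw [hDa, htr, hσ1, ht, ← Complex.ofReal_one, ← Complex.ofReal_sub, Complex.ofReal_re]
  -- The roles of `s` and `t` are exchanged, because the estimate is wanted with the weight `t` of
  -- `σ`.
  refine mul_one_sub_sq_le (x := trace ((G * A).comp (adjoint (G * B)))) ht0.le hs0.le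
    (by nlinarith [sq_nonneg ‖hsVec (D * B)‖]) (by nlinarith [sq_nonneg ‖hsVec (D * A)‖])
    (rootFidelity_nonneg ρ σ) ?_ (by rwa [mul_comm t s])
  rw [h2]
  calc ‖(inner ℂ (hsVec (D * B)) (hsVec (D * A)) : ℂ)‖ ^ 2
      ≤ (‖hsVec (D * B)‖ * ‖hsVec (D * A)‖) ^ 2 :=
        pow_le_pow_left₀ (norm_nonneg _) (norm_inner_le_norm _ _) 2
    _ = ‖hsVec (D * B)‖ ^ 2 * ‖hsVec (D * A)‖ ^ 2 := mul_pow _ _ _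
    _ ≤ (1 - t) * (1 - s) := mul_le_mul h4 h3 (sq_nonneg _) ((sq_nonneg _).trans h4)

/-- The fidelity with a pure state. -/
theorem fidelity_pureState_le [FiniteDimensional ℂ K] {ρ : K →L[ℂ] K} (hρ : ρ.IsPositive)
    {φ : K} (hφ : ‖φ‖ = 1) : fidelity ρ (pureState φ) ≤ (inner ℂ φ (ρ φ) : ℂ).re := by
  have hσ : (pureState φ).IsPositive := InnerProductSpace.isPositive_rankOne_self φ
  obtain ⟨B, hB, hAB⟩ := exists_trace_eq_rootFidelity ρ hσ
  -- Since `B B† ≤ |φ⟩⟨φ|`, the operator `B†` is `V |φ⟩⟨φ|` with `V` a contraction, so `√ρ B†` has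
  -- rank one and its trace is a single inner product.
  obtain ⟨V, hV, hVB⟩ := exists_contraction_comp (pureState φ) (adjoint B) fun x => by
    refine (pow_le_pow_iff_left₀ (norm_nonneg _) (norm_nonneg _) two_ne_zero).mp
      ((hB x).trans (le_of_eq ?_))
    rw [pureState, InnerProductSpace.rankOne_apply, norm_smul, hφ, mul_one, inner_smul_right,
      mul_comm, inner_mul_inner_symm, Complex.ofReal_re]
  have h1 : (CFC.sqrt ρ).comp (adjoint B) =
      InnerProductSpace.rankOne ℂ (CFC.sqrt ρ (V φ)) φ := by
    rw [← hVB]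
    ext x
    simp [pureState]
  rw [h1, trace_rankOne] at hAB
  have h2 : rootFidelity ρ (pureState φ) ≤ ‖CFC.sqrt ρ φ‖ := by
    have h3 := norm_inner_le_norm (𝕜 := ℂ) (CFC.sqrt ρ φ) (V φ)
    rw [(sqrt_isPositive ρ).inner_left_eq_inner_right, hAB, Complex.norm_real] at h3
    have h4 : ‖V φ‖ ≤ 1 := by
      refine (V.le_opNorm φ).trans ?_
      rwa [hφ, mul_one]
    exact (le_abs_self _).trans (h3.trans (mul_le_of_le_one_right (norm_nonneg _) h4))
  rw [fidelity_eq_sq, ← norm_sq_sqrt_apply hρ]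
  exact pow_le_pow_left₀ (rootFidelity_nonneg _ _) h2 2

end Fidelity

/-! ### Loss of trace in a channel -/

section Core

variable {A : Type u} {B : Type v} {Ho Hi : Type*}
  [NormedAddCommGroup A] [InnerProductSpace ℂ A] [CompleteSpace A]
  [NormedAddCommGroup B] [InnerProductSpace ℂ B] [CompleteSpace B]
  [NormedAddCommGroup Ho] [InnerProductSpace ℂ Ho] [CompleteSpace Ho]
  [NormedAddCommGroup Hi] [InnerProductSpace ℂ Hi] [CompleteSpace Hi]
  {ι κ : Type*}

theorem norm_sq_le_of_posSemidef (g : Fin 2 → Fin 2 → ℂ)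
    (hg : ∀ c : Fin 2 → ℂ, 0 ≤ ∑ i, ∑ j, (starRingEnd ℂ (c i) * c j) * g i j) :
    ‖g 0 1‖ ^ 2 ≤ (g 0 0).re * (g 1 1).re := by
  have h0 := Complex.nonneg_iff.mp (hg ![1, 0])
  have h1 := Complex.nonneg_iff.mp (hg ![0, 1])
  have h2 := (Complex.nonneg_iff.mp (hg ![1, 1])).2
  have h3 := (Complex.nonneg_iff.mp (hg ![1, Complex.I])).2
  simp [Fin.sum_univ_two] at h0 h1 h2 h3
  have hre : (g 1 0).re = (g 0 1).re := by linarith [h0.2, h1.2]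
  have him : (g 1 0).im = -(g 0 1).im := by linarith [h0.2, h1.2]
  have hn : ‖g 0 1‖ ^ 2 = (g 0 1).re ^ 2 + (g 0 1).im ^ 2 := by
    rw [Complex.sq_norm, Complex.normSq_apply]
    ring
  by_cases hz : ‖g 0 1‖ ^ 2 = 0
  · rw [hz]
    exact mul_nonneg h0.1 h1.1
  -- The form at `(-g₀₁, s)` is a real quadratic polynomial in `s`. Its discriminant carries an
  -- additional factor `‖g₀₁‖²`, whence the separate treatment of zero.
  have hq : ∀ s : ℝ, 0 ≤ (g 1 1).re * (s * s) + (-2 * ‖g 0 1‖ ^ 2) * s +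
      ‖g 0 1‖ ^ 2 * (g 0 0).re := by
    intro s
    have h := (Complex.nonneg_iff.mp (hg ![-(g 0 1), s])).1
    simp [Fin.sum_univ_two, ← h0.2, ← h1.2, hre, him] at h
    rw [hn]
    linarith
  have hd := discrim_le_zero hq
  rw [discrim] at hd
  have hpos : 0 < ‖g 0 1‖ ^ 2 := lt_of_le_of_ne (sq_nonneg _) (Ne.symm hz)
  nlinarith

theorem PosMatrix.sum_isPositive [Fintype κ] {T : κ → κ → A →L[ℂ] A} (hT : PosMatrix T)
    (c : κ → ℂ) : (∑ i, ∑ j, (starRingEnd ℂ (c i) * c j) • T i j).IsPositive := by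
  rw [isPositive_iff_inner_nonneg]
  intro x
  have h := hT fun i => c i • x
  refine h.trans_eq ?_
  simp only [sum_apply, inner_sum, smul_apply, map_smul, inner_smul_left, inner_smul_right]
  exact Finset.sum_congr rfl fun i _ => Finset.sum_congr rfl fun j _ => by ring

/-- A matrix of block operators is a block matrix over the product index set, tested on the slices
of the vectors. -/
theorem ofBlocks_posMatrix [Fintype ι] [Fintype κ] (f : OrthonormalBasis κ ℂ Hi)
    {N : ι → ι → κ → κ → Ho →L[ℂ] Ho}
    (hN : PosMatrix fun I J : ι × κ => N I.1 J.1 I.2 J.2) :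
    PosMatrix fun i j => ofBlocks f (N i j) := by
  intro x
  have h := hN fun I => sliceRight (f I.2) (x I.1)
  simp only [Fintype.sum_prod_type] at h
  simp only [inner_ofBlocks]
  convert h using 2 with i
  rw [Finset.sum_comm]

theorem trace_ofBlocks [Fintype κ] [FiniteDimensional ℂ Ho] [FiniteDimensional ℂ Hi]
    (f : OrthonormalBasis κ ℂ Hi) (N : κ → κ → Ho →L[ℂ] Ho) :
    trace (ofBlocks f N) = ∑ m, trace (N m m) := by
  rw [trace_eq_sum_blockRight f (mem_traceClass_of_finiteDimensional _)]
  simp only [blockRight_ofBlocks]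

theorem IsChannel.trace_sub_nonneg {E : (A →L[ℂ] A) → (B →L[ℂ] B)} (hE : IsChannel E)
    {T : A →L[ℂ] A} (hT : T ∈ traceClass A) (hp : T.IsPositive) :
    0 ≤ trace T - trace (E T) := by
  rw [← ofReal_re_trace hp, ← ofReal_re_trace (hE.map_isPositive hT hp), ← Complex.ofReal_sub]
  exact Complex.zero_le_real.mpr (sub_nonneg.mpr (hE.trace_le T hT hp))

/-- The operators `(Λ ∘ E ⊗ 1)[∑ᵢ |rᵢ⟩⟨sᵢ|]` given by their blocks. -/
def outputBlocks [Fintype κ] (f : OrthonormalBasis κ ℂ Hi) (Γ : B →ₗᵢ[ℂ] HTensor B Ho)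
    (E : (A →L[ℂ] A) → (B →L[ℂ] B)) (r s : κ → ι → A) : HTensor Ho Hi →L[ℂ] HTensor Ho Hi :=
  ofBlocks f fun m n => localExtraction Γ (E (op (r m) (s n)))

/-! ### Outputs of two families under the same channel -/

variable [Fintype κ] [FiniteDimensional ℂ Ho] [FiniteDimensional ℂ Hi]
  (f : OrthonormalBasis κ ℂ Hi) (Γ : B →ₗᵢ[ℂ] HTensor B Ho)
  {E : (A →L[ℂ] A) → (B →L[ℂ] B)}

theorem trace_outputBlocks (hE : IsChannel E) {r s : κ → ι → A} (hr : ∀ m, SqSum (r m))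
    (hs : ∀ m, SqSum (s m)) :
    trace (outputBlocks f Γ E r s) = ∑ m, trace (E (op (r m) (s m))) := by
  rw [outputBlocks, trace_ofBlocks]
  exact Finset.sum_congr rfl fun m _ => trace_localExtraction Γ
    (hE.map_traceClass _ (op_mem_traceClass (hr m) (hs m)))

theorem posMatrix_outputBlocks {η : Type*} [Fintype η] (hE : IsChannel E) {r : η → κ → ι → A}
    (hr : ∀ i m, SqSum (r i m)) :
    PosMatrix fun i j => outputBlocks f Γ E (r i) (r j) := by
  refine ofBlocks_posMatrix f ?_
  have hT : ∀ I J : η × κ, op (r I.1 I.2) (r J.1 J.2) ∈ traceClass A := fun I J =>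
    op_mem_traceClass (hr _ _) (hr _ _)
  exact localExtraction_posMatrix Γ (fun I J => hE.map_traceClass _ (hT I J))
    (hE.posMatrix hT (posMatrix_op (r := fun I : η × κ => r I.1 I.2) fun I => hr _ _))

theorem outputBlocks_isPositive (hE : IsChannel E) {r : κ → ι → A} (hr : ∀ m, SqSum (r m)) :
    (outputBlocks f Γ E r r).IsPositive := by
  have h := posMatrix_outputBlocks f Γ hE (r := fun _ : Unit => r) fun _ => hr
  rw [isPositive_iff_inner_nonneg]
  exact fun x => by simpa using h fun _ => x

/-- The lost traces `Tr T - Tr E(T)`, for `T` the entries `op (rᵢ) (rⱼ)`, form a positive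
semidefinite matrix: its quadratic form at `c` is the trace that `E` loses on the positive operators
`∑ c̄ᵢ cⱼ op (rᵢ m) (rⱼ m)`. The bound is the determinant inequality. -/
theorem norm_trace_sub_sq_le (hE : IsChannel E) {r : Fin 2 → κ → ι → A}
    (hr : ∀ i m, SqSum (r i m)) (hr1 : ∀ i, ∑ m, trace (op (r i m) (r i m)) = 1) {c : ℝ}
    (hc : ∑ m, trace (op (r 0 m) (r 1 m)) = c) {t : Fin 2 → ℝ}
    (ht : ∀ i, trace (outputBlocks f Γ E (r i) (r i)) = t i) :
    ‖(c : ℂ) - trace (outputBlocks f Γ E (r 0) (r 1))‖ ^ 2 ≤ (1 - t 0) * (1 - t 1) := by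
  let g : Fin 2 → Fin 2 → ℂ := fun i j =>
    ∑ m, (trace (op (r i m) (r j m)) - trace (E (op (r i m) (r j m))))
  have hg : ∀ i j, g i j = ∑ m, trace (op (r i m) (r j m)) -
      trace (outputBlocks f Γ E (r i) (r j)) := fun i j => by
    rw [trace_outputBlocks f Γ hE (hr i) (hr j), ← Finset.sum_sub_distrib]
  have h : ∀ c : Fin 2 → ℂ, 0 ≤ ∑ i, ∑ j, (starRingEnd ℂ (c i) * c j) * g i j := by
    intro c
    have h1 : ∑ i, ∑ j, (starRingEnd ℂ (c i) * c j) * g i j = ∑ m, ∑ i, ∑ j,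
        (starRingEnd ℂ (c i) * c j) *
          (trace (op (r i m) (r j m)) - trace (E (op (r i m) (r j m)))) := by
      simp only [g, Finset.mul_sum]
      rw [Finset.sum_comm' (t' := Finset.univ) (s' := fun _ => Finset.univ) (by simp)]
      rw [Finset.sum_comm]
      conv_rhs => rw [Finset.sum_comm]
      refine Finset.sum_congr rfl fun i _ => ?_
      rw [Finset.sum_comm]
    rw [h1]
    refine Finset.sum_nonneg fun m _ => ?_
    have hT : ∀ i j, op (r i m) (r j m) ∈ traceClass A := fun i j =>
      op_mem_traceClass (hr i m) (hr j m)
    have hTs : ∀ i j, (starRingEnd ℂ (c i) * c j) • op (r i m) (r j m) ∈ traceClass A :=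
      fun i j => Submodule.smul_mem _ _ (hT i j)
    have hTss : ∀ i, ∑ j, (starRingEnd ℂ (c i) * c j) • op (r i m) (r j m) ∈ traceClass A :=
      fun i => Submodule.sum_mem _ fun j _ => hTs i j
    have hp := hE.trace_sub_nonneg (Submodule.sum_mem _ fun i _ => hTss i)
      ((posMatrix_op (r := fun i => r i m) fun i => hr i m).sum_isPositive c)
    have e1 : trace (∑ i, ∑ j, (starRingEnd ℂ (c i) * c j) • op (r i m) (r j m)) =
        ∑ i, ∑ j, (starRingEnd ℂ (c i) * c j) * trace (op (r i m) (r j m)) := by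
      rw [trace_sum fun i _ => hTss i]
      refine Finset.sum_congr rfl fun i _ => ?_
      rw [trace_sum fun j _ => hTs i j]
      exact Finset.sum_congr rfl fun j _ => trace_smul _ _
    have e2 : trace (E (∑ i, ∑ j, (starRingEnd ℂ (c i) * c j) • op (r i m) (r j m))) =
        ∑ i, ∑ j, (starRingEnd ℂ (c i) * c j) * trace (E (op (r i m) (r j m))) := by
      rw [hE.linear.map_sum fun i _ => hTss i,
        trace_sum fun i _ => hE.map_traceClass _ (hTss i)]
      refine Finset.sum_congr rfl fun i _ => ?_
      rw [hE.linear.map_sum fun j _ => hTs i j, trace_sum fun j _ => hE.map_traceClass _ (hTs i j)]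
      refine Finset.sum_congr rfl fun j _ => ?_
      rw [hE.map_smul _ _ (hT i j), trace_smul]
    rw [e1, e2, ← Finset.sum_sub_distrib] at hp
    simp only [← Finset.sum_sub_distrib, ← mul_sub] at hp
    exact hp
  have h2 := norm_sq_le_of_posSemidef g h
  rw [hg, hg, hg, hr1, hr1, hc, ht, ht] at h2
  simpa using h2

/-- Fidelity of the normalized outputs of a channel. -/
theorem mul_one_sub_rootFidelity_outputBlocks_le (hE : IsChannel E) {r : Fin 2 → κ → ι → A}
    (hr : ∀ i m, SqSum (r i m)) (hr1 : ∀ i, ∑ m, trace (op (r i m) (r i m)) = 1) {c : ℝ}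
    (hc0 : 0 ≤ c) (hc : ∑ m, trace (op (r 0 m) (r 1 m)) = c) {t : Fin 2 → ℝ}
    (ht : ∀ i, trace (outputBlocks f Γ E (r i) (r i)) = t i) (ht1 : ∀ i, t i ≤ 1)
    (h0 : 0 < t 0) (h1 : 0 < t 1) :
    t 0 * (1 - rootFidelity (((t 0 : ℝ) : ℂ)⁻¹ • outputBlocks f Γ E (r 0) (r 0))
      (((t 1 : ℝ) : ℂ)⁻¹ • outputBlocks f Γ E (r 1) (r 1)) ^ 2) ≤ 1 - c ^ 2 :=
  mul_one_sub_sq_le h0.le h1.le (ht1 0) (ht1 1) hc0 (norm_trace_sub_sq_le f Γ hE hr hr1 hc ht)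
    ((posMatrix_outputBlocks f Γ hE hr).norm_trace_le_rootFidelity h0 h1)

/-- The case in which one of the two outputs vanishes. -/
theorem trace_le_of_trace_eq_zero (hE : IsChannel E) {r : Fin 2 → κ → ι → A}
    (hr : ∀ i m, SqSum (r i m)) (hr1 : ∀ i, ∑ m, trace (op (r i m) (r i m)) = 1) {c : ℝ}
    (hc : ∑ m, trace (op (r 0 m) (r 1 m)) = c) {t : Fin 2 → ℝ}
    (ht : ∀ i, trace (outputBlocks f Γ E (r i) (r i)) = t i)
    (h1 : t 1 = 0) : t 0 ≤ 1 - c ^ 2 := by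
  have h := norm_trace_sub_sq_le f Γ hE hr hr1 hc ht
  have hp := posMatrix_outputBlocks f Γ hE hr
  -- The output traces also form a positive semidefinite matrix, so a zero diagonal entry forces the
  -- off-diagonal one to vanish.
  have h2 := norm_sq_le_of_posSemidef (fun i j => trace (outputBlocks f Γ E (r i) (r j)))
    fun c => by
      have h3 := trace_nonneg_of_isPositive (hp.sum_isPositive c)
      have hm : ∀ T : HTensor Ho Hi →L[ℂ] HTensor Ho Hi, T ∈ traceClass (HTensor Ho Hi) :=
        fun T => mem_traceClass_of_finiteDimensional T
      simpa only [trace_sum fun _ _ => hm _, trace_smul] using h3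
  rw [ht 1, h1, Complex.ofReal_zero, Complex.zero_re, mul_zero] at h2
  have h3 : trace (outputBlocks f Γ E (r 0) (r 1)) = 0 :=
    norm_eq_zero.mp (pow_eq_zero_iff two_ne_zero |>.mp (le_antisymm h2 (sq_nonneg _)))
  rw [h3, h1, sub_zero, sub_zero, mul_one, Complex.norm_real, Real.norm_eq_abs, sq_abs] at h
  linarith

theorem trace_outputBlocks_le_one (hE : IsChannel E) {r : κ → ι → A} (hr : ∀ m, SqSum (r m))
    (hr1 : ∑ m, trace (op (r m) (r m)) = 1) : (trace (outputBlocks f Γ E r r)).re ≤ 1 := by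
  rw [trace_outputBlocks f Γ hE hr hr, ← Complex.one_re, ← hr1, Complex.re_sum, Complex.re_sum]
  exact Finset.sum_le_sum fun m _ => hE.trace_le _ (op_mem_traceClass (hr m) (hr m))
    (op_self_isPositive (hr m))

end Core

/-! ### The extracted channel -/

section Extracted

variable {A : Type u} {B : Type v} {Ho Hi Ei : Type*}
  [NormedAddCommGroup A] [InnerProductSpace ℂ A] [CompleteSpace A]
  [NormedAddCommGroup B] [InnerProductSpace ℂ B] [CompleteSpace B]
  [NormedAddCommGroup Ho] [InnerProductSpace ℂ Ho] [CompleteSpace Ho]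
  [NormedAddCommGroup Hi] [InnerProductSpace ℂ Hi] [CompleteSpace Hi] [FiniteDimensional ℂ Hi]
  [NormedAddCommGroup Ei] [InnerProductSpace ℂ Ei] [CompleteSpace Ei] [FiniteDimensional ℂ Ei]
  {ι κ : Type*}

instance finite_basisIndex : Finite (basisIndex Ei) :=
  (basis Ei).orthonormal.linearIndependent.finite

theorem conj_linear (Γ : A →ₗᵢ[ℂ] B) (S T : A →L[ℂ] A) (c : ℂ) :
    conj Γ (S + T) = conj Γ S + conj Γ T ∧ conj Γ (c • T) = c • conj Γ T := by
  constructor <;> ext x <;> simp [conj]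

theorem conj_mem_traceClass (Γ : A →ₗᵢ[ℂ] B) {T : A →L[ℂ] A} (hT : T ∈ traceClass A) :
    conj Γ T ∈ traceClass B :=
  comp_comp_adjoint_mem_traceClass hT _ _

theorem tensorOp_mem_traceClass {S : A →L[ℂ] A} (hS : S ∈ traceClass A) (T : Hi →L[ℂ] Hi) :
    tensorOp S T ∈ traceClass (HTensor A Hi) :=
  Submodule.sum_mem _ fun _ _ => comp_comp_adjoint_mem_traceClass hS _ _

theorem tensorOp_add (S : A →L[ℂ] A) (T T' : Hi →L[ℂ] Hi) :
    tensorOp S (T + T') = tensorOp S T + tensorOp S T' :=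
  ext_tmul fun a a' b b' => by
    simp only [tensorOp_tmul, add_apply, tmul_add]

theorem tensorOp_smul (S : A →L[ℂ] A) (c : ℂ) (T : Hi →L[ℂ] Hi) :
    tensorOp S (c • T) = c • tensorOp S T :=
  ext_tmul fun a a' b b' => by
    simp only [tensorOp_tmul, smul_apply, tmul_smul]

theorem tensorOp_op_rankOne {x y : ι → A} (hx : SqSum x) (hy : SqSum y) (a b : Hi) :
    tensorOp (op x y) (InnerProductSpace.rankOne ℂ a b) =
      op (fun i => tmul (x i) a) fun i => tmul (y i) b := by
  refine ext_tmul fun p p' q q' => ?_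
  rw [tensorOp_tmul, inner_tmul_tmul]
  refine HasSum.unique ?_ (hasSum_inner_op (hx.map (tmulRight a)) (hy.map (tmulRight b)) _ _)
  refine ((hasSum_inner_op hx hy p p').mul_right _).congr_fun fun i => ?_
  simp only [tmulRight_apply, inner_tmul_tmul, InnerProductSpace.rankOne_apply, inner_smul_right]
  ring

theorem ptraceRight_eq_sum [Fintype (basisIndex Ei)] (X : HTensor A Ei →L[ℂ] HTensor A Ei) :
    ptraceRight X = ∑ p, blockRight (basis Ei p) (basis Ei p) X :=
  tsum_fintype _

theorem ptraceRight_add (X Y : HTensor A Ei →L[ℂ] HTensor A Ei) :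
    ptraceRight (X + Y) = ptraceRight X + ptraceRight Y := by
  have := Fintype.ofFinite (basisIndex Ei)
  simp only [ptraceRight_eq_sum, ← Finset.sum_add_distrib]
  refine Finset.sum_congr rfl fun p _ => ?_
  ext a
  simp [blockRight]

theorem ptraceRight_smul (c : ℂ) (X : HTensor A Ei →L[ℂ] HTensor A Ei) :
    ptraceRight (c • X) = c • ptraceRight X := by
  have := Fintype.ofFinite (basisIndex Ei)
  simp only [ptraceRight_eq_sum, Finset.smul_sum, blockRight_smul]

theorem ptraceRight_mem_traceClass {X : HTensor A Ei →L[ℂ] HTensor A Ei}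
    (hX : X ∈ traceClass _) : ptraceRight X ∈ traceClass A := by
  have := Fintype.ofFinite (basisIndex Ei)
  rw [ptraceRight_eq_sum]
  exact Submodule.sum_mem _ fun p _ => blockRight_mem_traceClass hX _ _

theorem SqSum.slices {x : ι → HTensor A Ei} (hx : SqSum x) :
    SqSum fun q : ι × basisIndex Ei => sliceRight (basis Ei q.2) (x q.1) := by
  rw [SqSum, summable_prod_of_nonneg fun _ => sq_nonneg _]
  exact ⟨fun i => (hasSum_norm_sq_sliceRight (basis Ei) (x i)).summable, Summable.congr hx
    fun i => (hasSum_norm_sq_sliceRight (basis Ei) (x i)).tsum_eq.symm⟩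

theorem ptraceRight_op {x y : ι → HTensor A Ei} (hx : SqSum x) (hy : SqSum y) :
    ptraceRight (op x y) = op (fun q : ι × basisIndex Ei => sliceRight (basis Ei q.2) (x q.1))
      fun q => sliceRight (basis Ei q.2) (y q.1) := by
  have := Fintype.ofFinite (basisIndex Ei)
  rw [ptraceRight_eq_sum]
  refine ((hasSum_fintype _).congr_fun fun p => ?_).unique
    (op_prod_fiberwise_swap hx.slices hy.slices)
  rw [blockRight_op hx hy]

variable (Γi : HTensor A Hi →ₗᵢ[ℂ] HTensor A Ei) (Γo : B →ₗᵢ[ℂ] HTensor B Ho)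
  {E : (A →L[ℂ] A) → (B →L[ℂ] B)}

/-- The trace over the finite-dimensional extension is a finite sum of blocks and can be moved
inside `E` by linearity. What remains is a local extraction after `E`, the same form as for the true
output. -/
theorem extractedChannel_eq (hE : IsChannel E) {ρA : A →L[ℂ] A} (hρ : ρA ∈ traceClass A)
    (ρ : Hi →L[ℂ] Hi) : extractedChannel Γi Γo ρA E ρ =
      localExtraction Γo (E (ptraceRight (conj Γi (tensorOp ρA ρ)))) := by
  have := Fintype.ofFinite (basisIndex Ei)
  have hX := conj_mem_traceClass Γi (tensorOp_mem_traceClass hρ ρ)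
  have hb := fun s s' => blockRight_mem_traceClass hX s s'
  have hlin : LinearOnTraceClass fun X => conj Γo (E X) :=
    ⟨fun S hS T hT => by rw [hE.map_add S hS T hT, (conj_linear Γo _ _ 0).1],
      fun c T hT => by rw [hE.map_smul c T hT, (conj_linear Γo 0 _ c).2]⟩
  rw [extractedChannel, localExtraction, ptraceRight_eq_sum, ptraceRight_eq_sum]
  simp only [blockRight_ampLeft hlin hb]
  rw [← hlin.map_sum fun p _ => hb _ _]

theorem extractedChannel_linear (hE : IsChannel E) {ρA : A →L[ℂ] A} (hρ : ρA ∈ traceClass A) :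
    LinearOnTraceClass (extractedChannel Γi Γo ρA E) := by
  have hm : ∀ ρ : Hi →L[ℂ] Hi, ptraceRight (conj Γi (tensorOp ρA ρ)) ∈ traceClass A := fun ρ =>
    ptraceRight_mem_traceClass (conj_mem_traceClass Γi (tensorOp_mem_traceClass hρ ρ))
  refine ⟨fun S _ T _ => ?_, fun c T _ => ?_⟩
  · rw [extractedChannel_eq Γi Γo hE hρ, extractedChannel_eq Γi Γo hE hρ,
      extractedChannel_eq Γi Γo hE hρ, tensorOp_add, (conj_linear Γi _ _ 0).1, ptraceRight_add,
      hE.map_add _ (hm S) _ (hm T), (localExtraction_linear Γo).map_add _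
        (hE.map_traceClass _ (hm S)) _ (hE.map_traceClass _ (hm T))]
  · rw [extractedChannel_eq Γi Γo hE hρ, extractedChannel_eq Γi Γo hE hρ,
      tensorOp_smul, (conj_linear Γi 0 _ c).2, ptraceRight_smul,
      hE.map_smul _ _ (hm T), (localExtraction_linear Γo).map_smul _ _ (hE.map_traceClass _ (hm T))]

/-- The vectors `(1 ⊗ ⟨g| ) Γi (rᵢ ⊗ a)`, for `g` in the basis of the extension space. -/
def encodedFamily (r : ι → A) (a : Hi) (q : ι × basisIndex Ei) : A :=
  sliceRight (basis Ei q.2) (Γi (tmul (r q.1) a))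

theorem SqSum.encodedFamily {r : ι → A} (hr : SqSum r) (a : Hi) :
    SqSum (encodedFamily Γi r a) :=
  ((hr.map (tmulRight a)).map Γi.toContinuousLinearMap).slices

theorem extractedChannel_op_rankOne (hE : IsChannel E) {r : ι → A} (hr : SqSum r) (a b : Hi) :
    extractedChannel Γi Γo (op r r) E (InnerProductSpace.rankOne ℂ a b) =
      localExtraction Γo (E (op (encodedFamily Γi r a) (encodedFamily Γi r b))) := by
  have h := conj_op Γi (x := fun i => tmul (r i) a) (y := fun i => tmul (r i) b)
    (hr.map (tmulRight a)) (hr.map (tmulRight b))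
  rw [extractedChannel_eq Γi Γo hE (op_mem_traceClass hr hr), tensorOp_op_rankOne hr hr, h]
  congr 2
  exact ptraceRight_op ((hr.map (tmulRight a)).map Γi.toContinuousLinearMap)
    ((hr.map (tmulRight b)).map Γi.toContinuousLinearMap)

theorem pureState_eq_op {H : Type*} [NormedAddCommGroup H] [InnerProductSpace ℂ H]
    [CompleteSpace H] (φ : H) : pureState φ = op (fun _ : Unit => φ) fun _ => φ :=
  (op_unique φ φ).symm

theorem blockRight_pureState (φ : HTensor A Hi) (s s' : Hi) : blockRight s s' (pureState φ) =
    InnerProductSpace.rankOne ℂ (sliceRight s φ) (sliceRight s' φ) := by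
  rw [pureState_eq_op, blockRight_op (SqSum.of_fintype _) (SqSum.of_fintype _), op_unique]

theorem pureState_mem_traceClass {H : Type*} [NormedAddCommGroup H] [InnerProductSpace ℂ H]
    [CompleteSpace H] (φ : H) : pureState φ ∈ traceClass H := rankOne_mem_traceClass φ φ

theorem trace_pureState {H : Type*} [NormedAddCommGroup H] [InnerProductSpace ℂ H]
    [CompleteSpace H] {φ : H} (hφ : ‖φ‖ = 1) : trace (pureState φ) = 1 := by
  rw [pureState, trace_rankOne, inner_self_eq_ofReal, hφ]
  simp

/-- The output of the extracted channel on `φ` is the output of `E` on the encoded slices of `φ`, so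
it can be compared with the true output through `outputBlocks`. -/
theorem ampLeft_extractedChannel [Fintype κ] (f : OrthonormalBasis κ ℂ Hi) (hE : IsChannel E)
    {r : ι → A} (hr : SqSum r) (φ : HTensor Hi Hi) :
    ampLeft (extractedChannel Γi Γo (op r r) E) (pureState φ) =
      outputBlocks f Γo E (fun m => encodedFamily Γi r (sliceRight (f m) φ))
        fun m => encodedFamily Γi r (sliceRight (f m) φ) := by
  rw [ampLeft_eq_ofBlocks f (extractedChannel_linear Γi Γo hE (op_mem_traceClass hr hr))
    fun s s' => blockRight_mem_traceClass (pureState_mem_traceClass φ) s s']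
  simp only [blockRight_pureState, extractedChannel_op_rankOne Γi Γo hE hr]
  rfl

theorem trace_encodedFamily {r : ι → A} (hr : SqSum r) (a : Hi) :
    trace (op (encodedFamily Γi r a) (encodedFamily Γi r a)) =
      ((∑' i, ‖r i‖ ^ 2) * ‖a‖ ^ 2 : ℝ) := by
  have h := (hasSum_trace_op (hr.encodedFamily Γi a) (hr.encodedFamily Γi a)).prod_fiberwise
    fun i => hasSum_inner_sliceRight (basis Ei) (Γi (tmul (r i) a)) (Γi (tmul (r i) a))
  simp only [inner_self_eq_ofReal, Γi.norm_map, norm_tmul, mul_pow] at h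
  refine h.unique ?_
  have h2 : HasSum (fun i => ‖r i‖ ^ 2) (∑' i, ‖r i‖ ^ 2) := Summable.hasSum hr
  exact_mod_cast h2.mul_right (‖a‖ ^ (2 : ℕ))

end Extracted

/-! ### Extraction on the ancilla -/

section Ancilla

variable {H : Type u} {K : Type v} {L : Type w} {Hi : Type*}
  [NormedAddCommGroup H] [InnerProductSpace ℂ H] [CompleteSpace H]
  [NormedAddCommGroup K] [InnerProductSpace ℂ K] [CompleteSpace K]
  [NormedAddCommGroup L] [InnerProductSpace ℂ L] [CompleteSpace L]
  [NormedAddCommGroup Hi] [InnerProductSpace ℂ Hi] [CompleteSpace Hi] [FiniteDimensional ℂ Hi]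
  {ι κ : Type*} (Γ : K →ₗᵢ[ℂ] HTensor K Hi)

/-- The adjoints `Γ† (b ⊗ s)` of the Kraus operators of the extraction map. -/
def krausAdjoint (k : basisIndex K) (s : Hi) : K :=
  ContinuousLinearMap.adjoint Γ.toContinuousLinearMap (tmul (basis K k) s)

/-- The Kraus operators `1 ⊗ (⟨b| ⊗ 1) Γ` of the extraction map applied to a family of vectors. -/
def ancillaFamily (x : ι → HTensor H K) (q : ι × basisIndex K) : HTensor H Hi :=
  ∑ m, tmul (sliceRight (krausAdjoint Γ q.2 (stdOrthonormalBasis ℂ Hi m)) (x q.1))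
    (stdOrthonormalBasis ℂ Hi m)

theorem inner_krausAdjoint (k : basisIndex K) (s : Hi) (b : K) :
    (inner ℂ (krausAdjoint Γ k s) b : ℂ) = inner ℂ s (sliceLeft (basis K k) (Γ b)) := by
  rw [krausAdjoint, ContinuousLinearMap.adjoint_inner_left, inner_sliceLeft]
  rfl

/-- This identifies the finite sum in the definition with `1 ⊗ (⟨b| ⊗ 1) Γ` applied to `x`, without
a tensor product of operators between infinite-dimensional spaces. -/
theorem sliceLeft_ancillaFamily (x : ι → HTensor H K) (q : ι × basisIndex K) (a : H) :
    sliceLeft a (ancillaFamily Γ x q) = sliceLeft (basis K q.2) (Γ (sliceLeft a (x q.1))) := by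
  rw [ancillaFamily, map_sum,
    ← (stdOrthonormalBasis ℂ Hi).sum_repr' (sliceLeft (basis K q.2) (Γ (sliceLeft a (x q.1))))]
  refine Finset.sum_congr rfl fun m _ => ?_
  rw [sliceLeft_tmul, ← inner_krausAdjoint, inner_sliceRight, inner_sliceLeft]

theorem sliceRight_ancillaFamily (x : ι → HTensor H K) (q : ι × basisIndex K) (s : Hi) :
    sliceRight s (ancillaFamily Γ x q) = sliceRight (krausAdjoint Γ q.2 s) (x q.1) :=
  ext_inner_left ℂ fun a => by
    rw [inner_sliceRight, ← inner_sliceLeft, sliceLeft_ancillaFamily, ← inner_krausAdjoint,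
      inner_sliceLeft, inner_sliceRight]

/-- On each slice along a basis of `H` this is Parseval and the isometry of `Γ`; the order of the
two nonnegative sums is then exchanged. -/
theorem hasSum_norm_sq_ancillaFamily (x : ι → HTensor H K) (i : ι) :
    HasSum (fun k => ‖ancillaFamily Γ x (i, k)‖ ^ 2) (‖x i‖ ^ 2) := by
  have h1 : ∀ j, HasSum (fun k => ‖sliceLeft (basis H j) (ancillaFamily Γ x (i, k))‖ ^ 2)
      (‖sliceLeft (basis H j) (x i)‖ ^ 2) := by
    intro j
    simp only [sliceLeft_ancillaFamily]
    rw [← Γ.norm_map (sliceLeft (basis H j) (x i))]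
    exact hasSum_norm_sq_sliceLeft (basis K) _
  have h2 := hasSum_norm_sq_sliceLeft (basis H) (x i)
  have hs : Summable fun p : basisIndex H × basisIndex K =>
      ‖sliceLeft (basis H p.1) (ancillaFamily Γ x (i, p.2))‖ ^ 2 := by
    rw [summable_prod_of_nonneg fun _ => sq_nonneg _]
    exact ⟨fun j => (h1 j).summable, h2.summable.congr fun j => (h1 j).tsum_eq.symm⟩
  have h3 : HasSum (fun p : basisIndex H × basisIndex K =>
      ‖sliceLeft (basis H p.1) (ancillaFamily Γ x (i, p.2))‖ ^ 2) (‖x i‖ ^ 2) := by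
    have h4 := hs.hasSum
    rwa [h2.unique (h4.prod_fiberwise h1)]
  have h5 := (Equiv.prodComm (basisIndex K) (basisIndex H)).hasSum_iff.mpr h3
  exact h5.prod_fiberwise fun k => hasSum_norm_sq_sliceLeft (basis H) (ancillaFamily Γ x (i, k))

theorem SqSum.ancillaFamily {x : ι → HTensor H K} (hx : SqSum x) : SqSum (ancillaFamily Γ x) := by
  rw [SqSum, summable_prod_of_nonneg fun _ => sq_nonneg _]
  exact ⟨fun i => (hasSum_norm_sq_ancillaFamily Γ x i).summable, Summable.congr hx
    fun i => (hasSum_norm_sq_ancillaFamily Γ x i).tsum_eq.symm⟩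

theorem trace_ancillaFamily {x : ι → HTensor H K} (hx : SqSum x) :
    trace (op (ancillaFamily Γ x) (ancillaFamily Γ x)) = trace (op x x) := by
  rw [trace_op_self hx, trace_op_self (hx.ancillaFamily Γ)]
  congr 1
  have h : HasSum (fun q => ‖ChannelCert.ancillaFamily Γ x q‖ ^ 2) _ :=
    Summable.hasSum (hx.ancillaFamily Γ)
  exact (h.prod_fiberwise (hasSum_norm_sq_ancillaFamily Γ x)).tsum_eq.symm

theorem ampRight_localExtraction_op {x : ι → HTensor H K} (hx : SqSum x) :
    ampRight (localExtraction Γ) (op x x) = op (ancillaFamily Γ x) (ancillaFamily Γ x) := by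
  refine ampRight_eq fun s s' => ?_
  rw [blockLeft_op (hx.ancillaFamily Γ) (hx.ancillaFamily Γ), blockLeft_op hx hx,
    localExtraction_op Γ (hx.map _) (hx.map _)]
  simp only [sliceLeft_ancillaFamily]
  rfl

theorem ampRight_localExtraction_smul {X : HTensor H K →L[ℂ] HTensor H K}
    {x : ι → HTensor H K} (hx : SqSum x) (hX : X = op x x) (c : ℂ) :
    ampRight (localExtraction Γ) (c • X) = c • op (ancillaFamily Γ x) (ancillaFamily Γ x) := by
  subst hX
  refine ampRight_eq fun s s' => ?_
  rw [blockLeft_smul, blockLeft_smul, (localExtraction_linear Γ).map_smul _ _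
    (blockLeft_mem_traceClass (op_mem_traceClass hx hx) _ _),
    blockLeft_op (hx.ancillaFamily Γ) (hx.ancillaFamily Γ), blockLeft_op hx hx,
    localExtraction_op Γ (hx.map _) (hx.map _)]
  simp only [sliceLeft_ancillaFamily]
  rfl

/-- A channel on the first factor commutes with the extraction on the second factor. -/
theorem IsChannel.map_blockRight_ancillaFamily {E : (H →L[ℂ] H) → (L →L[ℂ] L)} (hE : IsChannel E)
    {x : ι → HTensor H K} (hx : SqSum x) {y : κ → HTensor L K} (hy : SqSum y)
    (h : ∀ s s' : K, blockRight s s' (op y y) = E (blockRight s s' (op x x))) (s s' : Hi) :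
    E (blockRight s s' (op (ancillaFamily Γ x) (ancillaFamily Γ x))) =
      blockRight s s' (op (ancillaFamily Γ y) (ancillaFamily Γ y)) := by
  have hX := hx.ancillaFamily Γ
  have hY := hy.ancillaFamily Γ
  rw [blockRight_op hX hX, blockRight_op hY hY]
  have h1 := hE.hasSum_op (hX.map (sliceRight s)) (hX.map (sliceRight s'))
  have h2 := (Equiv.prodComm (basisIndex K) ι).hasSum_iff.mpr h1
  -- The sum is grouped by the Kraus index `k`: the part with fixed `k` is a block of the original
  -- operator along the vectors `Γ† (b ⊗ s)`, to which the hypothesis on blocks applies.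
  have h3 := h2.prod_fiberwise (g := fun k =>
      E (blockRight (krausAdjoint Γ k s) (krausAdjoint Γ k s') (op x x))) fun k => by
    rw [blockRight_op hx hx]
    have := hE.hasSum_op (hx.map (sliceRight (krausAdjoint Γ k s)))
      (hx.map (sliceRight (krausAdjoint Γ k s')))
    refine this.congr_fun fun i => ?_
    simp only [Function.comp_apply, Equiv.prodComm_apply, Prod.swap_prod_mk,
      sliceRight_ancillaFamily]
  refine h3.unique
    ((op_prod_fiberwise_swap (hY.map (sliceRight s)) (hY.map (sliceRight s'))).congr_fun
      fun k => ?_)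
  rw [← h, blockRight_op hy hy]
  simp only [sliceRight_ancillaFamily]

/-- If `(E ⊗ 1)[X]` has nonzero trace, then it is a positive trace class operator. -/
theorem exists_op_of_transmissivity_ne_zero {E : (H →L[ℂ] H) → (L →L[ℂ] L)} (hE : IsChannel E)
    {x : ι → HTensor H K} (hx : SqSum x) (ht : transmissivity E (op x x) ≠ 0) :
    ∃ y : basisIndex (HTensor L K) → HTensor L K, SqSum y ∧ ampLeft E (op x x) = op y y ∧
      ∀ s s' : K, blockRight s s' (op y y) = E (blockRight s s' (op x x)) := by
  -- If no operator had the prescribed blocks, `ampLeft` would take its default value `0`, of trace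
  -- zero.
  have hex : ∃ Y : HTensor L K →L[ℂ] HTensor L K,
      ∀ s s' : K, blockRight s s' Y = E (blockRight s s' (op x x)) := by
    by_contra h
    refine ht ?_
    rw [transmissivity, ampLeft, dif_neg h]
    simp [trace]
  obtain ⟨Y, hY⟩ := hex
  have hamp := ampLeft_eq hY
  have hp : Y.IsPositive := by
    rw [isPositive_iff_inner_nonneg]
    intro ξ
    -- Positivity is a closed condition, and on a finite sum of elementary tensors it is the
    -- complete positivity of `E`.
    induction ξ using UniformSpace.Completion.induction_on with
    | hp => exact isClosed_Ici.preimage (f := fun ξ => (inner ℂ ξ (Y ξ) : ℂ)) (by fun_prop)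
    | ih ξ =>
      obtain ⟨s, rfl⟩ := TensorProduct.exists_finset ξ
      have e : ((∑ i ∈ s, i.1 ⊗ₜ[ℂ] i.2 : L ⊗[ℂ] K) : HTensor L K) =
          ∑ i : s, tmul (i : L × K).1 (i : L × K).2 := by
        rw [← Finset.sum_coe_sort s]
        exact map_sum (UniformSpace.Completion.toComplL (𝕜 := ℂ) (E := L ⊗[ℂ] K)) _ _
      rw [e]
      have h1 := hE.posMatrix
        (T := fun i j : s => blockRight (i : L × K).2 (j : L × K).2 (op x x))
        (fun i j => blockRight_mem_traceClass (op_mem_traceClass hx hx) _ _)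
        (by
          simp only [blockRight_op hx hx]
          exact posMatrix_op (r := fun (i : s) k => sliceRight (i : L × K).2 (x k))
            fun i => hx.map _)
      have h2 := h1 fun i => (i : L × K).1
      simp only [map_sum, sum_inner, inner_sum]
      simp only [← hY, inner_blockRight] at h2
      rwa [Finset.sum_comm]
  -- A divergent trace series would have the default sum `0`, against the nonzero transmissivity.
  have hs : Summable fun i => (inner ℂ (basis _ i) (Y (basis _ i)) : ℂ) := by
    by_contra h
    refine ht ?_
    rw [transmissivity, hamp, trace, tsum_eq_zero_of_not_summable h, Complex.zero_re]
  obtain ⟨y, hy, rfl⟩ := exists_op_self hp hs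
  exact ⟨y, hy, hamp, hY⟩

end Ancilla

/-! ### The diamond fidelity and the Choi fidelity -/

section Diamond

open ContinuousLinearMap (adjoint)

variable {Hi : Type u} {Ho : Type v}
  [NormedAddCommGroup Hi] [InnerProductSpace ℂ Hi] [CompleteSpace Hi] [FiniteDimensional ℂ Hi]
  [NormedAddCommGroup Ho] [InnerProductSpace ℂ Ho] [CompleteSpace Ho] [FiniteDimensional ℂ Ho]
  {κ : Type*}

theorem adjoint_tensorOp_one_tmul (K : Hi →L[ℂ] Hi) (a : Ho) (b : Hi) :
    adjoint (tensorOp (1 : Ho →L[ℂ] Ho) K) (tmul a b) = tmul a (adjoint K b) := by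
  have h : adjoint (tensorOp (1 : Ho →L[ℂ] Ho) K) = tensorOp 1 (adjoint K) :=
    ext_tmul fun a a' b b' => by
      rw [ContinuousLinearMap.adjoint_inner_right, tensorOp_tmul, tensorOp_tmul, inner_tmul_tmul,
        inner_tmul_tmul, ContinuousLinearMap.adjoint_inner_right]
      rfl
  rw [h, tensorOp_tmul]
  rfl

/-- Slicing along the first factor commutes with `1 ⊗ K`, so each slice contracts, and Parseval sums
them. -/
theorem norm_tensorOp_one_le (K : Hi →L[ℂ] Hi) (hK : ‖K‖ ≤ 1) :
    ‖tensorOp (1 : Ho →L[ℂ] Ho) K‖ ≤ 1 := by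
  refine ContinuousLinearMap.opNorm_le_bound _ zero_le_one fun ξ => ?_
  have h : ∀ a : Ho, sliceLeft a (tensorOp (1 : Ho →L[ℂ] Ho) K ξ) = K (sliceLeft a ξ) := fun a =>
    ext_inner_left ℂ fun b => by
      rw [inner_sliceLeft, ← ContinuousLinearMap.adjoint_inner_left, adjoint_tensorOp_one_tmul,
        ← inner_sliceLeft, ContinuousLinearMap.adjoint_inner_left]
  rw [one_mul]
  refine (pow_le_pow_iff_left₀ (norm_nonneg _) (norm_nonneg _) two_ne_zero).mp ?_
  rw [← sum_norm_sq_sliceLeft (stdOrthonormalBasis ℂ Ho),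
    ← sum_norm_sq_sliceLeft (stdOrthonormalBasis ℂ Ho) ξ]
  refine Finset.sum_le_sum fun i _ => pow_le_pow_left₀ (norm_nonneg _) ?_ 2
  rw [h]
  exact (K.le_opNorm _).trans (mul_le_of_le_one_left (norm_nonneg _) hK)

theorem blockRight_conj_tensorOp_one (K : Hi →L[ℂ] Hi) (σ : HTensor Ho Hi →L[ℂ] HTensor Ho Hi)
    (s s' : Hi) : blockRight s s' (tensorOp (1 : Ho →L[ℂ] Ho) K * σ *
      adjoint (tensorOp (1 : Ho →L[ℂ] Ho) K)) = blockRight (adjoint K s) (adjoint K s') σ := by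
  refine ContinuousLinearMap.ext fun a => ext_inner_left ℂ fun x => ?_
  rw [inner_blockRight, inner_blockRight, ← adjoint_tensorOp_one_tmul, ← adjoint_tensorOp_one_tmul,
    ContinuousLinearMap.adjoint_inner_left]
  rfl

theorem sliceRight_maximallyEntangled {e f : OrthonormalBasis (Fin (Module.finrank ℂ Hi)) ℂ Hi}
    {φ : HTensor Hi Hi}
    (hφ : φ = ((Real.sqrt (Module.finrank ℂ Hi) : ℂ)⁻¹) • ∑ k, tmul (e k) (f k)) (s : Hi) :
    sliceRight s φ =
      ((Real.sqrt (Module.finrank ℂ Hi) : ℂ)⁻¹) • ∑ k, (inner ℂ s (f k) : ℂ) • e k := by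
  rw [hφ, map_smul, map_sum]
  simp only [sliceRight_tmul]

theorem norm_maximallyEntangled (hd : 0 < Module.finrank ℂ Hi) {φ : HTensor Hi Hi}
    (hφ : IsMaximallyEntangled φ) : ‖φ‖ = 1 := by
  obtain ⟨e, f, rfl⟩ := hφ
  have h : ‖∑ k, tmul (e k) (f k)‖ ^ 2 = Module.finrank ℂ Hi := by
    rw [← sum_norm_sq_sliceRight f]
    have : ∀ m, sliceRight (f m) (∑ k, tmul (e k) (f k)) = e m := fun m => by
      simp only [map_sum, sliceRight_tmul, orthonormal_iff_ite.mp f.orthonormal, ite_smul, one_smul,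
        zero_smul, Finset.sum_ite_eq, Finset.mem_univ, if_true]
    simp [this]
  have hd' : (0 : ℝ) < Module.finrank ℂ Hi := by exact_mod_cast hd
  rw [norm_smul, norm_inv, Complex.norm_real, Real.norm_of_nonneg (Real.sqrt_nonneg _), ← h,
    Real.sqrt_sq (norm_nonneg _), inv_mul_cancel₀]
  intro h0
  rw [h0] at h
  linarith [zero_pow (M₀ := ℝ) two_ne_zero]

/-- Every unit vector is `√d (1 ⊗ K) φ` for a contraction `K`, if `φ` is maximally entangled. -/
theorem exists_contraction_of_maximallyEntangled (hd : 0 < Module.finrank ℂ Hi)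
    {φ : HTensor Hi Hi} (hφ : IsMaximallyEntangled φ) {χ : HTensor Hi Hi} (hχ : ‖χ‖ = 1) :
    ∃ K : Hi →L[ℂ] Hi, ‖K‖ ≤ 1 ∧ ∀ s, sliceRight s χ =
      (Real.sqrt (Module.finrank ℂ Hi) : ℂ) • sliceRight (adjoint K s) φ := by
  obtain ⟨e, f, hef⟩ := hφ
  -- `K` sends `fₖ` to the slice of `χ` along `eₖ`. Its Hilbert-Schmidt norm is `‖χ‖ = 1`, which
  -- bounds the operator norm.
  let K : Hi →L[ℂ] Hi := ∑ k, InnerProductSpace.rankOne ℂ (sliceLeft (e k) χ) (f k)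
  have hKx : ∀ x, K x = ∑ k, (inner ℂ (f k) x : ℂ) • sliceLeft (e k) χ := fun x => by
    simp only [K, sum_apply, InnerProductSpace.rankOne_apply]
  have hKf : ∀ k, K (f k) = sliceLeft (e k) χ := fun k => by
    rw [hKx]
    simp [orthonormal_iff_ite.mp f.orthonormal]
  refine ⟨K, ContinuousLinearMap.opNorm_le_bound _ zero_le_one fun x => ?_, fun s => ?_⟩
  · rw [one_mul, hKx]
    have h1 : ‖∑ k, (inner ℂ (f k) x : ℂ) • sliceLeft (e k) χ‖ ≤
        ∑ k, ‖(inner ℂ (f k) x : ℂ)‖ * ‖sliceLeft (e k) χ‖ :=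
      (norm_sum_le _ _).trans_eq (Finset.sum_congr rfl fun k _ => norm_smul _ _)
    have h2 := Finset.sum_mul_sq_le_sq_mul_sq Finset.univ
      (fun k => ‖(inner ℂ (f k) x : ℂ)‖) fun k => ‖sliceLeft (e k) χ‖
    rw [sum_norm_sq_sliceLeft e χ, f.sum_sq_norm_inner_right, hχ, one_pow, mul_one] at h2
    exact h1.trans ((pow_le_pow_iff_left₀ (by positivity) (norm_nonneg _) two_ne_zero).mp h2)
  · have hd' : (Real.sqrt (Module.finrank ℂ Hi) : ℂ) ≠ 0 := by
      rw [Complex.ofReal_ne_zero]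
      exact (Real.sqrt_pos.mpr (by exact_mod_cast hd)).ne'
    rw [sliceRight_maximallyEntangled hef, smul_smul, mul_inv_cancel₀ hd', one_smul,
      ← e.sum_repr' (sliceRight s χ)]
    refine Finset.sum_congr rfl fun k _ => ?_
    rw [ContinuousLinearMap.adjoint_inner_left, hKf, inner_sliceRight, inner_sliceLeft]

variable {E : (Hi →L[ℂ] Hi) → (Ho →L[ℂ] Ho)}

/-- `1 ⊗ K` acts on the factor that the map leaves alone: the block at `s, s'` after conjugation is
the block at `K† s, K† s'` before. The factor `d` is the product of the two factors `√d`. -/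
theorem ampLeft_pureState_of_contraction (hE : LinearOnTraceClass E) {φ χ : HTensor Hi Hi}
    {K : Hi →L[ℂ] Hi} (hK : ∀ s, sliceRight s χ =
      (Real.sqrt (Module.finrank ℂ Hi) : ℂ) • sliceRight (adjoint K s) φ) :
    ampLeft E (pureState χ) = ((Module.finrank ℂ Hi : ℝ) : ℂ) • (tensorOp (1 : Ho →L[ℂ] Ho) K *
      ampLeft E (pureState φ) * adjoint (tensorOp (1 : Ho →L[ℂ] Ho) K)) := by
  refine ampLeft_eq fun s s' => ?_
  rw [blockRight_smul, blockRight_conj_tensorOp_one, blockRight_ampLeft hE fun _ _ =>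
    mem_traceClass_of_finiteDimensional _, ← hE.map_smul _ _ (mem_traceClass_of_finiteDimensional _),
    blockRight_pureState, blockRight_pureState, hK, hK]
  congr 1
  ext x
  simp only [smul_apply, InnerProductSpace.rankOne_apply, inner_smul_left, Complex.conj_ofReal,
    smul_smul]
  congr 1
  have h : (Real.sqrt (Module.finrank ℂ Hi) : ℂ) * (Real.sqrt (Module.finrank ℂ Hi) : ℂ) =
      ((Module.finrank ℂ Hi : ℝ) : ℂ) := by
    rw [← Complex.ofReal_mul, Real.mul_self_sqrt (Nat.cast_nonneg _)]
  rw [← h]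
  ring

theorem ampLeft_pureState_isPositive (hE : IsChannel E) (φ : HTensor Hi Hi) :
    (ampLeft E (pureState φ)).IsPositive := by
  rw [ampLeft_eq_ofBlocks (stdOrthonormalBasis ℂ Hi) hE.linear fun _ _ =>
    mem_traceClass_of_finiteDimensional _]
  refine ofBlocks_isPositive _ (hE.posMatrix (fun _ _ => mem_traceClass_of_finiteDimensional _) ?_)
  simp only [pureState_eq_op, blockRight_op (SqSum.of_fintype _) (SqSum.of_fintype _)]
  exact posMatrix_op fun _ => SqSum.of_fintype _

theorem trace_ampLeft_pureState (hE : IsDeterministicChannel E) {φ : HTensor Hi Hi}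
    (hφ : ‖φ‖ = 1) : trace (ampLeft E (pureState φ)) = 1 := by
  rw [trace_isDeterministic hE (stdOrthonormalBasis ℂ Hi) (pureState_mem_traceClass φ),
    trace_pureState hφ]

theorem outputState_pureState (hE : IsDeterministicChannel E) {φ : HTensor Hi Hi}
    (hφ : ‖φ‖ = 1) : outputState E (pureState φ) = ampLeft E (pureState φ) := by
  have h : transmissivity E (pureState φ) = 1 := by
    rw [transmissivity, trace_ampLeft_pureState hE hφ, Complex.one_re]
  rw [outputState, if_neg (by rw [h]; exact one_ne_zero), h]
  simp

variable {E₀ : (Hi →L[ℂ] Hi) → (Ho →L[ℂ] Ho)}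

/-- Up to normalization, the outputs at `χ` are those at `φ` conjugated by the contraction `1 ⊗ K`.
As `E₀` preserves the trace, the conjugated ideal output has trace exactly `1/d`, and this weight in
the loss-of-trace estimate becomes the factor `d`. -/
theorem one_sub_fidelity_le (hE : LinearOnTraceClass E) (hE₀ : IsDeterministicChannel E₀)
    (hd : 0 < Module.finrank ℂ Hi) {φ χ : HTensor Hi Hi} (hφ : IsMaximallyEntangled φ)
    (hp : (ampLeft E (pureState φ)).IsPositive) (hχ : ‖χ‖ = 1)
    (ht : transmissivity E (pureState χ) ≠ 0) :
    1 - fidelity (outputState E (pureState χ)) (outputState E₀ (pureState χ)) ≤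
      (Module.finrank ℂ Hi : ℝ) * (1 - choiFidelity φ E E₀) ∧ choiFidelity φ E E₀ ≤ 1 := by
  obtain ⟨K, hK1, hK⟩ := exists_contraction_of_maximallyEntangled hd hφ hχ
  have hφ1 := norm_maximallyEntangled hd hφ
  set G := tensorOp (1 : Ho →L[ℂ] Ho) K with hG
  set d : ℝ := (Module.finrank ℂ Hi : ℝ) with hdd
  have hd0 : 0 < d := Nat.cast_pos.mpr hd
  have hEχ := ampLeft_pureState_of_contraction hE hK
  have hE₀χ := ampLeft_pureState_of_contraction hE₀.toIsChannel.linear hK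
  rw [← hG, ← hdd] at hEχ hE₀χ
  set σ := ampLeft E (pureState φ) with hσ
  set τ := ampLeft E₀ (pureState φ) with hτ
  have hτp : τ.IsPositive := ampLeft_pureState_isPositive hE₀.toIsChannel φ
  have hτ1 : trace τ = 1 := trace_ampLeft_pureState hE₀ hφ1
  set t : ℝ := transmissivity E (pureState φ) with htd
  have htσ : trace σ = t := (ofReal_re_trace hp).symm
  -- If the output at `φ` had trace zero it would vanish, and with it the output at `χ`.
  have ht0 : 0 < t := by
    have h1 : 0 ≤ t := (Complex.nonneg_iff.mp (trace_nonneg_of_isPositive hp)).1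
    refine lt_of_le_of_ne h1 fun h => ht ?_
    have h2 := (norm_le_trace hp (mem_traceClass_of_finiteDimensional σ)).1
    rw [htσ, ← h, Complex.ofReal_zero, Complex.zero_re] at h2
    rw [transmissivity, hEχ, norm_le_zero_iff.mp h2]
    simp [trace]
  have htc : (t : ℂ) ≠ 0 := Complex.ofReal_ne_zero.mpr ht0.ne'
  have hdc : (d : ℂ) ≠ 0 := Complex.ofReal_ne_zero.mpr hd0.ne'
  set ρ := (t : ℂ)⁻¹ • σ with hρ
  have hρp : ρ.IsPositive := smul_inv_isPositive hp ht0.le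
  have hρ1 : trace ρ = 1 := by rw [hρ, trace_smul, htσ, inv_mul_cancel₀ htc]
  have hJ : choiFidelity φ E E₀ = rootFidelity ρ τ ^ 2 := by
    rw [choiFidelity, outputState_pureState hE₀ hφ1, outputState, if_neg ht0.ne', fidelity_eq_sq]
  set s : ℝ := (trace (G * ρ * adjoint G)).re with hs
  have hGρ : (G * ρ * adjoint G).IsPositive := hρp.conj_adjoint G
  have hs1 : trace (G * ρ * adjoint G) = s := (ofReal_re_trace hGρ).symm
  have hσρ : ampLeft E (pureState χ) = ((d * t : ℝ) : ℂ) • (G * ρ * adjoint G) := by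
    rw [hEχ, hρ, mul_smul_comm, smul_mul_assoc, smul_smul, Complex.ofReal_mul,
      mul_assoc (d : ℂ) (t : ℂ), mul_inv_cancel₀ htc, mul_one]
  have htχ : transmissivity E (pureState χ) = d * t * s := by
    rw [transmissivity, hσρ, trace_smul, hs1, ← Complex.ofReal_mul, Complex.ofReal_re]
  have hs0 : 0 < s := by
    have h1 : 0 ≤ s := (Complex.nonneg_iff.mp (trace_nonneg_of_isPositive hGρ)).1
    refine lt_of_le_of_ne h1 fun h => ht ?_
    rw [htχ, ← h, mul_zero]
  have hτt : trace (G * τ * adjoint G) = ((d⁻¹ : ℝ) : ℂ) := by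
    have h1 := trace_ampLeft_pureState hE₀ hχ
    rw [hE₀χ, trace_smul] at h1
    rw [Complex.ofReal_inv]
    exact eq_inv_of_mul_eq_one_right h1
  have key := mul_one_sub_rootFidelity_sq_le hρp hτp hρ1 hτ1 (norm_tensorOp_one_le K hK1) hs1 hτt
    hs0 (inv_pos.mpr hd0)
  have e1 : outputState E (pureState χ) = (s : ℂ)⁻¹ • (G * ρ * adjoint G) := by
    have hne : ((d * t : ℝ) : ℂ) ≠ 0 := Complex.ofReal_ne_zero.mpr (mul_pos hd0 ht0).ne'
    rw [outputState, if_neg ht, hσρ, htχ, smul_smul, Complex.ofReal_mul (d * t), mul_inv,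
      mul_right_comm, inv_mul_cancel₀ hne, one_mul]
  have e2 : outputState E₀ (pureState χ) = ((d⁻¹ : ℝ) : ℂ)⁻¹ • (G * τ * adjoint G) := by
    rw [outputState_pureState hE₀ hχ, hE₀χ, Complex.ofReal_inv, inv_inv]
  rw [← e1, ← e2, ← fidelity_eq_sq, ← hJ, inv_mul_le_iff₀ hd0] at key
  refine ⟨key, ?_⟩
  rw [hJ]
  exact pow_le_one₀ (rootFidelity_nonneg _ _) (rootFidelity_le_one hρp hτp hρ1 hτ1)

theorem finrank_pos_of_norm_eq_one {χ : HTensor Hi Hi} (hχ : ‖χ‖ = 1) :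
    0 < Module.finrank ℂ Hi := by
  by_contra h
  have h0 : Module.finrank ℂ Hi = 0 := by omega
  have := Module.finrank_zero_iff.mp h0
  have h1 : χ = 0 := eq_zero_of_sliceRight fun s => Subsingleton.elim _ _
  rw [h1, norm_zero] at hχ
  exact zero_ne_one hχ

/-- The diamond fidelity is controlled by the Choi fidelity. -/
theorem sqrt_one_sub_diamondFidelity_le (hE : LinearOnTraceClass E)
    (hE₀ : IsDeterministicChannel E₀) {φ : HTensor Hi Hi} (hφ : IsMaximallyEntangled φ)
    (hp : (ampLeft E (pureState φ)).IsPositive) :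
    √(1 - diamondFidelity E E₀) ≤ (Module.finrank ℂ Hi : ℝ) * √(1 - choiFidelity φ E E₀) := by
  have h0 : 0 ≤ (Module.finrank ℂ Hi : ℝ) * √(1 - choiFidelity φ E E₀) :=
    mul_nonneg (Nat.cast_nonneg _) (Real.sqrt_nonneg _)
  refine Real.sqrt_le_iff.mpr ⟨h0, ?_⟩
  rw [sub_le_comm, diamondFidelity]
  refine le_csInf (Set.insert_nonempty _ _) ?_
  rintro x (rfl | ⟨χ, hχ, ht, -, rfl⟩)
  -- The element `1` adjoined to the set of fidelities.
  · linarith [sq_nonneg ((Module.finrank ℂ Hi : ℝ) * √(1 - choiFidelity φ E E₀))]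
  · have hd := finrank_pos_of_norm_eq_one hχ
    obtain ⟨h1, h2⟩ := one_sub_fidelity_le hE hE₀ hd hφ hp hχ ht
    have hd1 : (1 : ℝ) ≤ Module.finrank ℂ Hi := by exact_mod_cast hd
    rw [mul_pow, Real.sq_sqrt (by linarith)]
    -- The factor `d` is weakened to `d²`, using `d ≥ 1` and that the Choi fidelity is at most one.
    nlinarith [mul_nonneg (mul_nonneg (zero_le_one.trans hd1) (sub_nonneg.mpr hd1))
      (sub_nonneg.mpr h2)]

end Diamond

/-! ### The encoding isometry -/

section Encoding

variable {A : Type u} {Hi : Type v}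
  [NormedAddCommGroup A] [InnerProductSpace ℂ A] [CompleteSpace A]
  [NormedAddCommGroup Hi] [InnerProductSpace ℂ Hi] [CompleteSpace Hi] [FiniteDimensional ℂ Hi]

/-- Every isometry `Γ : A → A ⊗ Hi` is inverted by an isometry of `A ⊗ Hi`. -/
theorem exists_encoding (Γ : A →ₗᵢ[ℂ] HTensor A Hi) :
    ∃ (n : ℕ) (Γi : HTensor A Hi →ₗᵢ[ℂ] HTensor A (EuclideanSpace ℂ (Fin n)))
      (e : EuclideanSpace ℂ (Fin n)), ‖e‖ = 1 ∧ ∀ x, Γi (Γ x) = tmul x e := by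
  let b := stdOrthonormalBasis ℂ Hi
  let ε := EuclideanSpace.basisFun (Fin (Module.finrank ℂ Hi + 1)) ℂ
  let Γd := ContinuousLinearMap.adjoint Γ.toContinuousLinearMap
  have hΓ : ∀ x, Γd (Γ x) = x := fun x => ext_inner_left ℂ fun y => by
    rw [ContinuousLinearMap.adjoint_inner_right]
    exact Γ.inner_map_map y x
  let η : HTensor A Hi →L[ℂ] HTensor A Hi := 1 - Γ.toContinuousLinearMap.comp Γd
  have hη : ∀ ξ, η ξ = ξ - Γ (Γd ξ) := fun ξ => rfl
  -- With an extension of dimension `d + 1`, the target is `A ⊕ (A ⊗ Hi)`, and `T` is `(Γ†, 1 - Γ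
  -- Γ†)`. The second entry vanishes on the range of `Γ`, and the squared norms add up to `‖ξ‖²`.
  let T : HTensor A Hi →L[ℂ] HTensor A (EuclideanSpace ℂ (Fin (Module.finrank ℂ Hi + 1))) :=
    (tmulRight (ε 0)).comp Γd + ∑ k, (tmulRight (ε k.succ)).comp ((sliceRight (b k)).comp η)
  have hT : ∀ ξ, T ξ = tmul (Γd ξ) (ε 0) + ∑ k, tmul (sliceRight (b k) (η ξ)) (ε k.succ) :=
    fun ξ => by simp [T]
  have hnorm : ∀ ξ, ‖T ξ‖ = ‖ξ‖ := by
    intro ξ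
    refine (pow_left_inj₀ (norm_nonneg _) (norm_nonneg _) two_ne_zero).mp ?_
    have hε := orthonormal_iff_ite.mp ε.orthonormal
    have h0 : sliceRight (ε 0) (T ξ) = Γd ξ := by
      rw [hT, map_add, map_sum]
      simp [sliceRight_tmul, hε, (Fin.succ_ne_zero _).symm]
    have h1 : ∀ k : Fin (Module.finrank ℂ Hi), sliceRight (ε k.succ) (T ξ) =
        sliceRight (b k) (η ξ) := by
      intro k
      rw [hT, map_add, map_sum]
      simp [sliceRight_tmul, hε]
    rw [← sum_norm_sq_sliceRight ε, Fin.sum_univ_succ, h0]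
    simp only [h1]
    rw [sum_norm_sq_sliceRight b, hη]
    have h2 : (inner ℂ (ξ - Γ (Γd ξ)) (ξ - Γ (Γd ξ)) : ℂ) =
        inner ℂ ξ ξ - inner ℂ (Γd ξ) (Γd ξ) := by
      have h3 : ∀ x, (inner ℂ (Γ x) ξ : ℂ) = inner ℂ x (Γd ξ) := fun x =>
        (ContinuousLinearMap.adjoint_inner_right Γ.toContinuousLinearMap x ξ).symm
      have h4 : (inner ℂ ξ (Γ (Γd ξ)) : ℂ) = inner ℂ (Γd ξ) (Γd ξ) :=
        (ContinuousLinearMap.adjoint_inner_left Γ.toContinuousLinearMap (Γd ξ) ξ).symm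
      rw [inner_sub_left, inner_sub_right, inner_sub_right, h3, h4, Γ.inner_map_map]
      ring
    simp only [inner_self_eq_ofReal] at h2
    have h5 : ‖ξ - Γ (Γd ξ)‖ ^ 2 = ‖ξ‖ ^ 2 - ‖Γd ξ‖ ^ 2 := by exact_mod_cast h2
    rw [h5]
    ring
  refine ⟨_, ⟨(T : HTensor A Hi →ₗ[ℂ] _), hnorm⟩, ε 0, ε.orthonormal.1 0, fun x => ?_⟩
  change T (Γ x) = _
  rw [hT, hη, hΓ, sub_self, Finset.sum_eq_zero, add_zero]
  intro k _
  rw [map_zero]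
  exact map_zero (tmulRight _)

end Encoding

/-! ### Trigonometry -/

/-- With `α = arcsin (Ci / t)` and `β = arcsin Co`, the hypotheses give `cos α ≤ p` and `cos β = q`,
hence `cos (α + β) ≤ g`. The cosine is nonnegative because `α + β ≤ π / 2`, so the inequality can be
squared. -/
theorem sqrt_one_sub_sq_le_sin {t c p q g Ci Co : ℝ} (ht0 : 0 < t) (ht1 : t ≤ 1)
    (hp0 : 0 ≤ p) (hq0 : 0 ≤ q) (hq1 : q ≤ 1) (hp : t * (1 - p ^ 2) ≤ 1 - c ^ 2)
    (hCi0 : 0 ≤ Ci) (hc : 1 - c ^ 2 ≤ Ci ^ 2) (hCit : Ci ≤ t) (hCo : Co = √(1 - q ^ 2))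
    (hg : p * q - √(1 - p ^ 2) * √(1 - q ^ 2) ≤ g)
    (hα : Real.arcsin (Ci / t) + Real.arcsin Co ≤ Real.pi / 2) :
    √(1 - g ^ 2) ≤ Real.sin (Real.arcsin (Ci / t) + Real.arcsin Co) := by
  set s := Ci / t with hs
  have hs0 : 0 ≤ s := div_nonneg hCi0 ht0.le
  have hs1 : s ≤ 1 := (div_le_one ht0).mpr hCit
  have hq2 : q ^ 2 ≤ 1 := pow_le_one₀ hq0 hq1
  have hCo0 : 0 ≤ Co := hCo ▸ Real.sqrt_nonneg _
  have hCo2 : Co ^ 2 = 1 - q ^ 2 := by rw [hCo, Real.sq_sqrt (by linarith)]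
  have hCo1 : Co ≤ 1 := by nlinarith [sq_nonneg q]
  have hcosβ : Real.cos (Real.arcsin Co) = q := by
    rw [Real.cos_arcsin, hCo2, sub_sub_cancel, Real.sqrt_sq hq0]
  have hsinα : Real.sin (Real.arcsin s) = s := Real.sin_arcsin (by linarith) hs1
  have hsinβ : Real.sin (Real.arcsin Co) = Co := Real.sin_arcsin (by linarith) hCo1
  have hps : 1 - p ^ 2 ≤ s ^ 2 := by
    have h1 : t * (1 - p ^ 2) ≤ (s * t) ^ 2 := by
      rw [hs, div_mul_cancel₀ _ ht0.ne']
      exact hp.trans hc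
    -- This gives `1 - p² ≤ t (Ci / t)²`; a factor `t ≤ 1` is then discarded.
    have h2 : t * (1 - p ^ 2) ≤ t * (t * s ^ 2) := by nlinarith
    have h3 := le_of_mul_le_mul_left h2 ht0
    nlinarith [sq_nonneg s]
  have hsq : √(1 - p ^ 2) ≤ s := Real.sqrt_le_iff.mpr ⟨hs0, hps⟩
  have hcosα : Real.cos (Real.arcsin s) ≤ p := by
    rw [Real.cos_arcsin]
    exact Real.sqrt_le_iff.mpr ⟨hp0, by linarith⟩
  have hcos : Real.cos (Real.arcsin s + Real.arcsin Co) ≤ g := by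
    rw [Real.cos_add, hcosβ, hsinα, hsinβ]
    rw [← hCo] at hg
    nlinarith [mul_le_mul_of_nonneg_right hcosα hq0, mul_le_mul_of_nonneg_right hsq hCo0]
  have hα0 : 0 ≤ Real.arcsin s + Real.arcsin Co :=
    add_nonneg (Real.arcsin_nonneg.mpr hs0) (Real.arcsin_nonneg.mpr hCo0)
  have hcos0 : 0 ≤ Real.cos (Real.arcsin s + Real.arcsin Co) :=
    Real.cos_nonneg_of_mem_Icc ⟨by linarith [Real.pi_pos], hα⟩
  refine Real.sqrt_le_iff.mpr ⟨Real.sin_nonneg_of_nonneg_of_le_pi hα0 (by linarith [Real.pi_pos]), ?_⟩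
  nlinarith [Real.sin_sq_add_cos_sq (Real.arcsin s + Real.arcsin Co)]

/-- From `t ≤ Ci² ≤ t² ≤ t` one gets `Ci = t = 1`, so the first angle is already `π / 2` and the
second must be zero. -/
theorem sin_eq_one_of_eq_one {t Ci Co : ℝ} (ht1 : t ≤ 1) (ht0 : 0 < t) (hCo : 0 ≤ Co)
    (hCit : Ci ≤ t) (htC : t ≤ Ci ^ 2) (hCi0 : 0 ≤ Ci)
    (hα : Real.arcsin (Ci / t) + Real.arcsin Co ≤ Real.pi / 2) :
    Real.sin (Real.arcsin (Ci / t) + Real.arcsin Co) = 1 := by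
  have h1 : Ci = 1 := by nlinarith
  have h2 : t = 1 := by linarith
  rw [h1, h2, div_one, Real.arcsin_one] at hα ⊢
  have h3 : Real.arcsin Co = 0 := le_antisymm (by linarith) (Real.arcsin_nonneg.mpr hCo)
  rw [h3, add_zero, Real.sin_pi_div_two]

/-! ### The reference state -/

section Reference

variable {A : Type u} {Hi : Type v} {Ei : Type w}
  [NormedAddCommGroup A] [InnerProductSpace ℂ A] [CompleteSpace A]
  [NormedAddCommGroup Hi] [InnerProductSpace ℂ Hi] [CompleteSpace Hi] [FiniteDimensional ℂ Hi]
  [NormedAddCommGroup Ei] [InnerProductSpace ℂ Ei] [CompleteSpace Ei] [FiniteDimensional ℂ Ei]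
  {ι κ : Type*}

theorem isState_op_self {r : ι → A} (hr : SqSum r) (hr1 : ∑' i, ‖r i‖ ^ 2 = 1) :
    IsState (op r r) := by
  refine ⟨op_self_isPositive hr, ?_⟩
  have h := hasSum_trace (op_mem_traceClass hr hr) (basis A)
  rwa [trace_op_self hr, hr1, Complex.ofReal_one] at h

theorem IsState.exists_op {ρ : A →L[ℂ] A} (hρ : IsState ρ) :
    ∃ x : basisIndex A → A, SqSum x ∧ ρ = op x x ∧ trace ρ = 1 := by
  obtain ⟨x, hx, h⟩ := exists_op_self hρ.1 hρ.2.summable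
  exact ⟨x, hx, h, hρ.2.tsum_eq⟩

/-- The family `r` is `z` divided by its norm. If `z = 0` the overlap is zero for every `r`, and `x`
only serves to provide some unit family. -/
theorem exists_normalized {z x : ι → A} (hz : SqSum z) (hx : SqSum x) (hx0 : ∃ i, x i ≠ 0) :
    ∃ r : ι → A, SqSum r ∧ ∑' i, ‖r i‖ ^ 2 = 1 ∧
      HasSum (fun i => (inner ℂ (r i) (z i) : ℂ)) (√(∑' i, ‖z i‖ ^ 2) : ℝ) := by
  have key : ∀ {y : ι → A}, SqSum y → (∃ i, y i ≠ 0) → 0 < ∑' i, ‖y i‖ ^ 2 ∧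
      SqSum (fun i => ((√(∑' i, ‖y i‖ ^ 2) : ℝ) : ℂ)⁻¹ • y i) ∧
      ∑' i, ‖((√(∑' i, ‖y i‖ ^ 2) : ℝ) : ℂ)⁻¹ • y i‖ ^ 2 = 1 := by
    intro y hy ⟨i, hi⟩
    have hpos : 0 < ∑' i, ‖y i‖ ^ 2 :=
      Summable.tsum_pos hy (fun _ => sq_nonneg _) i (by positivity)
    refine ⟨hpos, hy.smul _, ?_⟩
    simp only [norm_smul, norm_inv, Complex.norm_real, mul_pow, inv_pow,
      Real.norm_of_nonneg (Real.sqrt_nonneg _), Real.sq_sqrt hpos.le, tsum_mul_left]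
    exact inv_mul_cancel₀ hpos.ne'
  by_cases h : ∃ i, z i ≠ 0
  · obtain ⟨hpos, h1, h2⟩ := key hz h
    refine ⟨_, h1, h2, ?_⟩
    have hs : HasSum (fun i => ‖z i‖ ^ 2) (∑' i, ‖z i‖ ^ 2) := Summable.hasSum hz
    have h3 := (Complex.hasSum_ofReal.mpr hs).mul_left ((√(∑' i, ‖z i‖ ^ 2) : ℝ) : ℂ)⁻¹
    rw [← Complex.ofReal_inv, ← Complex.ofReal_mul, inv_mul_eq_div, Real.div_sqrt] at h3
    refine h3.congr_fun fun i => ?_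
    rw [inner_smul_left, inner_self_eq_ofReal, ← Complex.ofReal_inv, Complex.conj_ofReal]
  · push Not at h
    obtain ⟨-, h1, h2⟩ := key hx hx0
    refine ⟨_, h1, h2, ?_⟩
    simp [h, hasSum_zero]

/-- The vectors `∑ₘ (1 ⊗ ⟨eₘ|) Γ wₘ`. -/
def extractedVector [Fintype κ] (Γ : A →ₗᵢ[ℂ] HTensor A Hi) (e : κ → Hi) (w : κ → ι → A) (i : ι) :
    A :=
  ∑ m, sliceRight (e m) (Γ (w m i))

theorem SqSum.extractedVector [Fintype κ] (Γ : A →ₗᵢ[ℂ] HTensor A Hi) (e : κ → Hi) {w : κ → ι → A}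
    (hw : ∀ m, SqSum (w m)) : SqSum (extractedVector Γ e w) :=
  SqSum.sum fun m _ => ((hw m).map Γ.toContinuousLinearMap).map (sliceRight (e m))

/-- Both slicings of `Γ wₘ` have the same coefficient `⟨b ⊗ eₘ, Γ wₘ⟩`; summing over the basis
vectors `b` of `A` is Parseval for the extracted vector. -/
theorem sum_inner_op_extractionFamily [Fintype κ] (Γ : A →ₗᵢ[ℂ] HTensor A Hi) (e : κ → Hi)
    {w : κ → ι → A} (hw : ∀ m, SqSum (w m)) :
    ∑ m, ∑ n, (inner ℂ (e m) (op (extractionFamily Γ (w m)) (extractionFamily Γ (w n)) (e n)) : ℂ) =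
      ((∑' i, ‖extractedVector Γ e w i‖ ^ 2 : ℝ) : ℂ) := by
  have h := hasSum_sum fun m (_ : m ∈ Finset.univ) => hasSum_sum fun n (_ : n ∈ Finset.univ) =>
    hasSum_inner_op ((hw m).extractionFamily Γ) ((hw n).extractionFamily Γ) (e m) (e n)
  have h2 := h.prod_fiberwise (g := fun i => ((‖extractedVector Γ e w i‖ ^ 2 : ℝ) : ℂ)) fun i => by
    rw [← inner_self_eq_ofReal]
    refine ((basis A).hasSum_inner_mul_inner (extractedVector Γ e w i)
      (extractedVector Γ e w i)).congr_fun fun k => ?_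
    rw [mul_comm, extractedVector, inner_sum, sum_inner, Finset.sum_mul_sum]
    refine Finset.sum_congr rfl fun m _ => Finset.sum_congr rfl fun n _ => ?_
    rw [extractionFamily, extractionFamily, inner_sliceLeft, inner_sliceRight,
      ← inner_conj_symm _ (e n), inner_sliceLeft, ← inner_conj_symm _ (basis A k), inner_sliceRight]
  rw [← h2.tsum_eq, Complex.ofReal_tsum]

theorem inner_ofBlocks_localExtraction [Fintype κ] (Γ : A →ₗᵢ[ℂ] HTensor A Hi)
    (f : OrthonormalBasis κ ℂ Hi) {w : κ → ι → A} (hw : ∀ m, SqSum (w m)) (ξ : HTensor Hi Hi) :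
    (inner ℂ ξ (ofBlocks f (fun m n => localExtraction Γ (op (w m) (w n))) ξ) : ℂ) =
      ((∑' i, ‖extractedVector Γ (fun m => sliceRight (f m) ξ) w i‖ ^ 2 : ℝ) : ℂ) := by
  rw [inner_ofBlocks]
  simp only [localExtraction_op Γ (hw _) (hw _)]
  exact sum_inner_op_extractionFamily Γ _ hw

/-- The family `x ⊗ e` with `e` traced out. -/
def paddedFamily (e : Ei) (x : ι → A) (q : ι × basisIndex Ei) : A :=
  sliceRight (basis Ei q.2) (tmul (x q.1) e)

theorem SqSum.paddedFamily {x : ι → A} (hx : SqSum x) (e : Ei) : SqSum (paddedFamily e x) :=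
  (hx.map (tmulRight e)).slices

/-- Padding by a unit vector leaves the operators unchanged, but indexes the true input like the
encoded family, so that their overlap makes sense. -/
theorem op_paddedFamily {x y : ι → A} (hx : SqSum x) (hy : SqSum y) {e : Ei} (he : ‖e‖ = 1) :
    op (paddedFamily e x) (paddedFamily e y) = op x y := by
  refine ((hasSum_op (hx.paddedFamily e) (hy.paddedFamily e)).prod_fiberwise
    (g := fun i => InnerProductSpace.rankOne ℂ (x i) (y i)) fun i => ?_).unique (hasSum_op hx hy)
  have h := ((basis Ei).hasSum_inner_mul_inner e e).smul_const
    (InnerProductSpace.rankOne ℂ (x i) (y i))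
  rw [inner_self_eq_ofReal, he, one_pow, Complex.ofReal_one, one_smul] at h
  refine h.congr_fun fun p => ContinuousLinearMap.ext fun a => ?_
  simp only [paddedFamily, sliceRight_tmul, InnerProductSpace.rankOne_apply, smul_apply, smul_smul,
    inner_smul_left, inner_conj_symm]
  congr 1
  ring

/-- By Parseval in the extension the overlap is a sum of `⟨Γi (rᵢ ⊗ a), xᵢ ⊗ e⟩`. Since `xᵢ ⊗ e = Γi
Γ xᵢ`, the isometry `Γi` drops out: this is where inverting `Γ` is used. -/
theorem hasSum_trace_op_paddedFamily_encodedFamily {Γ : A →ₗᵢ[ℂ] HTensor A Hi}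
    {Γi : HTensor A Hi →ₗᵢ[ℂ] HTensor A Ei} {e : Ei} (h : ∀ x, Γi (Γ x) = tmul x e) {x r : ι → A}
    (hx : SqSum x) (hr : SqSum r) (a : Hi) :
    HasSum (fun i => (inner ℂ (r i) (sliceRight a (Γ (x i))) : ℂ))
      (trace (op (paddedFamily e x) (encodedFamily Γi r a))) := by
  refine ((hasSum_trace_op (hx.paddedFamily e) (hr.encodedFamily Γi a)).prod_fiberwise fun i =>
    hasSum_inner_sliceRight (basis Ei) (Γi (tmul (r i) a)) (tmul (x i) e)).congr_fun fun i => ?_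
  rw [← h, Γi.inner_map_map, inner_sliceRight]

/-- Families realising the two operators that are compared: the given one, with blocks `w`, and the
encoded one, for a reference state `∑ᵢ |rᵢ⟩⟨rᵢ|`. -/
theorem exists_reference [Fintype κ] {Γ : A →ₗᵢ[ℂ] HTensor A Hi}
    {Γi : HTensor A Hi →ₗᵢ[ℂ] HTensor A Ei} {e : Ei} (he : ‖e‖ = 1)
    (h : ∀ x, Γi (Γ x) = tmul x e) (f : OrthonormalBasis κ ℂ Hi) {φ : HTensor Hi Hi} (hφ : ‖φ‖ = 1)
    {w : κ → ι → A} (hw : ∀ m, SqSum (w m)) (hw1 : ∑ m, trace (op (w m) (w m)) = 1) :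
    ∃ (r : ι → A) (c : ℝ) (q : Fin 2 → κ → ι × basisIndex Ei → A), SqSum r ∧
      ∑' i, ‖r i‖ ^ 2 = 1 ∧ 0 ≤ c ∧ (∀ i m, SqSum (q i m)) ∧
      (inner ℂ φ (ofBlocks f (fun m n => localExtraction Γ (op (w m) (w n))) φ) : ℂ).re = c ^ 2 ∧
      (∀ m n, op (q 0 m) (q 0 n) = op (w m) (w n)) ∧
      (q 1 = fun m => encodedFamily Γi r (sliceRight (f m) φ)) ∧
      (∀ i, ∑ m, trace (op (q i m) (q i m)) = 1) ∧ ∑ m, trace (op (q 0 m) (q 1 m)) = c := by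
  have hz := SqSum.extractedVector Γ (fun m => sliceRight (f m) φ) hw
  have hne : ∃ m i, w m i ≠ 0 := by
    by_contra! hn
    refine zero_ne_one (α := ℂ) (hw1 ▸ (Finset.sum_eq_zero fun m _ => ?_).symm)
    rw [trace_op (hw m) (hw m)]
    simp [hn]
  obtain ⟨m₀, hm₀⟩ := hne
  obtain ⟨r, hr, hr1, hrz⟩ := exists_normalized hz (hw m₀) hm₀
  -- `c` is the norm of `z`; `r` is `z / c`, so `⟨r, z⟩ = c`, with any unit family for `r` when `z =
  -- 0`.
  refine ⟨r, √(∑' i, ‖extractedVector Γ (fun m => sliceRight (f m) φ) w i‖ ^ 2),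
    ![fun m => paddedFamily e (w m), fun m => encodedFamily Γi r (sliceRight (f m) φ)], hr,
    hr1, Real.sqrt_nonneg _, ?_, ?_, fun m n => op_paddedFamily (hw m) (hw n) he, rfl, ?_, ?_⟩
  · rw [Fin.forall_fin_two]
    exact ⟨fun m => (hw m).paddedFamily e, fun m => hr.encodedFamily Γi _⟩
  · rw [inner_ofBlocks_localExtraction Γ f hw, Complex.ofReal_re,
      Real.sq_sqrt (tsum_nonneg fun _ => sq_nonneg _)]
  · rw [Fin.forall_fin_two]
    constructor
    · rw [← hw1]
      exact Finset.sum_congr rfl fun m _ => congrArg trace (op_paddedFamily (hw m) (hw m) he)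
    · change ∑ m, trace (op (encodedFamily Γi r (sliceRight (f m) φ)) (encodedFamily Γi r
        (sliceRight (f m) φ))) = 1
      simp only [trace_encodedFamily Γi hr, hr1, one_mul]
      rw [← Complex.ofReal_sum, sum_norm_sq_sliceRight, hφ, one_pow, Complex.ofReal_one]
  · refine (hasSum_sum fun m _ => hasSum_trace_op_paddedFamily_encodedFamily h (hw m) hr
      (sliceRight (f m) φ)).unique (hrz.congr_fun fun i => ?_)
    rw [extractedVector, inner_sum]

end Reference

/-! ### Certification -/

section Certification

variable {A A₂ B Hi Ho : Type*}
  [NormedAddCommGroup A] [InnerProductSpace ℂ A] [CompleteSpace A]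
  [NormedAddCommGroup A₂] [InnerProductSpace ℂ A₂] [CompleteSpace A₂]
  [NormedAddCommGroup B] [InnerProductSpace ℂ B] [CompleteSpace B]
  [NormedAddCommGroup Hi] [InnerProductSpace ℂ Hi] [CompleteSpace Hi] [FiniteDimensional ℂ Hi]
  [NormedAddCommGroup Ho] [InnerProductSpace ℂ Ho] [CompleteSpace Ho] [FiniteDimensional ℂ Ho]
  {ι κ : Type*} [Fintype κ] (f : OrthonormalBasis κ ℂ Hi)
  {E : (A →L[ℂ] A) → (B →L[ℂ] B)}

theorem trace_eq_sum_trace_op_slices {x : ι → HTensor A Hi} (hx : SqSum x) :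
    trace (op x x) =
      ∑ m, trace (op (fun i => sliceRight (f m) (x i)) fun i => sliceRight (f m) (x i)) := by
  rw [trace_eq_sum_blockRight f (op_mem_traceClass hx hx)]
  simp only [blockRight_op hx hx]

/-- The extracted output state, in terms of the blocks of the extracted input state. -/
theorem ampLeft_ampRight_outputState (ΓB : B →ₗᵢ[ℂ] HTensor B Ho) (Γ₂ : A₂ →ₗᵢ[ℂ] HTensor A₂ Hi)
    (hE : IsChannel E) {x : ι → HTensor A A₂} (hx : SqSum x) (ht : transmissivity E (op x x) ≠ 0)
    {w : κ → ι × basisIndex A₂ → A} (hw : w = fun m i => sliceRight (f m) (ancillaFamily Γ₂ x i)) :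
    ampLeft (localExtraction ΓB) (ampRight (localExtraction Γ₂) (outputState E (op x x))) =
        (transmissivity E (op x x) : ℂ)⁻¹ • outputBlocks f ΓB E w w ∧
      trace (outputBlocks f ΓB E w w) = transmissivity E (op x x) := by
  obtain ⟨y, hy, hxy, hb⟩ := exists_op_of_transmissivity_ne_zero hE hx ht
  have hW := hx.ancillaFamily Γ₂
  have hY := hy.ancillaFamily Γ₂
  have hEw : ∀ m n, E (op (w m) (w n)) =
      blockRight (f m) (f n) (op (ancillaFamily Γ₂ y) (ancillaFamily Γ₂ y)) := fun m n => by
    rw [← hE.map_blockRight_ancillaFamily Γ₂ hx hy hb, blockRight_op hW hW, hw]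
  have hY' := op_mem_traceClass hY hY
  constructor
  · rw [outputState, if_neg ht, ampRight_localExtraction_smul Γ₂ hy hxy]
    refine ext_blockRight_basis f fun m n => ?_
    rw [blockRight_ampLeft (localExtraction_linear ΓB)
      fun s s' => blockRight_mem_traceClass (Submodule.smul_mem _ _ hY') s s', blockRight_smul,
      blockRight_smul, (localExtraction_linear ΓB).map_smul _ _ (blockRight_mem_traceClass hY' _ _),
      outputBlocks, blockRight_ofBlocks, hEw]
  · have hwS : ∀ m, SqSum (w m) := fun m => hw ▸ hW.map (sliceRight (f m))
    rw [trace_outputBlocks f ΓB hE hwS hwS, transmissivity, hxy, ofReal_re_trace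
      (op_self_isPositive hy), ← trace_ancillaFamily Γ₂ hy, trace_eq_sum_blockRight f hY']
    simp only [hEw]

/-- The Choi fidelity of the extracted channel, from the overlap of the input families and the
fidelity of the extracted output state. -/
theorem sqrt_one_sub_choiFidelity_le (ΓB : B →ₗᵢ[ℂ] HTensor B Ho) (hE : IsChannel E)
    {q : Fin 2 → κ → ι → A} (hq : ∀ i m, SqSum (q i m))
    (hq1 : ∀ i, ∑ m, trace (op (q i m) (q i m)) = 1) {c : ℝ} (hc0 : 0 ≤ c)
    (hc : ∑ m, trace (op (q 0 m) (q 1 m)) = c) {φ : HTensor Hi Hi} (hφ : ‖φ‖ = 1)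
    {E' E₀ : (Hi →L[ℂ] Hi) → (Ho →L[ℂ] Ho)}
    (hE' : ampLeft E' (pureState φ) = outputBlocks f ΓB E (q 1) (q 1))
    (hE₀ : IsDeterministicChannel E₀) {t Ci Co : ℝ}
    (ht : trace (outputBlocks f ΓB E (q 0) (q 0)) = t) (ht0 : t ≠ 0)
    (hCi0 : 0 ≤ Ci) (hCi : 1 - c ^ 2 ≤ Ci ^ 2) (hCit : Ci ≤ t)
    (hCo : Co = √(1 - fidelity ((t : ℂ)⁻¹ • outputBlocks f ΓB E (q 0) (q 0))
      (ampLeft E₀ (pureState φ))))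
    (hα : Real.arcsin (Ci / t) + Real.arcsin Co ≤ Real.pi / 2) :
    √(1 - choiFidelity φ E' E₀) ≤ Real.sin (Real.arcsin (Ci / t) + Real.arcsin Co) := by
  have hpos := fun i => outputBlocks_isPositive f ΓB hE (hq i)
  have hle := fun i => trace_outputBlocks_le_one f ΓB hE (hq i) (hq1 i)
  have hτ := ampLeft_pureState_isPositive hE₀.toIsChannel φ
  have hτ1 := trace_ampLeft_pureState hE₀ hφ
  set T : Fin 2 → ℝ := fun i => (trace (outputBlocks f ΓB E (q i) (q i))).re with hT
  have hTt : ∀ i, trace (outputBlocks f ΓB E (q i) (q i)) = T i := fun i =>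
    (ofReal_re_trace (hpos i)).symm
  have hT0 : T 0 = t := by simp only [hT, ht, Complex.ofReal_re]
  have hnn : ∀ i, 0 ≤ T i := fun i =>
    (Complex.nonneg_iff.mp (trace_nonneg_of_isPositive (hpos i))).1
  have htpos : 0 < t := lt_of_le_of_ne (hT0 ▸ hnn 0) ht0.symm
  have ht1 : t ≤ 1 := hT0 ▸ hle 0
  have htr : transmissivity E' (pureState φ) = T 1 := by rw [transmissivity, hE']
  have hCo0 : 0 ≤ Co := hCo ▸ Real.sqrt_nonneg _
  -- If the extracted channel transmits nothing, its output is the conventional maximally mixed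
  -- state and only nonnegativity of the fidelity is available. The hypotheses then force the bound
  -- to equal one.
  rcases (hnn 1).eq_or_lt with h1 | h1
  · have h2 := trace_le_of_trace_eq_zero f ΓB hE hq hq1 hc hTt h1.symm
    rw [hT0] at h2
    rw [sin_eq_one_of_eq_one ht1 htpos hCo0 hCit (h2.trans hCi) hCi0 hα, Real.sqrt_le_one]
    rw [choiFidelity, fidelity_eq_sq]
    linarith [sq_nonneg (rootFidelity (outputState E' (pureState φ)) (outputState E₀ (pureState φ)))]
  · have key := mul_one_sub_rootFidelity_outputBlocks_le f ΓB hE hq hq1 hc0 hc hTt hle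
      (hT0 ▸ htpos) h1
    rw [hT0] at key
    have htc : ∀ i, T i ≠ 0 → trace ((T i : ℂ)⁻¹ • outputBlocks f ΓB E (q i) (q i)) = 1 :=
      fun i hi => by rw [trace_smul, hTt, inv_mul_cancel₀ (Complex.ofReal_ne_zero.mpr hi)]
    have h01 := htc 0 (hT0 ▸ ht0)
    rw [hT0] at h01
    have hp0 := smul_inv_isPositive (hpos 0) htpos.le
    -- The true normalized output is the middle point: it is near the extracted output by the
    -- loss-of-trace estimate, and near the ideal output by `Co`.
    have htri := rootFidelity_triangle hp0 (smul_inv_isPositive (hpos 1) h1.le) hτ h01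
      (htc 1 h1.ne') hτ1
    rw [choiFidelity, outputState_pureState hE₀ hφ, outputState, htr, if_neg h1.ne', hE',
      fidelity_eq_sq]
    exact sqrt_one_sub_sq_le_sin htpos ht1 (rootFidelity_nonneg _ _) (rootFidelity_nonneg _ _)
      (rootFidelity_le_one hp0 hτ h01 hτ1) key hCi0 hCi hCit hCo htri hα

theorem ampLeft_localExtraction_op {K : Type*} [NormedAddCommGroup K] [InnerProductSpace ℂ K]
    [CompleteSpace K] (Γ : A →ₗᵢ[ℂ] HTensor A K) {x : ι → HTensor A Hi} (hx : SqSum x) :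
    ampLeft (localExtraction Γ) (op x x) = ofBlocks f (fun m n => localExtraction Γ
        (op (fun i => sliceRight (f m) (x i)) fun i => sliceRight (f n) (x i))) ∧
      (ampLeft (localExtraction Γ) (op x x)).IsPositive := by
  have h : ampLeft (localExtraction Γ) (op x x) = ofBlocks f (fun m n => localExtraction Γ
      (op (fun i => sliceRight (f m) (x i)) fun i => sliceRight (f n) (x i))) := by
    rw [ampLeft_eq_ofBlocks f (localExtraction_linear Γ) fun s s' =>
      blockRight_mem_traceClass (op_mem_traceClass hx hx) s s']
    simp only [blockRight_op hx hx]
  refine ⟨h, h ▸ ofBlocks_isPositive f (localExtraction_posMatrix Γ (fun m n => ?_) ?_)⟩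
  · exact op_mem_traceClass (hx.map (sliceRight (f m))) (hx.map (sliceRight (f n)))
  · exact posMatrix_op fun m => hx.map (sliceRight (f m))

/-- The existence of an input state already excludes `d = 0`, in which case the maximally entangled
vector would not be a unit vector. -/
theorem finrank_pos_of_sum_trace_eq_one {w : Fin (Module.finrank ℂ Hi) → ι → A}
    (hw : ∑ m, trace (op (w m) (w m)) = 1) : 0 < Module.finrank ℂ Hi := by
  by_contra! h
  have : IsEmpty (Fin (Module.finrank ℂ Hi)) := by
    rw [Nat.le_zero.mp h]
    infer_instance
  rw [Finset.univ_eq_empty, Finset.sum_empty] at hw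
  exact zero_ne_one hw

end Certification

end ChannelCert

end

/-! ### The certification theorem -/

theorem mainTheorem1 {A₁ A₂ B Hi Ho : Type*}
    [NormedAddCommGroup A₁] [InnerProductSpace ℂ A₁] [CompleteSpace A₁]
    [NormedAddCommGroup A₂] [InnerProductSpace ℂ A₂] [CompleteSpace A₂]
    [NormedAddCommGroup B] [InnerProductSpace ℂ B] [CompleteSpace B]
    [NormedAddCommGroup Hi] [InnerProductSpace ℂ Hi] [CompleteSpace Hi] [FiniteDimensional ℂ Hi]
    [NormedAddCommGroup Ho] [InnerProductSpace ℂ Ho] [CompleteSpace Ho] [FiniteDimensional ℂ Ho]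
    (ΓA₁ : A₁ →ₗᵢ[ℂ] ChannelCert.HTensor A₁ Hi)
    (ΓA₂ : A₂ →ₗᵢ[ℂ] ChannelCert.HTensor A₂ Hi)
    (ΓB : B →ₗᵢ[ℂ] ChannelCert.HTensor B Ho) :
    ∃ (n : ℕ)
      (Γi : ChannelCert.HTensor A₁ Hi →ₗᵢ[ℂ]
        ChannelCert.HTensor A₁ (EuclideanSpace ℂ (Fin n)))
      (Γo : B →ₗᵢ[ℂ] ChannelCert.HTensor B Ho),
      (∃ e : EuclideanSpace ℂ (Fin n), ‖e‖ = 1 ∧ ∀ x : A₁, Γi (ΓA₁ x) = ChannelCert.tmul x e) ∧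
      Γo = ΓB ∧
      ∀ Φi : ChannelCert.HTensor A₁ A₂ →L[ℂ] ChannelCert.HTensor A₁ A₂,
        ChannelCert.IsState Φi →
      ∀ φ : ChannelCert.HTensor Hi Hi, ChannelCert.IsMaximallyEntangled φ →
      ∃ ρA : A₁ →L[ℂ] A₁, ChannelCert.IsState ρA ∧
      ∀ (E : (A₁ →L[ℂ] A₁) → (B →L[ℂ] B)) (E₀ : (Hi →L[ℂ] Hi) → (Ho →L[ℂ] Ho)),
        ChannelCert.IsChannel E → ChannelCert.IsDeterministicChannel E₀ →
        ChannelCert.transmissivity E Φi ≠ 0 →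
      ∀ (t Ci Co : ℝ) (Eio : (Hi →L[ℂ] Hi) → (Ho →L[ℂ] Ho)),
        t = ChannelCert.transmissivity E Φi →
        Ci = Real.sqrt (1 - ChannelCert.inputFidelity ΓA₁ ΓA₂ Φi φ) →
        Co = Real.sqrt (1 - ChannelCert.outputFidelity ΓB ΓA₂ E E₀ Φi φ) →
        Eio = ChannelCert.extractedChannel Γi Γo ρA E →
        Real.sqrt (1 - ChannelCert.diamondFidelity Eio E₀) ≤
          (Module.finrank ℂ Hi : ℝ) * Real.sqrt (1 - ChannelCert.choiFidelity φ Eio E₀) ∧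
        (Ci ≤ t → Real.arcsin (Ci / t) + Real.arcsin Co ≤ Real.pi / 2 →
          (Module.finrank ℂ Hi : ℝ) * Real.sqrt (1 - ChannelCert.choiFidelity φ Eio E₀) ≤
            (Module.finrank ℂ Hi : ℝ) * Real.sin (Real.arcsin (Ci / t) + Real.arcsin Co) ∧
          (Module.finrank ℂ Hi = 2 →
            1 - 4 * Real.sin (Real.arcsin (Ci / t) + Real.arcsin Co) ^ 2 ≤
              ChannelCert.diamondFidelity Eio E₀)) := by

  open ChannelCert in
  obtain ⟨n, Γi, e, he, hΓi⟩ := exists_encoding ΓA₁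
  refine ⟨n, Γi, ΓB, ⟨e, he, hΓi⟩, rfl, fun Φi hΦ φ hφ => ?_⟩
  obtain ⟨x, hx, rfl, hΦ1⟩ := hΦ.exists_op
  let f := stdOrthonormalBasis ℂ Hi
  have hW := hx.ancillaFamily ΓA₂
  let w : Fin (Module.finrank ℂ Hi) → _ → A₁ := fun m i => sliceRight (f m) (ancillaFamily ΓA₂ x i)
  have hw : ∀ m, SqSum (w m) := fun m => hW.map (sliceRight (f m))
  have hw1 : ∑ m, trace (op (w m) (w m)) = 1 := by
    rw [← hΦ1, ← trace_ancillaFamily ΓA₂ hx, trace_eq_sum_trace_op_slices f hW]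
  have hφ1 := norm_maximallyEntangled (finrank_pos_of_sum_trace_eq_one hw1) hφ
  -- The reference state depends only on the input state and on `φ`; the channels are introduced
  -- afterwards.
  obtain ⟨r, c, q, hr, hr1, hc0, hq, hF, hq0, hqe, hq1, hc⟩ :=
    exists_reference he hΓi f hφ1 hw hw1
  refine ⟨op r r, isState_op_self hr hr1, ?_⟩
  rintro E E₀ hE hE₀ ht t Ci Co Eio rfl rfl rfl rfl
  have hEio := ampLeft_extractedChannel Γi ΓB f hE hr φ
  have hq0' : outputBlocks f ΓB E (q 0) (q 0) = outputBlocks f ΓB E w w := by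
    simp only [outputBlocks, hq0]
  obtain ⟨hout, htr⟩ := ampLeft_ampRight_outputState f ΓB ΓA₂ hE hx ht (w := w) rfl
  rw [← hq0'] at hout htr
  have hdiamond := sqrt_one_sub_diamondFidelity_le
    (extractedChannel_linear Γi ΓB hE (op_mem_traceClass hr hr)) hE₀ hφ
    (hEio ▸ outputBlocks_isPositive f ΓB hE fun m => hr.encodedFamily Γi _)
  refine ⟨hdiamond, fun hCit hα => ?_⟩
  have hCi : 1 - c ^ 2 ≤ √(1 - inputFidelity ΓA₁ ΓA₂ (op x x) φ) ^ 2 := by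
    obtain ⟨h1, h2⟩ := ampLeft_localExtraction_op f ΓA₁ hW
    have h3 := fidelity_pureState_le h2 hφ1
    rw [h1, hF, ← h1, ← ampRight_localExtraction_op ΓA₂ hx] at h3
    change inputFidelity ΓA₁ ΓA₂ (op x x) φ ≤ _ at h3
    -- The square root of a negative number is zero, so both signs are handled and no upper bound on
    -- the fidelity is needed.
    rcases le_total 0 (1 - inputFidelity ΓA₁ ΓA₂ (op x x) φ) with h | h
    · rw [Real.sq_sqrt h]
      linarith
    · linarith [sq_nonneg √(1 - inputFidelity ΓA₁ ΓA₂ (op x x) φ)]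
  have hsin := sqrt_one_sub_choiFidelity_le f ΓB hE hq hq1 hc0 hc hφ1 (by rw [hEio, hqe]) hE₀
    htr ht (Real.sqrt_nonneg _) hCi hCit (by rw [outputFidelity, hout]) hα
  have hd := mul_le_mul_of_nonneg_left hsin (Nat.cast_nonneg (α := ℝ) (Module.finrank ℂ Hi))
  refine ⟨hd, fun hd2 => ?_⟩
  -- Squaring the chain of bounds with `d = 2` produces the constant `4`.
  have h := (Real.sqrt_le_iff.mp (hdiamond.trans hd)).2
  rw [hd2] at h
  push_cast at h
  linarith [mul_pow (2 : ℝ) (Real.sin (Real.arcsin (√(1 - inputFidelity ΓA₁ ΓA₂ (op x x) φ) /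
    transmissivity E (op x x)) + Real.arcsin √(1 - outputFidelity ΓB ΓA₂ E E₀ (op x x) φ))) 2]
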